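/- Let $N\ge 1$, $a\in\mathbb{C}$, and let $\mathbf{r}\in\mathbb{C}^N$ satisfy $\mathbf{r}^*\mathbf{r}=1$. Let $G$ be an $N\times N$ complex Ginibre matrix, that is, with i.i.d. standard complex normal entries (density $\pi^{-1}e^{-|g|^2}$ on $\mathbb{C}$), and consider the normal rank-one deformation $X=G+A$, $A=a\,\mathbf{r}\mathbf{r}^*$. Denote by $z_1,\dots,z_N$ the (almost surely distinct) eigenvalues of $X$ and by $\mathbf{v}_1,\dots,\mathbf{v}_N$ the corresponding right eigenvectors, normalized by $\mathbf{v}_k^*\mathbf{v}_k=1$, with a phase that is averaged uniformly over $[0,2\pi)$. Let $d\mu_H$ be the $U(N)$-invariant probability measure on the unit sphere $\{\mathbf{v}\in\mathbb{C}^N:\mathbf{v}^*\mathbf{v}=1\}$, and put $\Gamma(s,x)=\int_x^\infty t^{s-1}e^{-t}\,dt$. The joint probability density (JPD) $\mathcal{P}_N(z,\mathbf{v})$ of an eigenvalue and its right eigenvector is the density of $\frac1N\big\langle\sum_{k}\delta_{(z_k,\mathbf{v}_k)}\big\rangle_G$ with respect to $d^2z\,d\mu_H(\mathbf{v})$. It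 exists, depends on $\mathbf{v}$ only through $q=|\mathbf{r}^*\mathbf{v}|^2$, and its continuous version on $\mathbb{C}\times\{\mathbf v^*\mathbf v=1\}$ is $\mathcal{P}_N(z,\mathbf{v})=F_N(z,|\mathbf{r}^*\mathbf{v}|^2)$, where $$F_N(z,q)=\frac{1}{\pi N\,\Gamma(N)}\,e^{-q\left(|a|^2-a\overline z-\overline a z\right)}\Big\{\Gamma(N,|z|^2)+\Gamma(N-1,|z|^2)\,(1-q)\big[|a|^2(1-q)-a\overline z-\overline a z\big]\Big\}$$ (for $N=1$ one has $q=1$ on the unit sphere, and the second term is read as $0$). Let now $N\ge 2$. Then the JPD of $z$ and $q=|\mathbf{r}^*\mathbf{v}|^2$ (that is, the density of $\frac1N\big\langle\sum_k\delta_{(z_k,|\mathbf{r}^*\mathbf{v}_k|^2)}\big\rangle_G$ with respect to $d^2z\,dq$ on $\mathbb{C}\times[0,1]$) is $$\mathcal{P}_N(z,q)=(N-1)(1-q)^{N-2}F_N(z,q).$$ The mean eigenvalue density $p_N(z)=\big\langle\sum_{k}\delta^{(2)}(z-z_k)\big\rangle_G$ has the continuous version, given for every $z\in\mathbb{C}$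 by $$p_N(z)=N\int \mathcal{P}_N(z,\mathbf{v})\,d\mu_H(\mathbf{v})=N\int_0^1\mathcal{P}_N(z,q)\,dq$$ $$=\frac{N-1}{\pi\,\Gamma(N)}\Big\{\Gamma(N,|z|^2)\,I^{(0)}(N,\delta)+\Gamma(N-1,|z|^2)\big[|a|^2I^{(2)}(N,\delta)+(\delta-|a|^2)I^{(1)}(N,\delta)\big]\Big\},$$ where $\delta=|a|^2-(a\overline z+\overline a z)$ and $I^{(k)}(N,\delta)=\int_0^1e^{-q\delta}(1-q)^{N+k-2}\,dq$. -/

import Mathlib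

open MeasureTheory ProbabilityTheory
open scoped ENNReal

noncomputable section

/-! ### The complex Ginibre ensemble and its additive deformations -/

/-- The standard complex normal law `N_C(0,1)`: the law of `x + i y`, where `x`, `y` are
independent real centred Gaussians of variance `1/2`. -/
def stdComplexNormal : Measure ℂ :=
  ((gaussianReal 0 (1 / 2)).prod (gaussianReal 0 (1 / 2))).map
    (fun p : ℝ × ℝ => (p.1 : ℂ) + (p.2 : ℂ) * Complex.I)

/-- The complex Ginibre ensemble: the joint law of `N × N` independent standard complex normal
matrix entries. -/
def ginibreUE (N : ℕ) : Measure (Fin N → Fin N → ℂ) :=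
  Measure.pi fun _ => Measure.pi fun _ => stdComplexNormal

/-- The additively deformed matrix `G + A`. -/
def deformedMatrix {N : ℕ} (A : Matrix (Fin N) (Fin N) ℂ) (G : Fin N → Fin N → ℂ) :
    Matrix (Fin N) (Fin N) ℂ :=
  Matrix.of G + A

/-- The normal rank-one matrix `a r r*`. -/
def rankOneNormal {N : ℕ} (a : ℂ) (r : EuclideanSpace ℂ (Fin N)) : Matrix (Fin N) (Fin N) ℂ :=
  Matrix.of fun i j => a * r i * star (r j)

/-! ### Empirical measures of eigenvalues and eigenpairs -/

/-- The normalized `U(N)`-invariant measure on the complex unit sphere `{v : v* v = 1}`, regarded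
as a measure on `ℂ^N` carried by that sphere. -/
def sphereHaar (N : ℕ) : Measure (EuclideanSpace ℂ (Fin N)) :=
  (((volume : Measure (EuclideanSpace ℂ (Fin N))).toSphere Set.univ)⁻¹ •
    (volume : Measure (EuclideanSpace ℂ (Fin N))).toSphere).map Subtype.val

open Classical in
/-- A unit right eigenvector of `X` for the eigenvalue `z` (and `0` if `z` is not an eigenvalue).
If the eigenvalue is simple, it is determined up to a phase factor. -/
def unitEigenvector {N : ℕ} (X : Matrix (Fin N) (Fin N) ℂ) (z : ℂ) : EuclideanSpace ℂ (Fin N) :=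
  if h : ∃ v : EuclideanSpace ℂ (Fin N), ‖v‖ = 1 ∧ Matrix.toEuclideanLin X v = z • v then
    h.choose
  else 0

/-- The law of `e^{iθ} v` for a phase `θ` that is uniform on `[0, 2π)`. -/
def phaseAverage {N : ℕ} (v : EuclideanSpace ℂ (Fin N)) : Measure (EuclideanSpace ℂ (Fin N)) :=
  ((ENNReal.ofReal (2 * Real.pi))⁻¹ •
    (volume : Measure ℝ).restrict (Set.Ico 0 (2 * Real.pi))).map
      (fun θ : ℝ => Complex.exp (θ * Complex.I) • v)

/-- The empirical measure `∑ₐ δ_{zₐ}` of the eigenvalues of `X`. -/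
def eigenvalueMeasure {N : ℕ} (X : Matrix (Fin N) (Fin N) ℂ) : Measure ℂ :=
  (X.charpoly.roots.map fun z => Measure.dirac z).sum

/-- The joint empirical measure `∑ₐ δ_{zₐ} ⊗ δ_{vₐ}` of the eigenvalues and the corresponding
normalized right eigenvectors of `X`, averaged over the phase of the eigenvectors. When the
eigenvalues are distinct it does not depend on how `unitEigenvector` chooses the phases. -/
def eigenpairMeasure {N : ℕ} (X : Matrix (Fin N) (Fin N) ℂ) :
    Measure (ℂ × EuclideanSpace ℂ (Fin N)) :=
  (X.charpoly.roots.map fun z => (Measure.dirac z).prod (phaseAverage (unitEigenvector X z))).sum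

/-! ### Densities of averaged empirical measures -/

/-- `p` is a density, with respect to `ν`, of the average `⟨κ⟩` of the random measure `κ` over the
probability measure `P`: for every measurable `f ≥ 0`, `⟨∫ f dκ⟩ = ∫ f p dν`. -/
def IsMeanDensity {Ω α : Type*} [MeasurableSpace Ω] [MeasurableSpace α] (P : Measure Ω)
    (κ : Ω → Measure α) (ν : Measure α) (p : α → ℝ) : Prop :=
  Measurable p ∧ (∀ᵐ x ∂ν, 0 ≤ p x) ∧
    ∀ f : α → ℝ≥0∞, Measurable f →
      ∫⁻ ω, ∫⁻ x, f x ∂(κ ω) ∂P = ∫⁻ x, f x * ENNReal.ofReal (p x) ∂ν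

/-- `p` is the joint probability density of an eigenvalue `z` and the corresponding normalized
right eigenvector `v` of `G + A`, with respect to `d²z dμ_H(v)`: it is `1/N` times the density of
the averaged joint empirical measure. -/
def IsEigenpairJPD {N : ℕ} (A : Matrix (Fin N) (Fin N) ℂ)
    (p : ℂ × EuclideanSpace ℂ (Fin N) → ℝ) : Prop :=
  IsMeanDensity (ginibreUE N)
    (fun G => (N : ℝ≥0∞)⁻¹ • eigenpairMeasure (deformedMatrix A G))
    ((volume : Measure ℂ).prod (sphereHaar N)) p

/-- `p` is the joint probability density of an eigenvalue `z` and of `q = |r* v|²` (with `v` the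
corresponding normalized right eigenvector) of `G + A`, with respect to `d²z dq` on
`ℂ × [0,1]`. -/
def IsOverlapJPD {N : ℕ} (A : Matrix (Fin N) (Fin N) ℂ) (r : EuclideanSpace ℂ (Fin N))
    (p : ℂ × ℝ → ℝ) : Prop :=
  IsMeanDensity (ginibreUE N)
    (fun G => ((N : ℝ≥0∞)⁻¹ • eigenpairMeasure (deformedMatrix A G)).map
      (fun x => (x.1, ‖inner ℂ r x.2‖ ^ 2)))
    ((volume : Measure ℂ).prod ((volume : Measure ℝ).restrict (Set.Icc 0 1))) p

/-- `p` is the mean eigenvalue density `⟨∑ₐ δ(z - zₐ)⟩` of `G + A` with respect to `d²z`. -/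
def IsMeanEigenvalueDensity {N : ℕ} (A : Matrix (Fin N) (Fin N) ℂ) (p : ℂ → ℝ) : Prop :=
  IsMeanDensity (ginibreUE N) (fun G => eigenvalueMeasure (deformedMatrix A G))
    (volume : Measure ℂ) p

/-! ### The explicit expressions -/

/-- The incomplete Gamma function `Γ(s, x) = ∫_x^∞ t^{s-1} e^{-t} dt`. -/
def incompleteGamma (s x : ℝ) : ℝ :=
  ∫ t in Set.Ioi x, t ^ (s - 1) * Real.exp (-t)

/-- `a z̄ + ā z`, a real number. -/
def crossTerm (a z : ℂ) : ℝ := (a * star z + star a * z).re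

/-- `δ = |a|² - (a z̄ + ā z)`. -/
def deltaParam (a z : ℂ) : ℝ := ‖a‖ ^ 2 - crossTerm a z

/-- `I^{(k)}(N, δ) = ∫_0^1 e^{-qδ} (1-q)^{N+k-2} dq`, for `N ≥ 2`. -/
def overlapIntegral (k N : ℕ) (δ : ℝ) : ℝ :=
  ∫ q in (0 : ℝ)..1, Real.exp (-q * δ) * (1 - q) ^ (N + k - 2)

/-- The explicit joint density of `z` and `v`, as a function of `z` and `q = |r* v|²`. -/
def rankOneJPD (N : ℕ) (a z : ℂ) (q : ℝ) : ℝ :=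
  1 / (N * Real.pi * Real.Gamma N) * Real.exp (-q * (‖a‖ ^ 2 - crossTerm a z)) *
    (incompleteGamma N (‖z‖ ^ 2) +
      incompleteGamma ((N : ℝ) - 1) (‖z‖ ^ 2) * (1 - q) * (‖a‖ ^ 2 * (1 - q) - crossTerm a z))

/-- The explicit joint density of `z` and `q = |r* v|²`, for `N ≥ 2`. -/
def rankOneOverlapJPD (N : ℕ) (a z : ℂ) (q : ℝ) : ℝ :=
  ((N : ℝ) - 1) * (1 - q) ^ (N - 2) * rankOneJPD N a z q

/-- The explicit mean eigenvalue density, for `N ≥ 2`. -/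
def rankOneMeanDensity (N : ℕ) (a z : ℂ) : ℝ :=
  ((N : ℝ) - 1) / (Real.pi * Real.Gamma N) *
    (incompleteGamma N (‖z‖ ^ 2) * overlapIntegral 0 N (deltaParam a z) +
      incompleteGamma ((N : ℝ) - 1) (‖z‖ ^ 2) *
        (‖a‖ ^ 2 * overlapIntegral 2 N (deltaParam a z) +
          (deltaParam a z - ‖a‖ ^ 2) * overlapIntegral 1 N (deltaParam a z)))

end

/-! An eigenpair is made into a coordinate on matrix space. Fix an index `j`. If `X v = z v` with `v
j = 1`, then column `j` of `X` is recovered from `z`, `v` and the other columns. So an array `Y`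
with `z` at place `(j, j)`, the rest of `v` in the rest of column `j`, and the other columns of `X`
elsewhere determines `X = chartMatrix j Y`. The fibre of this map above `X` is the set of eigenpairs
normalized by `v j = 1`, and its real Jacobian is `|χ_X'(z)|²` (`det_chartDeriv`). For almost every
`X` all eigenvalues are simple and no eigenvector has a vanishing `j`-th entry. The area formula
`lintegral_fiberSum` then turns the mean of a sum over eigenpairs into one integral over `Y`
(`lintegral_eigenpair_eq`).

For a fixed eigenpair, the remaining columns are integrated out in a unitary frame `U` whose first
vector is `v / |v|` and whose first two vectors span a space containing `r`. There `X = U B U*`, the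
first column of `B` is `z e₀`, and `χ_X'(z) = det (z - C)` with `C` the lower right corner of `B`.
The change of columns costs `(1 + |u|²)^{-(n+1)}`, where `v = (1, u)` and `N = n + 1`; this is the
Fubini–Study density. The Gaussian weight is unitarily invariant and factorizes. The first column of
`B` gives an explicit exponential and the rest of the first row integrates to 1. The corner is a
Ginibre matrix shifted by a diagonal matrix whose only possibly non-zero entry is `a (1 - q)`.

The second moment of the determinant of a diagonal matrix minus a Ginibre matrix is a permanent,
equal to `∫ ∏ (t + |mᵢ|²) e^{-t} dt` (`lintegral_norm_det_sq_ginibreUE`). Here one factor is `t + |z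
- a(1-q)|²` and the others are `t + |z|²`. The shift `t ↦ t - |z|²` produces the two incomplete
Gamma functions, and the exponents collapse to `-q(|a|² - a z̄ - ā z)`.

Finally, `n!/π^n` times the Fubini–Study density, averaged over the phase, is the invariant
probability measure on the sphere (`lintegral_sphereHaar`), which gives the joint density of `z` and
`v`. Under that measure `q` has density `(N-1)(1-q)^{N-2}` (`lintegral_sphereHaar_overlap`), and
integrating over `q` gives the eigenvalue density. -/

/-! ### The area formula with multiplicities -/

section AreaFormula

variable {E : Type*}

/-- The sum of `h` over the fibre of `F` above `y`. -/
noncomputable def fiberSum (F : E → E) (h : E → ℝ≥0∞) (y : E) : ℝ≥0∞ :=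
  ∑' x : {x // F x = y}, h x

lemma fiberSum_eq_tsum_indicator (F : E → E) (h : E → ℝ≥0∞) (y : E) :
    fiberSum F h y = ∑' x, {x | F x = y}.indicator h x :=
  tsum_subtype {x | F x = y} h

lemma fiberSum_eq_of_injOn {F : E → E} {s : Set E} (hs : Set.InjOn F s) {h : E → ℝ≥0∞}
    (hsupp : ∀ x ∉ s, h x = 0) {x : E} (hx : x ∈ s) : fiberSum F h (F x) = h x := by
  rw [fiberSum_eq_tsum_indicator, tsum_eq_single x]
  · simp
  · intro x' hx'
    by_cases h1 : F x' = F x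
    · by_cases h2 : x' ∈ s
      · exact absurd (hs h2 hx h1) hx'
      · simp [hsupp x' h2]
    · simp [h1]

lemma fiberSum_eq_zero {F : E → E} {s : Set E} {h : E → ℝ≥0∞}
    (hsupp : ∀ x ∉ s, h x = 0) {y : E} (hy : y ∉ F '' s) : fiberSum F h y = 0 := by
  refine ENNReal.tsum_eq_zero.2 fun x => hsupp _ fun hx => hy ⟨x, hx, x.2⟩

variable [NormedAddCommGroup E] [NormedSpace ℝ E] [FiniteDimensional ℝ E]

/-- Inverse function theorem at a regular point. -/
lemma exists_nhds_injOn {F : E → E} (hF : ContDiff ℝ 1 F) {x : E}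
    (hx : (fderiv ℝ F x).det ≠ 0) : ∃ u, IsOpen u ∧ x ∈ u ∧ Set.InjOn F u := by
  have hs : HasStrictFDerivAt F (fderiv ℝ F x) x := hF.contDiffAt.hasStrictFDerivAt one_ne_zero
  have hs' : HasStrictFDerivAt F
      (((fderiv ℝ F x).toContinuousLinearEquivOfDetNeZero hx : E ≃L[ℝ] E) : E →L[ℝ] E) x := by
    simpa using hs
  exact ⟨(hs'.toOpenPartialHomeomorph F).source, (hs'.toOpenPartialHomeomorph F).open_source,
    hs'.mem_toOpenPartialHomeomorph_source, (hs'.toOpenPartialHomeomorph F).injOn⟩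

variable [MeasurableSpace E] [BorelSpace E]

/-- When `h` lives on a set where `F` is injective, at most one point of each fibre contributes, and
the formula is the ordinary change of variables. Measurability is kept in the conclusion because the
general case sums countably many such pieces under the integral. -/
lemma measurable_lintegral_fiberSum_of_injOn (μ : Measure E) [μ.IsAddHaarMeasure] {F : E → E}
    (hF : Differentiable ℝ F) {s : Set E} (hs : MeasurableSet s) (hinj : Set.InjOn F s)
    {h : E → ℝ≥0∞} (hh : Measurable h) (hsupp : ∀ x ∉ s, h x = 0) :
    Measurable (fiberSum F h) ∧
      ∫⁻ y, fiberSum F h y ∂μ = ∫⁻ x, ENNReal.ofReal |(fderiv ℝ F x).det| * h x ∂μ := by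
  have hd : ∀ x ∈ s, HasFDerivWithinAt F (fderiv ℝ F x) s x := fun x _ =>
    (hF x).hasFDerivAt.hasFDerivWithinAt
  have hemb := measurableEmbedding_of_fderivWithin hs hd hinj
  constructor
  · have := hemb.measurable_extend (hh.comp measurable_subtype_coe)
      (measurable_const (a := (0 : ℝ≥0∞)))
    convert this using 1
    funext y
    by_cases hy : y ∈ F '' s
    · obtain ⟨x, hx, rfl⟩ := hy
      rw [fiberSum_eq_of_injOn hinj hsupp hx]
      exact (hemb.injective.extend_apply (h ∘ Subtype.val) (fun _ => 0) ⟨x, hx⟩).symm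
    · rw [fiberSum_eq_zero hsupp hy, Function.extend_apply']
      rintro ⟨a, ha⟩
      exact hy ⟨a, a.2, ha⟩
  · have himg : MeasurableSet (F '' s) := by
      have := hemb.measurableSet_range
      rwa [Set.range_domRestrict] at this
    have h1 : ∫⁻ y, fiberSum F h y ∂μ = ∫⁻ y in F '' s, fiberSum F h y ∂μ := by
      rw [← lintegral_indicator himg]
      refine lintegral_congr fun y => ?_
      by_cases hy : y ∈ F '' s
      · simp [hy]
      · simp [hy, fiberSum_eq_zero hsupp hy]
    have h2 : ∫⁻ x, ENNReal.ofReal |(fderiv ℝ F x).det| * h x ∂μ =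
        ∫⁻ x in s, ENNReal.ofReal |(fderiv ℝ F x).det| * h x ∂μ := by
      rw [← lintegral_indicator hs]
      refine lintegral_congr fun y => ?_
      by_cases hy : y ∈ s
      · simp [hy]
      · simp [hy, hsupp y hy]
    rw [h1, h2, lintegral_image_eq_lintegral_abs_det_fderiv_mul μ hs hd hinj]
    refine setLIntegral_congr_fun hs fun x hx => ?_
    simp only [fiberSum_eq_of_injOn hinj hsupp hx]

/-- The points where the derivative is invertible are covered by countably many disjoint measurable
sets on which the map is injective. -/
lemma exists_disjoint_cover_injOn {F : E → E} (hF : ContDiff ℝ 1 F) :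
    ∃ s : ℕ → Set E, (∀ k, MeasurableSet (s k)) ∧ Pairwise (Function.onFun Disjoint s) ∧
      (∀ k, Set.InjOn F (s k)) ∧ {x | (fderiv ℝ F x).det ≠ 0} = ⋃ k, s k := by
  classical
  set S := {x | (fderiv ℝ F x).det ≠ 0} with hS
  have hSm : MeasurableSet S := by
    have : Continuous fun x => (fderiv ℝ F x).det :=
      ContinuousLinearMap.continuous_det.comp (hF.continuous_fderiv one_ne_zero)
    exact (isOpen_ne_fun this continuous_const).measurableSet
  choose! u hu using fun x (hx : x ∈ S) => exists_nhds_injOn hF hx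
  obtain ⟨t, htS, htc, hcov⟩ := TopologicalSpace.countable_cover_nhdsWithin
    (f := u) (s := S) fun x hx => mem_nhdsWithin_of_mem_nhds ((hu x hx).1.mem_nhds (hu x hx).2.1)
  rcases t.eq_empty_or_nonempty with rfl | hne
  · refine ⟨fun _ => ∅, fun _ => .empty, fun _ _ _ => by simp [Function.onFun], fun _ => by simp, ?_⟩
    simp only [Set.mem_empty_iff_false, Set.iUnion_of_empty, Set.iUnion_empty] at hcov
    simpa using Set.subset_empty_iff.1 hcov
  · obtain ⟨e, rfl⟩ := htc.exists_eq_range hne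
    have heS : ∀ k, e k ∈ S := fun k => htS ⟨k, rfl⟩
    refine ⟨disjointed fun k => S ∩ u (e k), ?_, disjoint_disjointed _, fun k => ?_, ?_⟩
    · exact MeasurableSet.disjointed fun k => hSm.inter (hu _ (heS k)).1.measurableSet
    · exact (hu _ (heS k)).2.2.mono ((disjointed_subset _ _).trans Set.inter_subset_right)
    · rw [iUnion_disjointed, ← Set.inter_iUnion]
      refine (Set.inter_eq_left.2 ?_).symm
      simpa using hcov

/-- The area formula: `∫ ∑_{F x = y} h x dy = ∫ |det DF x| h x dx`. -/
theorem lintegral_fiberSum (μ : Measure E) [μ.IsAddHaarMeasure] {F : E → E}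
    (hF : ContDiff ℝ 1 F) {h : E → ℝ≥0∞} (hh : Measurable h) :
    ∫⁻ y, fiberSum F h y ∂μ = ∫⁻ x, ENNReal.ofReal |(fderiv ℝ F x).det| * h x ∂μ := by
  obtain ⟨s, hsm, hdisj, hinj, hcov⟩ := exists_disjoint_cover_injOn hF
  have hd := hF.differentiable one_ne_zero
  -- Sard's theorem in equal dimensions: critical values are negligible. Critical points thus drop
  -- out of the left side, and on the right their weight is zero.
  have hnull : μ (F '' {x | (fderiv ℝ F x).det = 0}) = 0 :=
    addHaar_image_eq_zero_of_det_fderivWithin_eq_zero μ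
      (fun x _ => (hd x).hasFDerivAt.hasFDerivWithinAt) (fun x hx => hx)
  have hk := fun k => measurable_lintegral_fiberSum_of_injOn μ hd (hsm k) (hinj k)
    (hh.indicator (hsm k)) (fun x hx => Set.indicator_of_notMem hx h)
  have hsum : ∀ x, (fderiv ℝ F x).det ≠ 0 → ∑' k, (s k).indicator h x = h x := by
    intro x hx
    obtain ⟨k, hxk⟩ := Set.mem_iUnion.1 (hcov ▸ hx : x ∈ ⋃ k, s k)
    rw [tsum_eq_single k, Set.indicator_of_mem hxk]
    intro j hj
    exact Set.indicator_of_notMem (Set.disjoint_left.1 (hdisj hj.symm) hxk) h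
  -- Off the critical values every point of the fibre is regular, hence lies in exactly one of the
  -- pieces `s k`.
  have h1 : ∫⁻ y, fiberSum F h y ∂μ = ∫⁻ y, ∑' k, fiberSum F ((s k).indicator h) y ∂μ := by
    refine lintegral_congr_ae ?_
    filter_upwards [compl_mem_ae_iff.2 hnull] with y hy
    simp only [fiberSum]
    rw [ENNReal.tsum_comm]
    refine tsum_congr fun x => (hsum x fun hx => hy ⟨x, hx, x.2⟩).symm
  rw [h1, lintegral_tsum fun k => (hk k).1.aemeasurable]
  simp_rw [fun k => (hk k).2]
  rw [← lintegral_tsum]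
  · refine lintegral_congr fun x => ?_
    rw [ENNReal.tsum_mul_left]
    by_cases hx : (fderiv ℝ F x).det = 0
    · simp [hx]
    · rw [hsum x hx]
  · intro k
    have : Measurable fun x => (fderiv ℝ F x).det :=
      (ContinuousLinearMap.continuous_det.comp (hF.continuous_fderiv one_ne_zero)).measurable
    exact ((this.abs.ennreal_ofReal).mul (hh.indicator (hsm k))).aemeasurable

end AreaFormula

/-! ### Linear changes of variables -/

/-- The real determinant of a complex-linear map is the squared modulus of its complex determinant.
-/
lemma lintegral_comp_linearMap {E : Type*} [NormedAddCommGroup E] [NormedSpace ℂ E]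
    [NormedSpace ℝ E] [IsScalarTower ℝ ℂ E]
    [FiniteDimensional ℝ E] [MeasurableSpace E] [BorelSpace E] (μ : Measure E) [μ.IsAddHaarMeasure]
    (L : E →ₗ[ℂ] E) (hL : LinearMap.det L ≠ 0) (f : E → ℝ≥0∞) :
    ∫⁻ x, f x ∂μ = ENNReal.ofReal (‖LinearMap.det L‖ ^ 2) * ∫⁻ x, f (L x) ∂μ := by
  have hdet : LinearMap.det (L.restrictScalars ℝ) = ‖LinearMap.det L‖ ^ 2 := by
    rw [LinearMap.det_restrictScalars, Algebra.norm_complex_eq]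
    simp [Complex.normSq_eq_norm_sq]
  have h0 : LinearMap.det (L.restrictScalars ℝ) ≠ 0 := by
    rw [hdet]; positivity
  have hpos : 0 < ‖LinearMap.det L‖ ^ 2 := by positivity
  let e := ((L.restrictScalars ℝ).equivOfDetNeZero h0).toContinuousLinearEquiv.toHomeomorph
  have he : ∀ x, e x = L x := fun x => rfl
  have hmap := Measure.map_linearMap_addHaar_eq_smul_addHaar μ h0
  have h3 : ∫⁻ x, f x ∂(Measure.map (L.restrictScalars ℝ) μ) = ∫⁻ x, f (L x) ∂μ :=
    lintegral_map_equiv f e.toMeasurableEquiv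
  rw [← h3, hmap, lintegral_smul_measure, hdet, smul_eq_mul, ← mul_assoc, ← ENNReal.ofReal_mul hpos.le,
    abs_of_pos (inv_pos.2 hpos), mul_inv_cancel₀ hpos.ne', ENNReal.ofReal_one, one_mul]

/-! ### Parametrization of matrices by an eigenpair and the remaining columns -/

section EigenChart

variable {N : ℕ}

/-- The vector with `j`-th entry `1` and the other entries taken from the `j`-th column of `Y`. -/
def chartVec (j : Fin N) (Y : Fin N → Fin N → ℂ) : Fin N → ℂ :=
  fun i => if i = j then 1 else Y i j

/-- The matrix that agrees with `Y` outside the `j`-th column and has `chartVec j Y` as an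
eigenvector for the eigenvalue `Y j j`. -/
def chartMatrix (j : Fin N) (Y : Fin N → Fin N → ℂ) : Fin N → Fin N → ℂ :=
  fun i k => if k = j then Y j j * chartVec j Y i - ∑ l ∈ Finset.univ.erase j, Y i l * chartVec j Y l
    else Y i k

lemma chartVec_self (j : Fin N) (Y : Fin N → Fin N → ℂ) : chartVec j Y j = 1 := by simp [chartVec]

lemma chartMatrix_mulVec (j : Fin N) (Y : Fin N → Fin N → ℂ) :
    (Matrix.of (chartMatrix j Y)).mulVec (chartVec j Y) = Y j j • chartVec j Y := by
  funext i
  simp only [Matrix.mulVec, dotProduct, Matrix.of_apply, Pi.smul_apply, smul_eq_mul]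
  rw [← Finset.add_sum_erase _ _ (Finset.mem_univ j), chartVec_self]
  have : ∑ l ∈ Finset.univ.erase j, chartMatrix j Y i l * chartVec j Y l =
      ∑ l ∈ Finset.univ.erase j, Y i l * chartVec j Y l :=
    Finset.sum_congr rfl fun l hl => by simp [chartMatrix, Finset.ne_of_mem_erase hl]
  rw [this]
  simp [chartMatrix]

/-- The inverse of `chartMatrix` for a given eigenpair. -/
def chartInv (j : Fin N) (X : Fin N → Fin N → ℂ) (z : ℂ) (v : Fin N → ℂ) : Fin N → Fin N → ℂ :=
  fun i k => if k = j then (if i = j then z else v i) else X i k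

lemma chartVec_chartInv {j : Fin N} {X : Fin N → Fin N → ℂ} {z : ℂ} {v : Fin N → ℂ}
    (hv : v j = 1) : chartVec j (chartInv j X z v) = v := by
  funext i
  by_cases h : i = j
  · subst h; simp [chartVec, hv]
  · simp [chartVec, chartInv, h]

/-- Because `v j = 1`, the eigenvalue equation can be solved for column `j`. Together with
`chartInv_chartMatrix` this identifies the fibre of `chartMatrix j` above `X` with the eigenpairs
normalized by `v j = 1`. -/
lemma chartMatrix_chartInv {j : Fin N} {X : Fin N → Fin N → ℂ} {z : ℂ} {v : Fin N → ℂ}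
    (hv : v j = 1) (h : (Matrix.of X).mulVec v = z • v) :
    chartMatrix j (chartInv j X z v) = X := by
  funext i k
  by_cases hk : k = j
  · subst hk
    have h1 := congrFun h i
    simp only [Matrix.mulVec, dotProduct, Matrix.of_apply, Pi.smul_apply, smul_eq_mul] at h1
    rw [← Finset.add_sum_erase _ _ (Finset.mem_univ k), hv, mul_one] at h1
    simp only [chartMatrix, if_true, chartVec_chartInv hv]
    have : ∑ l ∈ Finset.univ.erase k, chartInv k X z v i l * v l =
        ∑ l ∈ Finset.univ.erase k, X i l * v l :=
      Finset.sum_congr rfl fun l hl => by simp [chartInv, Finset.ne_of_mem_erase hl]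
    have h0 : chartInv k X z v k k = z := by simp [chartInv]
    rw [this, h0]
    linear_combination -h1
  · simp [chartMatrix, chartInv, hk]

lemma chartInv_chartMatrix (j : Fin N) (Y : Fin N → Fin N → ℂ) :
    chartInv j (chartMatrix j Y) (Y j j) (chartVec j Y) = Y := by
  funext i k
  by_cases hk : k = j
  · by_cases hi : i = j
    · simp [chartInv, hk, hi]
    · simp [chartInv, hk, hi, chartVec]
  · simp [chartInv, chartMatrix, hk]

lemma contDiff_chartMatrix (j : Fin N) : ContDiff ℝ 1 (chartMatrix j) := by
  have hc : ∀ i k, ContDiff ℝ 1 fun Y : Fin N → Fin N → ℂ => Y i k := fun i k =>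
    contDiff_apply_apply ℝ ℂ i k
  have hv : ∀ i, ContDiff ℝ 1 fun Y : Fin N → Fin N → ℂ => chartVec j Y i := by
    intro i
    by_cases h : i = j
    · simpa [chartVec, h] using contDiff_const
    · simpa [chartVec, h] using hc i j
  refine contDiff_pi.2 fun i => contDiff_pi.2 fun k => ?_
  by_cases h : k = j
  · simp only [chartMatrix, h, if_true]
    exact ((hc _ _).mul (hv _)).sub (ContDiff.sum fun l _ => (hc _ _).mul (hv _))
  · simpa [chartMatrix, h] using hc i k

/-- If `X v = z v` with `v j = 1`, then `χ_X(t) = (t - z) det(t - X with j-th column v)`. -/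
lemma derivative_charpoly_eval {j : Fin N} {X : Matrix (Fin N) (Fin N) ℂ} {z : ℂ} {v : Fin N → ℂ}
    (hv : v j = 1) (h : X.mulVec v = z • v) :
    X.charpoly.derivative.eval z = (Matrix.updateCol (z • (1 : Matrix _ _ ℂ) - X) j v).det := by
  -- As `v j = 1`, replacing column `j` of `t - X` by `(t - X) v` is a column operation and keeps
  -- the determinant. Since `(t - X) v = (t - z) v`, a factor `t - z` comes out, and the derivative
  -- at `z` is the value of the cofactor.
  have key : X.charpoly = (Polynomial.X - Polynomial.C z) *
      (Matrix.updateCol X.charmatrix j (fun i => Polynomial.C (v i))).det := by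
    rw [← Matrix.det_updateCol_smul, Matrix.charpoly]
    have h2 : (Polynomial.X - Polynomial.C z) • (fun i => Polynomial.C (v i)) =
        X.charmatrix.mulVec fun i => Polynomial.C (v i) := by
      funext i
      have h1 := congrArg Polynomial.C (congrFun h i)
      simp only [Matrix.mulVec, dotProduct, map_sum, map_mul, Pi.smul_apply, smul_eq_mul] at h1 ⊢
      simp only [Matrix.charmatrix, Matrix.sub_apply, Matrix.scalar_apply, sub_mul,
        Finset.sum_sub_distrib, RingHom.mapMatrix_apply, Matrix.map_apply, h1]
      simp [Matrix.diagonal_apply]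
    rw [h2]
    have h3 := Matrix.det_updateCol_sum X.charmatrix j (fun i => Polynomial.C (v i))
    simp only [hv, map_one, one_smul] at h3
    rw [← h3]
    congr 2
    funext i
    simp [Matrix.mulVec, dotProduct, mul_comm]
  rw [key]
  simp only [Polynomial.derivative_mul, Polynomial.derivative_sub, Polynomial.derivative_X,
    Polynomial.derivative_C, Polynomial.eval_add, Polynomial.eval_mul, Polynomial.eval_sub,
    Polynomial.eval_X, Polynomial.eval_C, sub_self, zero_mul, add_zero, sub_zero,
    one_mul]
  rw [← Polynomial.coe_evalRingHom, RingHom.map_det]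
  congr 1
  ext i k
  by_cases hk : k = j
  · subst hk; simp
  · simp [Matrix.updateCol_ne hk, Matrix.charmatrix, Matrix.diagonal_apply, Matrix.one_apply,
      apply_ite]

/-- The complex derivative of `chartMatrix`. -/
noncomputable def chartDeriv (j : Fin N) (Y : Fin N → Fin N → ℂ) :
    (Fin N → Fin N → ℂ) →ₗ[ℂ] (Fin N → Fin N → ℂ) where
  toFun H := fun i k => if k = j then
      H j j * chartVec j Y i + Y j j * (if i = j then 0 else H i j) -
        ∑ l ∈ Finset.univ.erase j, (H i l * chartVec j Y l + Y i l * H l j)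
    else H i k
  map_add' H K := by
    funext i k
    by_cases hk : k = j
    · by_cases hi : i = j <;>
        simp [hk, hi, mul_add, add_mul, Finset.sum_add_distrib] <;> ring
    · simp [hk]
  map_smul' c H := by
    funext i k
    by_cases hk : k = j
    · by_cases hi : i = j <;>
        simp [hk, hi, mul_sub, mul_add, Finset.mul_sum] <;>
        simp [mul_left_comm, mul_assoc]
    · simp [hk]

lemma hasFDerivAt_chartMatrix (j : Fin N) (Y : Fin N → Fin N → ℂ) :
    HasFDerivAt (chartMatrix j)
      ((LinearMap.toContinuousLinearMap (chartDeriv j Y)).restrictScalars ℝ) Y := by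
  refine HasFDerivAt.restrictScalars ℝ ?_
  let p : Fin N → Fin N → ((Fin N → Fin N → ℂ) →L[ℂ] ℂ) := fun i k =>
    (ContinuousLinearMap.proj k).comp (ContinuousLinearMap.proj (R := ℂ) (φ := fun _ => Fin N → ℂ) i)
  have hc : ∀ i k, HasFDerivAt (fun Y : Fin N → Fin N → ℂ => Y i k) (p i k) Y := fun i k =>
    (p i k).hasFDerivAt
  have hv : ∀ i, HasFDerivAt (fun Y : Fin N → Fin N → ℂ => chartVec j Y i)
      (if i = j then 0 else p i j) Y := by
    intro i
    by_cases h : i = j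
    · simpa [chartVec, h] using hasFDerivAt_const (1 : ℂ) Y
    · simpa [chartVec, h] using hc i j
  refine hasFDerivAt_pi'.2 fun i => hasFDerivAt_pi'.2 fun k => ?_
  by_cases h : k = j
  · simp only [chartMatrix, h, if_true]
    refine (((hc j j).mul (hv i)).sub (HasFDerivAt.fun_sum fun l (hl : l ∈ Finset.univ.erase j) =>
      (hc i l).mul (hv l))).congr_fderiv ?_
    ext1 H
    have hsum : ∑ l ∈ Finset.univ.erase j, ((if l = j then 0 else Y i l * H l j) +
        chartVec j Y l * H i l) =
        ∑ l ∈ Finset.univ.erase j, (H i l * chartVec j Y l + Y i l * H l j) :=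
      Finset.sum_congr rfl fun l hl => by simp [Finset.ne_of_mem_erase hl, add_comm, mul_comm]
    simp [chartDeriv, p, -Finset.sum_erase_eq_sub,
      apply_ite (fun q : (Fin N → Fin N → ℂ) →L[ℂ] ℂ => q H), hsum]
    ring
  · simp only [chartMatrix, h, if_false]
    refine (hc i k).congr_fderiv ?_
    ext1 H
    simp [chartDeriv, h, p]

/-- The derivative is block triangular. It preserves the subspace `W` of perturbations supported in
column `j`, and it is the identity on the quotient because the other columns are copied unchanged.
On `W ≅ ℂ^N` it is the matrix `z - X` with column `j` replaced by `chartVec j Y`, which is the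
determinant of `derivative_charpoly_eval`. -/
lemma det_chartDeriv (j : Fin N) (Y : Fin N → Fin N → ℂ) :
    LinearMap.det (chartDeriv j Y) =
      (Matrix.of (chartMatrix j Y)).charpoly.derivative.eval (Y j j) := by
  let W : Submodule ℂ (Fin N → Fin N → ℂ) :=
    { carrier := {H | ∀ i k, k ≠ j → H i k = 0}
      add_mem' := fun ha hb i k hk => by simp [ha i k hk, hb i k hk]
      zero_mem' := fun i k hk => rfl
      smul_mem' := fun c H hH i k hk => by simp [hH i k hk] }
  have hW : W ≤ W.comap (chartDeriv j Y) := fun H hH i k hk => by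
    simpa [chartDeriv, hk] using hH i k hk
  have hQ : W.mapQ W (chartDeriv j Y) hW = LinearMap.id := by
    refine Submodule.linearMap_qext _ (LinearMap.ext fun H => ?_)
    simp only [LinearMap.comp_apply, Submodule.mkQ_apply, Submodule.mapQ_apply, LinearMap.id_apply]
    refine (Submodule.Quotient.eq W).2 fun i k hk => ?_
    simp [chartDeriv, hk]
  let e : W ≃ₗ[ℂ] (Fin N → ℂ) :=
    { toFun := fun H i => H.1 i j
      map_add' := fun _ _ => rfl
      map_smul' := fun _ _ => rfl
      invFun := fun h => ⟨fun i k => if k = j then h i else 0, fun i k hk => by simp [hk]⟩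
      left_inv := fun H => by
        ext i k
        by_cases hk : k = j
        · simp [hk]
        · simp [hk, H.2 i k hk]
      right_inv := fun h => by ext; simp }
  rw [LinearMap.det_eq_det_mul_det W _ hW, hQ, LinearMap.det_id, mul_one,
    derivative_charpoly_eval (chartVec_self j Y) (chartMatrix_mulVec j Y),
    ← LinearMap.det_conj _ e, ← LinearMap.det_toLin']
  congr 1
  refine LinearMap.ext fun h => funext fun i => ?_
  simp only [LinearMap.comp_apply, LinearEquiv.coe_coe, Matrix.toLin'_apply, Matrix.mulVec,
    dotProduct]
  rw [← Finset.add_sum_erase _ _ (Finset.mem_univ j)]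
  have h1 : ∀ l ∈ Finset.univ.erase j,
      (Matrix.updateCol (Y j j • (1 : Matrix (Fin N) (Fin N) ℂ) - Matrix.of (chartMatrix j Y)) j
        (chartVec j Y)) i l * h l = (if i = l then Y j j * h l else 0) - Y i l * h l := by
    intro l hl
    have := Finset.ne_of_mem_erase hl
    by_cases hil : i = l <;> simp [chartMatrix, this, hil, sub_mul]
  have h2 : ∀ l ∈ Finset.univ.erase j, (if l = j then h i else 0) * chartVec j Y l + Y i l * h l =
      Y i l * h l := by
    intro l hl
    simp [Finset.ne_of_mem_erase hl]
  rw [Finset.sum_congr rfl h1, Finset.sum_sub_distrib]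
  simp only [e, chartDeriv, LinearEquiv.coe_symm_mk, LinearMap.restrict_apply, LinearEquiv.coe_mk,
    LinearMap.coe_mk, AddHom.coe_mk, if_true, Matrix.updateCol_self]
  rw [Finset.sum_congr rfl h2, Finset.sum_ite_eq]
  by_cases hi : i = j
  · simp [hi, mul_comm]; ring
  · simp [hi, mul_comm]; ring

lemma ofReal_abs_det_fderiv_chartMatrix (j : Fin N) (Y : Fin N → Fin N → ℂ) :
    |(fderiv ℝ (chartMatrix j) Y).det| =
      ‖(Matrix.of (chartMatrix j Y)).charpoly.derivative.eval (Y j j)‖ ^ 2 := by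
  rw [(hasFDerivAt_chartMatrix j Y).fderiv, ← det_chartDeriv, ContinuousLinearMap.det]
  have : (((LinearMap.toContinuousLinearMap (chartDeriv j Y)).restrictScalars ℝ :
      (Fin N → Fin N → ℂ) →L[ℝ] (Fin N → Fin N → ℂ)) : (Fin N → Fin N → ℂ) →ₗ[ℝ] _) =
      (chartDeriv j Y).restrictScalars ℝ := rfl
  rw [this, LinearMap.det_restrictScalars, Algebra.norm_complex_eq]
  simp [Complex.normSq_eq_norm_sq]

end EigenChart

instance isAddHaarMeasure_volume_pi_pi {ι κ : Type*} [Fintype ι] [Fintype κ] :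
    (volume : Measure (ι → κ → ℂ)).IsAddHaarMeasure := by
  have : ∀ _ : ι, (volume : Measure (κ → ℂ)).IsAddHaarMeasure := fun _ => inferInstance
  exact Measure.pi.isAddHaarMeasure _

section EigenpairFiber

variable {N : ℕ}

/-! ### Phase averages -/

/-- The average of `g (e^{iθ} v)` over `θ`. -/
noncomputable def phaseMean (g : EuclideanSpace ℂ (Fin N) → ℝ≥0∞) (v : EuclideanSpace ℂ (Fin N)) :
    ℝ≥0∞ :=
  (ENNReal.ofReal (2 * Real.pi))⁻¹ *
    ∫⁻ θ in Set.Ico 0 (2 * Real.pi), g (Complex.exp ((θ : ℝ) * Complex.I) • v)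

lemma lintegral_phaseAverage {g : EuclideanSpace ℂ (Fin N) → ℝ≥0∞} (hg : Measurable g)
    (v : EuclideanSpace ℂ (Fin N)) : ∫⁻ x, g x ∂(phaseAverage v) = phaseMean g v := by
  have hm : Measurable fun θ : ℝ => Complex.exp (θ * Complex.I) • v := by fun_prop
  rw [phaseAverage, lintegral_map hg hm, lintegral_smul_measure]
  rfl

/-- Multiplication by `c` translates `θ` by `arg c`, and the integrand is `2π`-periodic. This makes
the phase chosen by `unitEigenvector` irrelevant. -/
lemma phaseMean_smul (g : EuclideanSpace ℂ (Fin N) → ℝ≥0∞) (v : EuclideanSpace ℂ (Fin N)) {c : ℂ}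
    (hc : ‖c‖ = 1) : phaseMean g (c • v) = phaseMean g v := by
  have hT : (0 : ℝ) < 2 * Real.pi := by positivity
  have hper : Function.Periodic
      (fun θ : ℝ => g (Complex.exp (θ * Complex.I) • v)) (2 * Real.pi) := by
    intro θ
    have := Complex.exp_mul_I_periodic (θ : ℂ)
    simp only at this ⊢
    rw [← this]
    push_cast
    rfl
  have hc' : c = Complex.exp (c.arg * Complex.I) := by
    conv_lhs => rw [← Complex.norm_mul_exp_arg_mul_I c, hc]
    simp
  unfold phaseMean
  congr 1
  have h1 : ∀ θ : ℝ, g (Complex.exp (θ * Complex.I) • c • v) =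
      g (Complex.exp (((θ + c.arg : ℝ) : ℂ) * Complex.I) • v) := by
    intro θ
    rw [smul_smul]
    nth_rw 1 [hc']
    rw [← Complex.exp_add, ← add_mul]
    push_cast
    rfl
  simp_rw [h1]
  have h2 : ∫⁻ θ in Set.Ico 0 (2 * Real.pi),
      g (Complex.exp (((θ + c.arg : ℝ) : ℂ) * Complex.I) • v) =
      ∫⁻ θ in Set.Ico c.arg (c.arg + 2 * Real.pi), g (Complex.exp ((θ : ℂ) * Complex.I) • v) := by
    have hmp := measurePreserving_add_right (volume : Measure ℝ) c.arg
    rw [← hmp.setLIntegral_comp_preimage_emb (measurableEmbedding_addRight c.arg)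
      (fun θ : ℝ => g (Complex.exp ((θ : ℂ) * Complex.I) • v)) (Set.Ico c.arg (c.arg + 2 * Real.pi))]
    congr 3
    ext θ
    simp
  rw [h2, restrict_Ico_eq_restrict_Ioc, restrict_Ico_eq_restrict_Ioc]
  have h3 := (isAddFundamentalDomain_Ioc hT c.arg volume).setLIntegral_eq
    (isAddFundamentalDomain_Ioc hT 0 volume)
    (fun θ : ℝ => g (Complex.exp ((θ : ℂ) * Complex.I) • v)) (hper.map_vadd_zmultiples)
  rw [h3, zero_add]

lemma phaseMean_of_invariant {g : EuclideanSpace ℂ (Fin N) → ℝ≥0∞} {v : EuclideanSpace ℂ (Fin N)}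
    (h : ∀ c : ℂ, ‖c‖ = 1 → g (c • v) = g v) : phaseMean g v = g v := by
  have hT : (0 : ℝ) < 2 * Real.pi := by positivity
  unfold phaseMean
  simp_rw [fun θ : ℝ => h _ (Complex.norm_exp_ofReal_mul_I θ)]
  rw [setLIntegral_const, Real.volume_Ico, sub_zero, mul_comm, mul_assoc, ENNReal.mul_inv_cancel,
    mul_one]
  · simpa using hT
  · exact ENNReal.ofReal_ne_top

lemma measurable_phaseMean {f : ℂ × EuclideanSpace ℂ (Fin N) → ℝ≥0∞} (hf : Measurable f) :
    Measurable fun x : ℂ × EuclideanSpace ℂ (Fin N) => phaseMean (fun v => f (x.1, v)) x.2 := by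
  unfold phaseMean
  refine Measurable.const_mul ?_ _
  have : Measurable fun p : (ℂ × EuclideanSpace ℂ (Fin N)) × ℝ =>
      f (p.1.1, Complex.exp (p.2 * Complex.I) • p.1.2) := by fun_prop
  exact this.lintegral_prod_right'

/-! ### Integrals against the empirical measures -/

lemma lintegral_multiset_sum {α β : Type*} [MeasurableSpace α] (s : Multiset β) (m : β → Measure α)
    (f : α → ℝ≥0∞) : ∫⁻ x, f x ∂(s.map m).sum = (s.map fun b => ∫⁻ x, f x ∂(m b)).sum := by
  induction s using Multiset.induction_on with
  | empty => simp
  | cons b s ih => simp [lintegral_add_measure, ih]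

instance phaseAverage_isFinite (v : EuclideanSpace ℂ (Fin N)) :
    IsFiniteMeasure (phaseAverage v) := by
  have : IsFiniteMeasure ((ENNReal.ofReal (2 * Real.pi))⁻¹ •
      (volume : Measure ℝ).restrict (Set.Ico 0 (2 * Real.pi))) := by
    refine ⟨?_⟩
    rw [Measure.smul_apply, Measure.restrict_apply_univ, Real.volume_Ico, smul_eq_mul]
    refine ENNReal.mul_lt_top ?_ ENNReal.ofReal_lt_top
    simp [Real.pi_pos]
  unfold phaseAverage
  infer_instance

lemma lintegral_eigenpairMeasure {f : ℂ × EuclideanSpace ℂ (Fin N) → ℝ≥0∞} (hf : Measurable f)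
    (X : Matrix (Fin N) (Fin N) ℂ) :
    ∫⁻ x, f x ∂(eigenpairMeasure X) =
      (X.charpoly.roots.map fun z => phaseMean (fun v => f (z, v)) (unitEigenvector X z)).sum := by
  rw [eigenpairMeasure, lintegral_multiset_sum]
  congr 2
  funext z
  rw [lintegral_prod _ hf.aemeasurable, lintegral_dirac' _ hf.lintegral_prod_right',
    lintegral_phaseAverage (by fun_prop)]

/-- The unit vector in the direction of `u`. -/
noncomputable def unitDir (u : Fin N → ℂ) : EuclideanSpace ℂ (Fin N) :=
  ((‖WithLp.toLp 2 u‖⁻¹ : ℝ) : ℂ) • WithLp.toLp 2 u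

lemma norm_unitDir {u : Fin N → ℂ} (hu : u ≠ 0) : ‖unitDir u‖ = 1 := by
  have : WithLp.toLp 2 u ≠ 0 := by simpa using hu
  rw [unitDir, norm_smul]
  simp only [Complex.ofReal_inv, norm_inv, Complex.norm_real, norm_norm]
  exact inv_mul_cancel₀ (norm_ne_zero_iff.2 this)

lemma measurable_unitDir : Measurable (unitDir : (Fin N → ℂ) → EuclideanSpace ℂ (Fin N)) := by
  unfold unitDir
  have h : Measurable fun u : Fin N → ℂ => (WithLp.toLp 2 u : EuclideanSpace ℂ (Fin N)) :=
    (PiLp.continuous_toLp 2 _).measurable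
  exact (Complex.measurable_ofReal.comp h.norm.inv).smul h

lemma exists_eigenvector {X : Matrix (Fin N) (Fin N) ℂ} {z : ℂ} (hz : z ∈ X.charpoly.roots) :
    ∃ v : Fin N → ℂ, v ≠ 0 ∧ X.mulVec v = z • v := by
  have h := (Polynomial.mem_roots'.1 hz).2
  rw [Polynomial.IsRoot, Matrix.eval_charpoly] at h
  obtain ⟨v, hv, hv'⟩ := Matrix.exists_mulVec_eq_zero_iff.2 h
  refine ⟨v, hv, ?_⟩
  rw [Matrix.sub_mulVec, sub_eq_zero] at hv'
  rw [← hv']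
  simp [Matrix.scalar_apply, ← Matrix.smul_one_eq_diagonal, Matrix.smul_mulVec]

lemma unitEigenvector_spec {X : Matrix (Fin N) (Fin N) ℂ} {z : ℂ} {v : Fin N → ℂ} (hv : v ≠ 0)
    (h : X.mulVec v = z • v) :
    ‖unitEigenvector X z‖ = 1 ∧
      X.mulVec (WithLp.ofLp (unitEigenvector X z)) = z • WithLp.ofLp (unitEigenvector X z) := by
  have hex : ∃ v : EuclideanSpace ℂ (Fin N), ‖v‖ = 1 ∧ Matrix.toEuclideanLin X v = z • v := by
    refine ⟨unitDir v, norm_unitDir hv, ?_⟩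
    rw [unitDir, map_smul, Matrix.toLpLin_apply]
    simp only [h]
    rw [WithLp.toLp_smul, smul_comm]
  have h2 := hex.choose_spec
  rw [unitEigenvector, dif_pos hex]
  refine ⟨h2.1, ?_⟩
  have := congrArg WithLp.ofLp h2.2
  simpa [Matrix.toLpLin_apply] using this

/-- For a matrix whose eigenvectors all have non-zero `j`-th entry and all of whose eigenvalues are
simple, the joint empirical measure is a sum over the fibre of `chartMatrix j`. -/
lemma lintegral_eigenpairMeasure_eq_fiberSum {f : ℂ × EuclideanSpace ℂ (Fin N) → ℝ≥0∞}
    (hf : Measurable f) (j : Fin N) {X : Fin N → Fin N → ℂ}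
    (h1 : ∀ (z : ℂ) (v : Fin N → ℂ), v ≠ 0 → (Matrix.of X).mulVec v = z • v → v j ≠ 0)
    (h2 : ∀ Y, chartMatrix j Y = X → (Matrix.of X).charpoly.derivative.eval (Y j j) ≠ 0) :
    ∫⁻ x, f x ∂(eigenpairMeasure (Matrix.of X)) =
      fiberSum (chartMatrix j)
        (fun Y => phaseMean (fun v => f (Y j j, v)) (unitDir (chartVec j Y))) X := by
  set p := (Matrix.of X).charpoly with hp
  have hp0 : p ≠ 0 := (Matrix.charpoly_monic _).ne_zero
  have hex : ∀ z ∈ p.roots, ∃ v : Fin N → ℂ, v j = 1 ∧ (Matrix.of X).mulVec v = z • v := by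
    intro z hz
    obtain ⟨v, hv, hv'⟩ := exists_eigenvector hz
    have hj := h1 z v hv hv'
    refine ⟨(v j)⁻¹ • v, by simp [hj], ?_⟩
    rw [Matrix.mulVec_smul, hv', smul_comm]
  -- The difference of two distinct normalized eigenvectors for `z` would be an eigenvector with
  -- zero `j`-th entry.
  have huniq : ∀ (z : ℂ) (v w : Fin N → ℂ), v j = 1 → w j = 1 → (Matrix.of X).mulVec v = z • v →
      (Matrix.of X).mulVec w = z • w → v = w := by
    intro z v w hv hw hv' hw'
    by_contra hne
    refine h1 z (v - w) (sub_ne_zero.2 hne) ?_ (by simp [hv, hw])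
    rw [Matrix.mulVec_sub, hv', hw', smul_sub]
  have hchart : ∀ Y, chartMatrix j Y = X →
      (Matrix.of X).mulVec (chartVec j Y) = Y j j • chartVec j Y := fun Y hY => by
    rw [← hY]; exact chartMatrix_mulVec j Y
  have hne : ∀ v : Fin N → ℂ, v j = 1 → v ≠ 0 := fun v hv h0 => by simp [h0] at hv
  have hroot : ∀ Y, chartMatrix j Y = X → Y j j ∈ p.roots := by
    intro Y hY
    rw [Polynomial.mem_roots hp0, Polynomial.IsRoot, hp, Matrix.eval_charpoly]
    refine Matrix.exists_mulVec_eq_zero_iff.1 ⟨chartVec j Y, hne _ (chartVec_self j Y), ?_⟩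
    rw [Matrix.sub_mulVec, hchart Y hY]
    simp [Matrix.scalar_apply, ← Matrix.smul_one_eq_diagonal, Matrix.smul_mulVec]
  -- A multiple root is a zero of the derivative of the characteristic polynomial, which `h2`
  -- excludes at every point of the fibre.
  have hnodup : p.roots.Nodup := by
    rw [Multiset.nodup_iff_count_le_one]
    intro z
    by_contra! hlt
    have hz : z ∈ p.roots := Multiset.count_pos.1 (by omega)
    obtain ⟨v, hv, hv'⟩ := hex z hz
    have h3 := h2 _ (chartMatrix_chartInv hv hv')
    rw [Polynomial.count_roots] at hlt
    have h4 := (Polynomial.one_lt_rootMultiplicity_iff_isRoot hp0).1 hlt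
    apply h3
    simpa [chartInv] using h4.2
  rw [lintegral_eigenpairMeasure hf]
  choose! w hw1 hw2 using hex
  let e : {Y // chartMatrix j Y = X} ≃ {z // z ∈ (⟨p.roots, hnodup⟩ : Finset ℂ)} :=
    { toFun := fun Y => ⟨Y.1 j j, hroot Y.1 Y.2⟩
      invFun := fun z => ⟨chartInv j X z (w z), chartMatrix_chartInv (hw1 z z.2) (hw2 z z.2)⟩
      left_inv := fun Y => by
        refine Subtype.ext ?_
        have h5 : w (Y.1 j j) = chartVec j Y.1 := huniq (Y.1 j j) _ _ (hw1 _ (hroot Y.1 Y.2))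
          (chartVec_self j _) (hw2 _ (hroot Y.1 Y.2)) (hchart Y.1 Y.2)
        simp only [h5]
        conv_rhs => rw [← chartInv_chartMatrix j Y.1, Y.2]
      right_inv := fun z => by simp [chartInv] }
  rw [fiberSum, ← e.symm.tsum_eq, tsum_fintype]
  have hval : ∀ z : {z // z ∈ (⟨p.roots, hnodup⟩ : Finset ℂ)},
      phaseMean (fun v => f ((e.symm z).1 j j, v)) (unitDir (chartVec j (e.symm z).1)) =
        phaseMean (fun v => f (z.1, v)) (unitEigenvector (Matrix.of X) z.1) := by
    rintro ⟨z, hz⟩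
    have hz' : z ∈ p.roots := hz
    simp only [e, Equiv.coe_fn_symm_mk, chartVec_chartInv (hw1 z hz')]
    have hjj : chartInv j X z (w z) j j = z := by simp [chartInv]
    rw [hjj]
    obtain ⟨hu1, hu2⟩ := unitEigenvector_spec (hne _ (hw1 z hz')) (hw2 z hz')
    set u := unitEigenvector (Matrix.of X) z with hu
    have hu0 : WithLp.ofLp u ≠ 0 := by
      intro h0
      have : u = 0 := by simpa using h0
      simp [this] at hu1
    have hjne := h1 z _ hu0 hu2
    -- The chart vector is the unit eigenvector divided by its `j`-th entry, so after normalization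
    -- the two differ by a phase, which `phaseMean` does not see.
    have hcol : w z = (u j)⁻¹ • WithLp.ofLp u := by
      refine huniq z _ _ (hw1 z hz') (by simp [hjne]) (hw2 z hz') ?_
      rw [Matrix.mulVec_smul, hu2, smul_comm]
    have hdir : unitDir (w z) = (((‖(u j)⁻¹‖⁻¹ : ℝ) : ℂ) * (u j)⁻¹) • u := by
      rw [unitDir, hcol, WithLp.toLp_smul, norm_smul, smul_smul]
      simp [hu1]
    rw [hdir, phaseMean_smul]
    simp [hjne]
  simp_rw [hval]
  exact (Finset.sum_attach (⟨p.roots, hnodup⟩ : Finset ℂ)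
    (fun z => phaseMean (fun v => f (z, v)) (unitEigenvector (Matrix.of X) z))).symm

/-! ### Genericity -/

/-- An eigenvector with `v j = 0` has some `v k ≠ 0`. Normalizing `v k = 1` exhibits `X` as the
image under `chartMatrix k` of an array in the proper subspace `Y j k = 0`. A differentiable map
between spaces of equal dimension sends null sets to null sets, and there are finitely many `k`. -/
lemma ae_eigenvector_apply_ne_zero (j : Fin N) :
    ∀ᵐ X : Fin N → Fin N → ℂ, ∀ (z : ℂ) (v : Fin N → ℂ), v ≠ 0 →
      (Matrix.of X).mulVec v = z • v → v j ≠ 0 := by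
  have hnull : ∀ k : Fin N, k ≠ j →
      volume (chartMatrix k '' {Y : Fin N → Fin N → ℂ | Y j k = 0}) = 0 := by
    intro k hk
    refine addHaar_image_eq_zero_of_differentiableOn_of_addHaar_eq_zero volume
      ((contDiff_chartMatrix k).differentiable one_ne_zero).differentiableOn ?_
    let S : Submodule ℝ (Fin N → Fin N → ℂ) :=
      { carrier := {Y | Y j k = 0}
        add_mem' := fun {a b} ha hb => by
          simp only [Set.mem_ofPred_eq] at ha hb ⊢
          simp [ha, hb]
        zero_mem' := rfl
        smul_mem' := fun c Y hY => by
          simp only [Set.mem_ofPred_eq] at hY ⊢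
          simp [hY] }
    have hS : S ≠ ⊤ := by
      intro h
      have : (fun _ _ => 1 : Fin N → Fin N → ℂ) ∈ S := h ▸ Submodule.mem_top
      exact one_ne_zero this
    exact Measure.addHaar_submodule volume S hS
  have hU : volume (⋃ k ∈ {k : Fin N | k ≠ j},
      chartMatrix k '' {Y : Fin N → Fin N → ℂ | Y j k = 0}) = 0 :=
    (measure_biUnion_null_iff (Set.to_countable _)).2 hnull
  filter_upwards [compl_mem_ae_iff.2 hU] with X hX z v hv hXv hvj
  obtain ⟨k, hk⟩ := Function.ne_iff.1 hv
  have hkj : k ≠ j := fun h => hk (by rw [h, hvj]; rfl)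
  have hk' : v k ≠ 0 := hk
  refine hX (Set.mem_biUnion (x := k) hkj ⟨chartInv k X z ((v k)⁻¹ • v), ?_, ?_⟩)
  · simp [chartInv, hkj.symm, hvj]
  · refine chartMatrix_chartInv (by simp [hk']) ?_
    rw [Matrix.mulVec_smul, hXv, smul_comm]

/-- By the Jacobian formula the excluded matrices are exactly the critical values of `chartMatrix
j`, a null set by Sard's theorem. -/
lemma ae_derivative_charpoly_ne_zero (j : Fin N) :
    ∀ᵐ X : Fin N → Fin N → ℂ, ∀ Y, chartMatrix j Y = X →
      (Matrix.of X).charpoly.derivative.eval (Y j j) ≠ 0 := by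
  have hnull := addHaar_image_eq_zero_of_det_fderivWithin_eq_zero (volume)
    (s := {Y : Fin N → Fin N → ℂ | (fderiv ℝ (chartMatrix j) Y).det = 0}) (fun Y _ =>
      ((contDiff_chartMatrix j).differentiable one_ne_zero Y).hasFDerivAt.hasFDerivWithinAt)
    (fun Y hY => hY)
  filter_upwards [compl_mem_ae_iff.2 hnull] with X hX Y hY h0
  refine hX ⟨Y, ?_, hY⟩
  have := ofReal_abs_det_fderiv_chartMatrix j Y
  rw [hY, h0] at this
  simpa using this

/-- The integrated form of the eigenpair statistics. -/
lemma lintegral_eigenpair_eq (j : Fin N) {f : ℂ × EuclideanSpace ℂ (Fin N) → ℝ≥0∞}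
    (hf : Measurable f) {ρ : (Fin N → Fin N → ℂ) → ℝ≥0∞} (hρ : Measurable ρ) :
    ∫⁻ X : Fin N → Fin N → ℂ, ρ X * ∫⁻ x, f x ∂(eigenpairMeasure (Matrix.of X)) =
      ∫⁻ Y : Fin N → Fin N → ℂ, ENNReal.ofReal
        (‖(Matrix.of (chartMatrix j Y)).charpoly.derivative.eval (Y j j)‖ ^ 2) *
        (ρ (chartMatrix j Y) *
          phaseMean (fun v => f (Y j j, v)) (unitDir (chartVec j Y))) := by
  have hc : Measurable (chartMatrix j : (Fin N → Fin N → ℂ) → _) :=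
    (contDiff_chartMatrix j).continuous.measurable
  have hv : Measurable (chartVec j : (Fin N → Fin N → ℂ) → _) := by
    refine measurable_pi_lambda _ fun i => ?_
    by_cases h : i = j
    · simp [chartVec, h]
    · simp only [chartVec, h, if_false]; fun_prop
  have hm : Measurable fun Y : Fin N → Fin N → ℂ => ρ (chartMatrix j Y) *
      phaseMean (fun v => f (Y j j, v)) (unitDir (chartVec j Y)) := by
    refine (hρ.comp hc).mul ?_
    have h0 : Measurable fun Y : Fin N → Fin N → ℂ => (Y j j, unitDir (chartVec j Y)) :=
      Measurable.prodMk (by fun_prop) (measurable_unitDir.comp hv)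
    exact (measurable_phaseMean hf).comp h0
  have hA := lintegral_fiberSum volume (contDiff_chartMatrix j) hm
  simp_rw [ofReal_abs_det_fderiv_chartMatrix] at hA
  rw [← hA]
  refine lintegral_congr_ae ?_
  filter_upwards [ae_eigenvector_apply_ne_zero j, ae_derivative_charpoly_ne_zero j] with X h1 h2
  rw [lintegral_eigenpairMeasure_eq_fiberSum hf j h1 h2]
  simp only [fiberSum]
  rw [← ENNReal.tsum_mul_left]
  exact tsum_congr fun Y => by rw [Y.2]

end EigenpairFiber

/-! ### Products of densities -/

lemma lintegral_pi_prod {n : ℕ} {α : Type*} [MeasurableSpace α] (μ : Measure α) [SigmaFinite μ]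
    {f : Fin n → α → ℝ≥0∞} (hf : ∀ i, Measurable (f i)) :
    ∫⁻ x, ∏ i, f i (x i) ∂(Measure.pi fun _ : Fin n => μ) = ∏ i, ∫⁻ x, f i x ∂μ := by
  induction n with
  | zero => simp
  | succ n ih =>
    have hmp := measurePreserving_piFinSuccAbove (fun _ : Fin (n + 1) => μ) 0
    rw [Fin.prod_univ_succ, ← ih fun i => hf i.succ,
      ← lintegral_prod_mul (hf 0).aemeasurable (Finset.measurable_fun_prod _ fun i _ =>
        (hf i.succ).comp (measurable_pi_apply i)).aemeasurable, ← hmp.map_eq, lintegral_map_equiv]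
    refine lintegral_congr fun x => ?_
    rw [Fin.prod_univ_succ]
    rfl

lemma pi_withDensity {n : ℕ} {α : Type*} [MeasurableSpace α] (μ : Measure α) [SigmaFinite μ]
    {f : α → ℝ≥0∞} (hf : Measurable f) [SigmaFinite (μ.withDensity f)] :
    (Measure.pi fun _ : Fin n => μ.withDensity f) =
      (Measure.pi fun _ : Fin n => μ).withDensity fun x => ∏ i, f (x i) := by
  refine Measure.pi_eq (μ := fun _ : Fin n => μ.withDensity f) fun s hs => ?_
  rw [withDensity_apply _ (MeasurableSet.univ_pi hs),
    ← lintegral_indicator (MeasurableSet.univ_pi hs)]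
  have h : ∀ x : Fin n → α, (Set.univ.pi s).indicator (fun x => ∏ i, f (x i)) x =
      ∏ i, (s i).indicator f (x i) := by
    intro x
    by_cases hx : x ∈ Set.univ.pi s
    · rw [Set.indicator_of_mem hx]
      exact Finset.prod_congr rfl fun i _ => (Set.indicator_of_mem (hx i trivial) f).symm
    · rw [Set.indicator_of_notMem hx]
      simp only [Set.mem_pi, Set.mem_univ, true_implies, not_forall] at hx
      obtain ⟨i, hi⟩ := hx
      exact (Finset.prod_eq_zero (Finset.mem_univ i) (Set.indicator_of_notMem hi f)).symm
  simp_rw [h]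
  rw [lintegral_pi_prod μ fun i => hf.indicator (hs i)]
  exact Finset.prod_congr rfl fun i _ => by
    rw [lintegral_indicator (hs i), withDensity_apply _ (hs i)]

/-! ### The Ginibre density -/

/-- The density of the standard complex normal law. -/
noncomputable def normalDensity (z : ℂ) : ℝ≥0∞ :=
  ENNReal.ofReal (Real.pi⁻¹ * Real.exp (-‖z‖ ^ 2))

lemma measurable_normalDensity : Measurable normalDensity := by
  unfold normalDensity; fun_prop

lemma stdComplexNormal_eq_withDensity : stdComplexNormal = volume.withDensity normalDensity := by
  have hpdf := measurable_gaussianPDF 0 (1 / 2)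
  have hne : (1 / 2 : NNReal) ≠ 0 := by norm_num
  have hs : SFinite (volume.withDensity (gaussianPDF 0 (1 / 2))) := inferInstance
  rw [stdComplexNormal, gaussianReal_of_var_ne_zero _ hne, prod_withDensity hpdf hpdf,
    ← Measure.volume_eq_prod]
  have hfun : (fun p : ℝ × ℝ => (p.1 : ℂ) + (p.2 : ℂ) * Complex.I) =
      Complex.measurableEquivRealProd.symm := by
    funext p
    simp [Complex.measurableEquivRealProd_symm_apply, Complex.mk_eq_add_mul_I]
  rw [hfun]
  have hvol := Complex.volume_preserving_equiv_real_prod.symm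
  refine Measure.ext fun s hs => ?_
  rw [MeasurableEquiv.map_apply, withDensity_apply _ (Complex.measurableEquivRealProd.symm.measurable hs),
    withDensity_apply _ hs, ← hvol.setLIntegral_comp_preimage_emb
      Complex.measurableEquivRealProd.symm.measurableEmbedding]
  refine lintegral_congr fun p => ?_
  simp only [normalDensity, gaussianPDF, gaussianPDFReal]
  rw [← ENNReal.ofReal_mul (by positivity)]
  congr 1
  rw [mul_mul_mul_comm, ← Real.exp_add]
  have hn : ‖Complex.measurableEquivRealProd.symm p‖ ^ 2 = p.1 ^ 2 + p.2 ^ 2 := by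
    rw [← Complex.normSq_eq_norm_sq, Complex.measurableEquivRealProd_symm_apply, Complex.normSq_mk]
    ring
  rw [hn]
  congr 1
  · rw [← mul_inv, ← Real.sqrt_mul (by positivity), Real.sqrt_mul_self (by positivity)]
    norm_num
    field_simp
  · congr 1
    norm_num
    ring

instance stdComplexNormal_isProbability : IsProbabilityMeasure stdComplexNormal := by
  unfold stdComplexNormal
  exact Measure.isProbabilityMeasure_map (by fun_prop)

lemma lintegral_normalDensity : ∫⁻ z, normalDensity z = 1 := by
  have h := stdComplexNormal_isProbability.measure_univ
  rw [stdComplexNormal_eq_withDensity, withDensity_apply _ .univ, Measure.restrict_univ] at h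
  exact h

/-- The density of the complex Ginibre ensemble. -/
noncomputable def ginibreDensity {m n : ℕ} (X : Fin m → Fin n → ℂ) : ℝ≥0∞ :=
  ∏ i, ∏ j, normalDensity (X i j)

lemma measurable_ginibreDensity {m n : ℕ} :
    Measurable (ginibreDensity : (Fin m → Fin n → ℂ) → ℝ≥0∞) := by
  unfold ginibreDensity
  have := measurable_normalDensity
  fun_prop

lemma ginibreDensity_eq {m n : ℕ} (X : Fin m → Fin n → ℂ) :
    ginibreDensity X =
      ENNReal.ofReal (Real.pi⁻¹ ^ (m * n) * Real.exp (-∑ i, ∑ j, ‖X i j‖ ^ 2)) := by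
  have hp : ∀ z : ℂ, 0 ≤ Real.pi⁻¹ * Real.exp (-‖z‖ ^ 2) := fun z => by positivity
  unfold ginibreDensity normalDensity
  have h1 : ∀ i, ∏ j, ENNReal.ofReal (Real.pi⁻¹ * Real.exp (-‖X i j‖ ^ 2)) =
      ENNReal.ofReal (∏ j, (Real.pi⁻¹ * Real.exp (-‖X i j‖ ^ 2))) := fun i =>
    (ENNReal.ofReal_prod_of_nonneg fun j _ => hp _).symm
  simp_rw [h1]
  rw [← ENNReal.ofReal_prod_of_nonneg fun i _ => Finset.prod_nonneg fun j _ => hp _]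
  congr 1
  simp only [Finset.prod_mul_distrib, Finset.prod_const, Finset.card_univ, Fintype.card_fin,
    ← Real.exp_sum, ← pow_mul, Finset.sum_neg_distrib, mul_comm m n]

lemma ginibreUE_eq_withDensity (N : ℕ) : ginibreUE N = volume.withDensity ginibreDensity := by
  have h1 : (Measure.pi fun _ : Fin N => stdComplexNormal) =
      volume.withDensity fun x : Fin N → ℂ => ∏ i, normalDensity (x i) := by
    have : SigmaFinite ((volume : Measure ℂ).withDensity normalDensity) := by
      rw [← stdComplexNormal_eq_withDensity]; infer_instance
    rw [stdComplexNormal_eq_withDensity, pi_withDensity _ measurable_normalDensity, volume_pi]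
  have hm : Measurable fun x : Fin N → ℂ => ∏ i, normalDensity (x i) := by
    have := measurable_normalDensity
    fun_prop
  have : SigmaFinite (volume.withDensity fun x : Fin N → ℂ => ∏ i, normalDensity (x i)) := by
    rw [← h1]; infer_instance
  rw [ginibreUE]
  simp_rw [h1]
  rw [pi_withDensity _ hm]
  rfl

lemma lintegral_ginibreUE (N : ℕ) (Φ : (Fin N → Fin N → ℂ) → ℝ≥0∞) :
    ∫⁻ G, Φ G ∂(ginibreUE N) = ∫⁻ X, ginibreDensity X * Φ X := by
  rw [ginibreUE_eq_withDensity, lintegral_withDensity_eq_lintegral_mul_non_measurable _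
    measurable_ginibreDensity]
  · rfl
  · refine .of_forall fun X => ?_
    rw [ginibreDensity_eq]
    exact ENNReal.ofReal_lt_top

/-! ### Moments of the standard complex normal law -/

lemma memLp_id_stdComplexNormal : MemLp (fun z : ℂ => z) 2 stdComplexNormal := by
  have h1 : MemLp (fun p : ℝ × ℝ => ((p.1 : ℝ) : ℂ)) 2
      ((gaussianReal 0 (1 / 2)).prod (gaussianReal 0 (1 / 2))) :=
    ((memLp_id_gaussianReal 2).comp_fst _).ofReal
  have h2 : MemLp (fun p : ℝ × ℝ => ((p.2 : ℝ) : ℂ)) 2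
      ((gaussianReal 0 (1 / 2)).prod (gaussianReal 0 (1 / 2))) :=
    ((memLp_id_gaussianReal 2).comp_snd _).ofReal
  unfold stdComplexNormal
  rw [memLp_map_measure_iff (by fun_prop) (by fun_prop)]
  exact h1.add (h2.mul_const Complex.I)

lemma integral_id_stdComplexNormal : ∫ z, z ∂stdComplexNormal = 0 := by
  unfold stdComplexNormal
  rw [integral_map (by fun_prop) (by fun_prop)]
  have h1 : Integrable (fun p : ℝ × ℝ => ((p.1 : ℝ) : ℂ))
      ((gaussianReal 0 (1 / 2)).prod (gaussianReal 0 (1 / 2))) :=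
    (((memLp_id_gaussianReal 1).comp_fst _).ofReal).integrable le_rfl
  have h2 : Integrable (fun p : ℝ × ℝ => ((p.2 : ℝ) : ℂ))
      ((gaussianReal 0 (1 / 2)).prod (gaussianReal 0 (1 / 2))) :=
    (((memLp_id_gaussianReal 1).comp_snd _).ofReal).integrable le_rfl
  rw [integral_add h1 (h2.mul_const _), integral_mul_const,
    integral_fun_fst (fun x : ℝ => (x : ℂ)), integral_fun_snd (fun x : ℝ => (x : ℂ)),
    integral_complex_ofReal, integral_id_gaussianReal]
  simp

lemma integral_norm_sq_stdComplexNormal :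
    ∫ z, z * (starRingEnd ℂ) z ∂stdComplexNormal = 1 := by
  have h0 : ∫ z, z * (starRingEnd ℂ) z ∂stdComplexNormal =
      ((∫ z, ‖z‖ ^ 2 ∂stdComplexNormal : ℝ) : ℂ) := by
    rw [← integral_complex_ofReal]
    refine integral_congr_ae (.of_forall fun z => ?_)
    simp [Complex.mul_conj, Complex.normSq_eq_norm_sq]
  rw [h0]
  have h : ∫ z, ‖z‖ ^ 2 ∂stdComplexNormal = 1 := by
    unfold stdComplexNormal
    rw [integral_map (by fun_prop) (by fun_prop)]
    have hn : ∀ p : ℝ × ℝ, ‖(p.1 : ℂ) + (p.2 : ℂ) * Complex.I‖ ^ 2 = p.1 ^ 2 + p.2 ^ 2 := fun p => by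
      rw [← Complex.normSq_eq_norm_sq, Complex.normSq_add_mul_I]
    simp_rw [hn]
    have hv : ∫ x, x ^ 2 ∂(gaussianReal 0 (1 / 2)) = 1 / 2 := by
      have := variance_id_gaussianReal (μ := 0) (v := 1 / 2)
      rw [variance_of_integral_eq_zero (by fun_prop) (by simp)] at this
      simpa using this
    have h1 : Integrable (fun p : ℝ × ℝ => p.1 ^ 2)
        ((gaussianReal 0 (1 / 2)).prod (gaussianReal 0 (1 / 2))) :=
      ((memLp_id_gaussianReal 2).comp_fst _).integrable_sq
    have h2 : Integrable (fun p : ℝ × ℝ => p.2 ^ 2)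
        ((gaussianReal 0 (1 / 2)).prod (gaussianReal 0 (1 / 2))) :=
      ((memLp_id_gaussianReal 2).comp_snd _).integrable_sq
    rw [integral_add h1 h2, integral_fun_fst (fun x : ℝ => x ^ 2),
      integral_fun_snd (fun x : ℝ => x ^ 2), hv]
    norm_num
  simp [h]

/-- Second moments of a row of shifted standard complex normal entries. -/
lemma integrable_integral_row {n : ℕ} (c d : ℂ) (j k : Fin n) :
    Integrable (fun x : Fin n → ℂ => (c - x j) * (starRingEnd ℂ) (d - x k))
        (Measure.pi fun _ => stdComplexNormal) ∧
      ∫ x : Fin n → ℂ, (c - x j) * (starRingEnd ℂ) (d - x k)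
        ∂(Measure.pi fun _ => stdComplexNormal) =
        c * (starRingEnd ℂ) d + if j = k then 1 else 0 := by
  have hL : ∀ c : ℂ, MemLp (fun z : ℂ => c - z) 2 stdComplexNormal := fun c =>
    (memLp_const c).sub memLp_id_stdComplexNormal
  have hmean : ∀ c : ℂ, ∫ z, (c - z) ∂stdComplexNormal = c := fun c => by
    rw [integral_sub (integrable_const c) (memLp_id_stdComplexNormal.integrable one_le_two),
      integral_id_stdComplexNormal]
    simp
  have hp : ∀ (c : ℂ) (j : Fin n), MemLp (fun x : Fin n → ℂ => c - x j) 2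
      (Measure.pi fun _ => stdComplexNormal) := fun c j =>
    (hL c).comp_measurePreserving (measurePreserving_eval _ j)
  have hstar : ∀ {α : Type} {m : MeasurableSpace α} {μ : Measure α} {f : α → ℂ},
      MemLp f 2 μ → MemLp (fun x => (starRingEnd ℂ) (f x)) 2 μ := fun h => h.star
  refine ⟨(hp c j).integrable_mul (hstar (hp d k)), ?_⟩
  by_cases h : j = k
  · subst h
    have h1 := (measurePreserving_eval (fun _ : Fin n => stdComplexNormal) j).map_eq
    have h2 : ∫ x : Fin n → ℂ, (c - x j) * (starRingEnd ℂ) (d - x j)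
        ∂(Measure.pi fun _ => stdComplexNormal) =
        ∫ z, (c - z) * (starRingEnd ℂ) (d - z) ∂stdComplexNormal := by
      conv_rhs => rw [← h1]
      rw [integral_map (measurable_pi_apply j).aemeasurable (by fun_prop)]
    have hi := memLp_id_stdComplexNormal.integrable one_le_two
    have hi' := (hstar memLp_id_stdComplexNormal).integrable one_le_two
    have hi2 : Integrable (fun z : ℂ => z * (starRingEnd ℂ) z) stdComplexNormal :=
      memLp_id_stdComplexNormal.integrable_mul (hstar memLp_id_stdComplexNormal)
    have e1 : ∫ z, (c * (starRingEnd ℂ) d - c * (starRingEnd ℂ) z) ∂stdComplexNormal =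
        c * (starRingEnd ℂ) d := by
      rw [integral_sub (integrable_const _) (hi'.const_mul c),
        integral_const_mul c fun z : ℂ => (starRingEnd ℂ) z, integral_conj (f := fun z : ℂ => z), integral_id_stdComplexNormal]
      simp
    have e2 : ∫ z, (z * (starRingEnd ℂ) d - z * (starRingEnd ℂ) z) ∂stdComplexNormal = -1 := by
      rw [integral_sub (hi.mul_const _) hi2, integral_mul_const, integral_id_stdComplexNormal,
        integral_norm_sq_stdComplexNormal]
      simp
    have h3 : ∀ z : ℂ, (c - z) * (starRingEnd ℂ) (d - z) =
        (c * (starRingEnd ℂ) d - c * (starRingEnd ℂ) z) -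
          (z * (starRingEnd ℂ) d - z * (starRingEnd ℂ) z) := fun z => by
      rw [map_sub]; ring
    rw [h2]
    simp_rw [h3]
    have i1 : Integrable (fun z : ℂ => c * (starRingEnd ℂ) d - c * (starRingEnd ℂ) z)
        stdComplexNormal := (integrable_const _).sub (hi'.const_mul c)
    have i2 : Integrable (fun z : ℂ => z * (starRingEnd ℂ) d - z * (starRingEnd ℂ) z)
        stdComplexNormal := (hi.mul_const _).sub hi2
    rw [integral_sub i1 i2, e1, e2]
    simp
  -- For `j ≠ k` the integrand is a product over all coordinates, with factor 1 away from `j` and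
  -- `k`, so independence applies.
  · let f : Fin n → ℂ → ℂ := fun l x =>
      if l = j then c - x else if l = k then (starRingEnd ℂ) (d - x) else 1
    have hf : ∀ x : Fin n → ℂ, (c - x j) * (starRingEnd ℂ) (d - x k) = ∏ l, f l (x l) := by
      intro x
      rw [Finset.prod_eq_mul j k h]
      · simp [f, Ne.symm h]
      · intro l _ hl; simp [f, hl.1, hl.2]
      · simp
      · simp
    simp_rw [hf]
    rw [integral_fintype_prod_eq_prod, Finset.prod_eq_mul j k h]
    · simp only [f, if_true, Ne.symm h, if_false, h, add_zero, hmean, integral_conj]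
    · intro l _ hl; simp [f, hl.1, hl.2]
    · simp
    · simp

/-! ### The second moment of the determinant of a shifted Ginibre matrix -/

lemma card_perm_fixing {n : ℕ} (S : Finset (Fin n)) :
    (Finset.univ.filter fun σ : Equiv.Perm (Fin n) => ∀ i ∈ S, σ i = i).card =
      (n - S.card).factorial := by
  classical
  rw [← Fintype.card_subtype]
  have e := Equiv.Perm.subtypeEquivSubtypePerm fun i : Fin n => i ∉ S
  have h1 : Fintype.card {σ : Equiv.Perm (Fin n) // ∀ i ∈ S, σ i = i} =
      Fintype.card {σ : Equiv.Perm (Fin n) // ∀ i, ¬(i ∉ S) → σ i = i} :=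
    Fintype.card_congr (Equiv.subtypeEquivRight fun σ => by simp)
  rw [h1, ← Fintype.card_congr e, Fintype.card_perm]
  congr 1
  rw [Fintype.card_subtype_compl]
  simp

lemma integral_pow_mul_exp_neg (k : ℕ) :
    IntegrableOn (fun t : ℝ => t ^ k * Real.exp (-t)) (Set.Ioi 0) ∧
      ∫ t in Set.Ioi (0 : ℝ), t ^ k * Real.exp (-t) = k.factorial := by
  have h : ∀ t ∈ Set.Ioi (0 : ℝ), Real.exp (-t) * t ^ ((k : ℝ) + 1 - 1) = t ^ k * Real.exp (-t) := by
    intro t _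
    rw [add_sub_cancel_right, Real.rpow_natCast, mul_comm]
  constructor
  · exact (integrableOn_congr_fun h measurableSet_Ioi).1
      (Real.GammaIntegral_convergent (by positivity : (0 : ℝ) < k + 1))
  · rw [← setIntegral_congr_fun measurableSet_Ioi h, ← Real.Gamma_eq_integral (by positivity),
      Real.Gamma_nat_eq_factorial]

lemma prod_add_eq_sum {n : ℕ} (y : Fin n → ℝ) (t : ℝ) :
    ∏ i, (t + y i) = ∑ S : Finset (Fin n), (∏ i ∈ S, y i) * t ^ (n - S.card) := by
  simp_rw [add_comm t]
  rw [Finset.prod_add, Finset.powerset_univ]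
  refine Finset.sum_congr rfl fun S _ => ?_
  rw [Finset.prod_const, ← Finset.compl_eq_univ_sdiff, Finset.card_compl, Fintype.card_fin]

/-- The permanent of the all-ones matrix plus a diagonal matrix. -/
lemma sum_perm_prod_eq_integral {n : ℕ} (y : Fin n → ℝ) :
    ∑ σ : Equiv.Perm (Fin n), ∏ i, (1 + if σ i = i then y i else 0) =
      ∫ t in Set.Ioi (0 : ℝ), (∏ i, (t + y i)) * Real.exp (-t) := by
  classical
  -- Both sides are expanded over subsets `S`. The coefficient of `∏_{i ∈ S} y i` on the left counts
  -- the permutations fixing `S` pointwise, `(n - |S|)!`; on the right it is `∫ t^{n-|S|} e^{-t}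
  -- dt`, the same number.
  have hR : ∫ t in Set.Ioi (0 : ℝ), (∏ i, (t + y i)) * Real.exp (-t) =
      ∑ S : Finset (Fin n), (∏ i ∈ S, y i) * (n - S.card).factorial := by
    simp_rw [prod_add_eq_sum, Finset.sum_mul, mul_assoc]
    rw [integral_finsetSum _ fun S _ => (integral_pow_mul_exp_neg _).1.const_mul _]
    refine Finset.sum_congr rfl fun S _ => ?_
    rw [integral_const_mul, (integral_pow_mul_exp_neg _).2]
  rw [hR]
  simp_rw [Finset.prod_one_add, Finset.powerset_univ]
  rw [Finset.sum_comm]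
  refine Finset.sum_congr rfl fun S _ => ?_
  have h : ∀ σ : Equiv.Perm (Fin n), ∏ i ∈ S, (if σ i = i then y i else 0) =
      (∏ i ∈ S, y i) * if ∀ i ∈ S, σ i = i then 1 else 0 := by
    intro σ
    rw [Finset.prod_ite_zero]
    split_ifs <;> simp
  simp_rw [h]
  rw [← Finset.mul_sum, Finset.sum_boole, card_perm_fixing]

/-- Expand `|det|²` over pairs `(σ, τ)` of permutations. The rows are independent, and row `i`
contributes `D i (σ i) * conj (D i (τ i)) + [σ i = τ i]`. If `σ ≠ τ`, some row has `σ i ≠ τ i`; one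
of the two entries of `D` is then off the diagonal and the product vanishes. The terms `σ = τ` form
the permanent of `sum_perm_prod_eq_integral`. -/
lemma lintegral_norm_det_sq_ginibreUE {n : ℕ} (m : Fin n → ℂ) :
    ∫⁻ G, ENNReal.ofReal (‖(Matrix.diagonal m - Matrix.of G).det‖ ^ 2) ∂(ginibreUE n) =
      ENNReal.ofReal
        (∫ t in Set.Ioi (0 : ℝ), (∏ i, (t + ‖m i‖ ^ 2)) * Real.exp (-t)) := by
  classical
  let D : Matrix (Fin n) (Fin n) ℂ := Matrix.diagonal m
  let g : Equiv.Perm (Fin n) → Equiv.Perm (Fin n) → Fin n → (Fin n → ℂ) → ℂ := fun σ τ i x =>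
    (D i (σ i) - x (σ i)) * (starRingEnd ℂ) (D i (τ i) - x (τ i))
  have hexp : ∀ G : Fin n → Fin n → ℂ, ((‖(D - Matrix.of G).det‖ ^ 2 : ℝ) : ℂ) =
      ∑ σ : Equiv.Perm (Fin n), ∑ τ : Equiv.Perm (Fin n),
        (((Equiv.Perm.sign σ : ℤ) : ℂ) * ((Equiv.Perm.sign τ : ℤ) : ℂ)) * ∏ i, g σ τ i (G i) := by
    intro G
    -- `Matrix.det_apply'` uses the entries `(σ i, i)`; transposing first makes the `i`-th factor
    -- depend on row `i` only.
    rw [← Complex.normSq_eq_norm_sq, ← Complex.mul_conj, ← Matrix.det_transpose, Matrix.det_apply',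
      map_sum, Finset.sum_mul_sum]
    refine Finset.sum_congr rfl fun σ _ => Finset.sum_congr rfl fun τ _ => ?_
    simp only [g, Finset.prod_mul_distrib, map_mul, map_prod, map_intCast, Matrix.transpose_apply,
      Matrix.sub_apply, Matrix.of_apply]
    ring
  have hint : ∀ σ τ, Integrable (fun G : Fin n → Fin n → ℂ => ∏ i, g σ τ i (G i))
      (ginibreUE n) := fun σ τ =>
    Integrable.fintype_prod fun i => (integrable_integral_row _ _ _ _).1
  have hval : ∀ σ τ, ∫ G : Fin n → Fin n → ℂ, ∏ i, g σ τ i (G i) ∂(ginibreUE n) =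
      if σ = τ then ((∏ i, (1 + if σ i = i then ‖m i‖ ^ 2 else 0) : ℝ) : ℂ) else 0 := by
    intro σ τ
    rw [ginibreUE, integral_fintype_prod_eq_prod]
    simp_rw [g, fun i => (integrable_integral_row (D i (σ i)) (D i (τ i)) (σ i) (τ i)).2]
    by_cases h : σ = τ
    · subst h
      simp only [if_true, Complex.ofReal_prod]
      refine Finset.prod_congr rfl fun i _ => ?_
      by_cases hi : σ i = i
      · simp [D, hi, Complex.mul_conj, Complex.normSq_eq_norm_sq, add_comm]
      · simp [D, hi, Matrix.diagonal_apply_ne' _ hi]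
    · rw [if_neg h]
      obtain ⟨i, hi⟩ : ∃ i, σ i ≠ τ i := by
        by_contra! hall
        exact h (Equiv.ext hall)
      refine Finset.prod_eq_zero (Finset.mem_univ i) ?_
      by_cases hσ : σ i = i
      · have : τ i ≠ i := fun h' => hi (hσ.trans h'.symm)
        simp [D, hi, Matrix.diagonal_apply_ne' _ this]
      · simp [D, hi, Matrix.diagonal_apply_ne' _ hσ]
  have hintC : Integrable (fun G : Fin n → Fin n → ℂ => ((‖(D - Matrix.of G).det‖ ^ 2 : ℝ) : ℂ))
      (ginibreUE n) := by
    simp_rw [hexp]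
    exact integrable_finsetSum _ fun σ _ => integrable_finsetSum _ fun τ _ =>
      (hint σ τ).const_mul _
  have hintR : Integrable (fun G : Fin n → Fin n → ℂ => ‖(D - Matrix.of G).det‖ ^ 2)
      (ginibreUE n) := by
    exact hintC.re
  rw [← ofReal_integral_eq_lintegral_ofReal hintR (.of_forall fun G => by positivity)]
  congr 1
  rw [← sum_perm_prod_eq_integral, ← Complex.ofReal_inj, ← integral_complex_ofReal]
  simp_rw [hexp]
  rw [integral_finsetSum _ fun σ _ => integrable_finsetSum _ fun τ _ => (hint σ τ).const_mul _,
    Complex.ofReal_sum]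
  refine Finset.sum_congr rfl fun σ _ => ?_
  rw [integral_finsetSum _ fun τ _ => (hint σ τ).const_mul _]
  simp_rw [integral_const_mul, hval]
  simp only [mul_ite, mul_zero, Finset.sum_ite_eq, Finset.mem_univ, if_true]
  rw [← Int.cast_mul, Int.units_coe_mul_self]
  simp

section FixedEigenpair

variable {n : ℕ}

/-! ### Integration over the matrices with a given eigenpair -/

/-- The array with first column `c` and remaining columns `W`. -/
def joinCols (c : Fin (n + 1) → ℂ) (W : Fin (n + 1) → Fin n → ℂ) : Fin (n + 1) → Fin (n + 1) → ℂ :=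
  fun i => Fin.cons (c i) (W i)

@[simp] lemma joinCols_zero (c : Fin (n + 1) → ℂ) (W : Fin (n + 1) → Fin n → ℂ) (i : Fin (n + 1)) :
    joinCols c W i 0 = c i := rfl

@[simp] lemma joinCols_succ (c : Fin (n + 1) → ℂ) (W : Fin (n + 1) → Fin n → ℂ) (i : Fin (n + 1))
    (k : Fin n) : joinCols c W i k.succ = W i k := rfl

lemma measurable_joinCols (c : Fin (n + 1) → ℂ) : Measurable (joinCols c) := by
  refine measurable_pi_lambda _ fun i => measurable_pi_lambda _ fun k => ?_
  refine Fin.cases ?_ (fun k => ?_) k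
  · exact measurable_const
  · simp only [joinCols_succ]; fun_prop

/-- Multiplication of the rows of an array by a matrix from the right. -/
noncomputable def mulRightMap {m : ℕ} (P : Matrix (Fin n) (Fin n) ℂ) :
    (Fin m → Fin n → ℂ) →ₗ[ℂ] (Fin m → Fin n → ℂ) :=
  LinearMap.pi fun i => Matrix.toLin' P.transpose ∘ₗ LinearMap.proj i

/-- Exchange of rows and columns. -/
def swapEquiv (m n : ℕ) : (Fin m → Fin n → ℂ) ≃ₗ[ℂ] (Fin n → Fin m → ℂ) where
  toFun Y := fun j i => Y i j
  invFun Y := fun i j => Y j i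
  map_add' _ _ := rfl
  map_smul' _ _ := rfl
  left_inv _ := rfl
  right_inv _ := rfl

/-- Multiplication of the columns of an array by a matrix from the left. -/
noncomputable def mulLeftMap {m : ℕ} (U : Matrix (Fin m) (Fin m) ℂ) :
    (Fin m → Fin n → ℂ) →ₗ[ℂ] (Fin m → Fin n → ℂ) :=
  (swapEquiv n m).toLinearMap ∘ₗ mulRightMap U.transpose ∘ₗ (swapEquiv n m).symm.toLinearMap

lemma mulRightMap_apply {m : ℕ} (P : Matrix (Fin n) (Fin n) ℂ) (Y : Fin m → Fin n → ℂ) (i : Fin m)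
    (k : Fin n) : mulRightMap P Y i k = ∑ j, Y i j * P j k := by
  simp [mulRightMap, Matrix.mulVec, dotProduct, mul_comm]

lemma mulLeftMap_apply {m : ℕ} (U : Matrix (Fin m) (Fin m) ℂ) (Y : Fin m → Fin n → ℂ) (i : Fin m)
    (k : Fin n) : mulLeftMap U Y i k = ∑ l, U i l * Y l k := by
  have : mulLeftMap U Y i k = mulRightMap U.transpose (fun j i => Y i j) k i := rfl
  rw [this, mulRightMap_apply]
  simp [mul_comm]

lemma det_mulRightMap {m : ℕ} (P : Matrix (Fin n) (Fin n) ℂ) :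
    LinearMap.det (mulRightMap P : (Fin m → Fin n → ℂ) →ₗ[ℂ] _) = P.det ^ m := by
  rw [mulRightMap, LinearMap.det_pi]
  simp

lemma det_mulLeftMap {m : ℕ} (U : Matrix (Fin m) (Fin m) ℂ) :
    LinearMap.det (mulLeftMap U : (Fin m → Fin n → ℂ) →ₗ[ℂ] _) = U.det ^ n := by
  rw [mulLeftMap, LinearMap.det_conj, det_mulRightMap, Matrix.det_transpose]

lemma norm_det_unitary {U : Matrix (Fin n) (Fin n) ℂ} (hU : U ∈ Matrix.unitaryGroup (Fin n) ℂ) :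
    ‖U.det‖ = 1 := by
  exact CStarRing.norm_of_mem_unitary (Matrix.det_of_mem_unitary hU)

/-- A principal minor of a unitary matrix and the complementary entry. -/
lemma norm_det_minor_unitary {U : Matrix (Fin (n + 1)) (Fin (n + 1)) ℂ}
    (hU : U ∈ Matrix.unitaryGroup (Fin (n + 1)) ℂ) :
    ‖(U.conjTranspose.submatrix Fin.succ Fin.succ).det‖ = ‖U 0 0‖ := by
  have h1 := Matrix.adjugate_fin_succ_eq_det_submatrix U.conjTranspose 0 0
  -- The inverse of `U*` is `U`, so a cofactor of `U*` is an entry of `U` up to the unimodular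
  -- factor `det U*`.
  have h2 : U.conjTranspose.adjugate = U.conjTranspose.det • U := by
    have h3 : U.conjTranspose * U = 1 := (Matrix.mem_unitaryGroup_iff'.1 hU)
    have h4 := Matrix.adjugate_mul U.conjTranspose
    calc U.conjTranspose.adjugate = U.conjTranspose.adjugate * (U.conjTranspose * U) := by
          rw [h3, mul_one]
      _ = U.conjTranspose.det • U := by rw [← mul_assoc, h4, smul_mul_assoc, one_mul]
  rw [h2] at h1
  simp only [Fin.succAbove_zero, Fin.val_zero, add_zero, pow_zero, one_mul] at h1
  rw [← h1, Matrix.smul_apply, smul_eq_mul, norm_mul, Matrix.det_conjTranspose, norm_star,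
    norm_det_unitary hU, one_mul]

/-- In a frame whose first vector is proportional to `v = (1, u)`, the matrices with `X v = z v` are
`U B U*`, where `B` has first column `z e₀` and free remaining columns `Y`. The remaining columns of
`X` are the affine function `L Y + W₀` of `Y`. Here `|det L| = |det U|^n |det P|^{n+1} = |U 0
0|^{n+1}`, by the minor identity for unitary matrices, and the real Jacobian is its square. -/
lemma lintegral_chartMatrix_eq {U : Matrix (Fin (n + 1)) (Fin (n + 1)) ℂ}
    (hU : U ∈ Matrix.unitaryGroup (Fin (n + 1)) ℂ) {u : Fin n → ℂ} (h00 : U 0 0 ≠ 0)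
    (hu : ∀ i, U i 0 = U 0 0 * (Fin.cons 1 u : Fin (n + 1) → ℂ) i) (z : ℂ)
    (H : (Fin (n + 1) → Fin (n + 1) → ℂ) → ℝ≥0∞) :
    ∫⁻ W, H (chartMatrix 0 (joinCols (Fin.cons z u) W)) =
      ENNReal.ofReal ((‖U 0 0‖ ^ 2) ^ (n + 1)) *
        ∫⁻ Y, H (U * Matrix.of (joinCols (Pi.single 0 z) Y) * U.conjTranspose) := by
  set v : Fin (n + 1) → ℂ := Fin.cons 1 u with hv
  let M : (Fin (n + 1) → Fin n → ℂ) → Matrix (Fin (n + 1)) (Fin (n + 1)) ℂ := fun Y =>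
    U * Matrix.of (joinCols (Pi.single 0 z) Y) * U.conjTranspose
  let P : Matrix (Fin n) (Fin n) ℂ := U.conjTranspose.submatrix Fin.succ Fin.succ
  let L : (Fin (n + 1) → Fin n → ℂ) →ₗ[ℂ] (Fin (n + 1) → Fin n → ℂ) :=
    mulRightMap P ∘ₗ mulLeftMap U
  -- The part of `U B U*` that comes from the fixed first column `z e₀` of `B`.
  let W₀ : Fin (n + 1) → Fin n → ℂ := fun i k => U i 0 * z * U.conjTranspose 0 k.succ
  have hUU : U.conjTranspose * U = 1 := Matrix.mem_unitaryGroup_iff'.1 hU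
  have hcol : U.mulVec (Pi.single 0 1) = U 0 0 • v := by
    funext i
    simp [hu i]
  have hMv : ∀ Y, (Matrix.of (M Y)).mulVec v = z • v := by
    intro Y
    have h1 : (M Y).mulVec (U 0 0 • v) = z • (U 0 0 • v) := by
      rw [← hcol]
      simp only [M]
      rw [Matrix.mulVec_mulVec, mul_assoc, hUU, mul_one, ← Matrix.mulVec_mulVec,
        ← Matrix.mulVec_smul]
      congr 1
      funext i
      simp [Pi.single_apply]
    rw [Matrix.mulVec_smul, smul_comm] at h1
    exact smul_right_injective _ h00 h1
  have hW : ∀ Y, chartInv 0 (M Y) z v = joinCols (Fin.cons z u) (L Y + W₀) := by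
    intro Y
    funext i k
    refine Fin.cases ?_ (fun k => ?_) k
    · refine Fin.cases ?_ (fun i => ?_) i
      · simp [chartInv]
      · simp [chartInv, hv]
    · simp only [chartInv, Fin.succ_ne_zero, if_false, joinCols_succ, Pi.add_apply]
      simp only [M, L, LinearMap.comp_apply, mulRightMap_apply, mulLeftMap_apply, W₀]
      rw [Matrix.mul_apply, Fin.sum_univ_succ, add_comm]
      congr 1
      simp [Matrix.mul_apply, Pi.single_apply]
  have hM : ∀ Y, chartMatrix 0 (joinCols (Fin.cons z u) (L Y + W₀)) = M Y := by
    intro Y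
    rw [← hW]
    exact chartMatrix_chartInv (by simp [hv]) (hMv Y)
  have hdet : ‖LinearMap.det L‖ = ‖U 0 0‖ ^ (n + 1) := by
    rw [LinearMap.det_comp, det_mulRightMap, det_mulLeftMap, norm_mul, norm_pow, norm_pow,
      norm_det_unitary hU, one_pow, mul_one, norm_det_minor_unitary hU]
  have hdet0 : LinearMap.det L ≠ 0 := by
    rw [← norm_ne_zero_iff, hdet]
    exact pow_ne_zero _ (norm_ne_zero_iff.2 h00)
  rw [← lintegral_add_right_eq_self _ W₀, lintegral_comp_linearMap volume L hdet0, hdet, ← pow_mul,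
    mul_comm (n + 1) 2, pow_mul]
  simp_rw [hM]
  rfl

lemma sum_norm_sq_unitary_conj {U : Matrix (Fin n) (Fin n) ℂ}
    (hU : U ∈ Matrix.unitaryGroup (Fin n) ℂ) (M : Matrix (Fin n) (Fin n) ℂ) :
    ∑ i, ∑ j, ‖(U * M * U.conjTranspose) i j‖ ^ 2 = ∑ i, ∑ j, ‖M i j‖ ^ 2 := by
  have key : ∀ M : Matrix (Fin n) (Fin n) ℂ, ((∑ i, ∑ j, ‖M i j‖ ^ 2 : ℝ) : ℂ) =
      (M * M.conjTranspose).trace := by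
    intro M
    simp [Matrix.trace, Matrix.mul_apply, Complex.mul_conj, Complex.normSq_eq_norm_sq]
  have hUU : U.conjTranspose * U = 1 := Matrix.mem_unitaryGroup_iff'.1 hU
  rw [← Complex.ofReal_inj, key, key]
  simp only [Matrix.conjTranspose_mul, Matrix.conjTranspose_conjTranspose]
  calc (U * M * U.conjTranspose * (U * (M.conjTranspose * U.conjTranspose))).trace
      = (U * M * (U.conjTranspose * U) * (M.conjTranspose * U.conjTranspose)).trace := by
        simp only [mul_assoc]
    _ = ((U * (M * M.conjTranspose)) * U.conjTranspose).trace := by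
        rw [hUU]; simp only [mul_assoc, one_mul]
    _ = (M * M.conjTranspose).trace := by
        rw [Matrix.trace_mul_comm, ← mul_assoc, hUU, one_mul]

/-- `U s = r` gives `r r* = U (s s*) U*`, and the Gaussian weight depends only on the Frobenius
norm. -/
lemma ginibreDensity_unitary_conj_sub {U : Matrix (Fin n) (Fin n) ℂ}
    (hU : U ∈ Matrix.unitaryGroup (Fin n) ℂ) (a : ℂ) {r : EuclideanSpace ℂ (Fin n)} {s : Fin n → ℂ}
    (hr : U.mulVec s = WithLp.ofLp r) (B : Matrix (Fin n) (Fin n) ℂ) :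
    ginibreDensity (U * B * U.conjTranspose - rankOneNormal a r) =
      ginibreDensity fun i j => B i j - a * s i * star (s j) := by
  have h1 : rankOneNormal a r =
      U * (Matrix.of fun i j => a * s i * star (s j)) * U.conjTranspose := by
    have h2 : (Matrix.of fun i j => a * s i * star (s j)) = a • Matrix.vecMulVec s (star s) := by
      ext i j; simp [Matrix.vecMulVec_apply, mul_assoc]
    have h3 : rankOneNormal a r = a • Matrix.vecMulVec (WithLp.ofLp r) (star (WithLp.ofLp r)) := by
      ext i j; simp [rankOneNormal, Matrix.vecMulVec_apply, mul_assoc]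
    rw [h2, h3, Matrix.mul_smul, Matrix.smul_mul, Matrix.mul_vecMulVec, Matrix.vecMulVec_mul,
      ← Matrix.star_mulVec, hr]
  have h4 : U * B * U.conjTranspose - rankOneNormal a r =
      U * (B - Matrix.of fun i j => a * s i * star (s j)) * U.conjTranspose := by
    rw [h1, mul_sub, sub_mul]
  have h5 := ginibreDensity_eq (m := n) (n := n)
    (U * (B - Matrix.of fun i j => a * s i * star (s j)) * U.conjTranspose)
  have h6 := sum_norm_sq_unitary_conj hU (B - Matrix.of fun i j => a * s i * star (s j))
  rw [h4]
  exact (h5.trans (by rw [h6]; rfl)).trans (ginibreDensity_eq _).symm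

/-- Conjugation leaves the characteristic polynomial unchanged. For the bordered matrix `e₀` is an
eigenvector, so `derivative_charpoly_eval` puts `e₀` in the first column, and expansion along it
leaves the corner. -/
lemma derivative_charpoly_bordered {U : Matrix (Fin (n + 1)) (Fin (n + 1)) ℂ}
    (hU : U ∈ Matrix.unitaryGroup (Fin (n + 1)) ℂ) (z : ℂ) (Y : Fin (n + 1) → Fin n → ℂ) :
    (U * Matrix.of (joinCols (Pi.single 0 z) Y) * U.conjTranspose).charpoly.derivative.eval z =
      (z • (1 : Matrix (Fin n) (Fin n) ℂ) - Matrix.of fun (i j : Fin n) => Y i.succ j).det := by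
  have hUU : U.conjTranspose * U = 1 := Matrix.mem_unitaryGroup_iff'.1 hU
  set B := Matrix.of (joinCols (Pi.single 0 z) Y) with hB
  have h1 : (U * B * U.conjTranspose).charpoly = B.charpoly := by
    rw [Matrix.charpoly_mul_comm, ← mul_assoc, hUU, one_mul]
  have h2 : B.mulVec (Pi.single 0 1) = z • (Pi.single 0 1 : Fin (n + 1) → ℂ) := by
    funext i
    simp [hB, Pi.single_apply]
  rw [h1, derivative_charpoly_eval (j := 0) (by simp) h2, Matrix.det_succ_column_zero,
    Finset.sum_eq_single 0]
  · simp only [Fin.val_zero, pow_zero, Matrix.updateCol_self, Pi.single_eq_same, one_mul,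
      Fin.succAbove_zero]
    congr 1
    ext i j
    simp [hB, Matrix.one_apply]
  · intro i _ hi
    simp [hi]
  · simp

/-- The independent entries are grouped into the prescribed first column, the first row `w` and the
corner `C`. -/
lemma ginibreDensity_bordered (z a : ℂ) (s : Fin (n + 1) → ℂ) (w : Fin n → ℂ)
    (C : Fin n → Fin n → ℂ) :
    ginibreDensity (fun i j => joinCols (Pi.single 0 z) (Fin.cons w C) i j - a * s i * star (s j)) =
      (normalDensity (z - a * ‖s 0‖ ^ 2) *
        ∏ i : Fin n, normalDensity (a * s i.succ * star (s 0))) *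
      ((∏ j, normalDensity (w j - a * s 0 * star (s j.succ))) *
        ginibreDensity fun i j => C i j - a * s i.succ * star (s j.succ)) := by
  have h0 : a * s 0 * star (s 0) = a * ‖s 0‖ ^ 2 := by
    rw [mul_assoc]
    congr 1
    simpa using Complex.mul_conj' (s 0)
  have hneg : ∀ x : ℂ, normalDensity (0 - x) = normalDensity x := fun x => by
    simp [normalDensity]
  simp only [ginibreDensity, Fin.prod_univ_succ, joinCols_zero, joinCols_succ, Fin.cons_zero,
    Fin.cons_succ, Pi.single_eq_same, h0]
  simp only [Pi.single_apply, Fin.succ_ne_zero, if_false, hneg, Finset.prod_mul_distrib]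
  ring

/-- The first column contributes a constant. The first row is absent from the determinant, so its
shifted Gaussian integrates to 1. The corner is Ginibre plus the corner of `a s s*`; by `hs` this
shift is diagonal, and the second moment of the determinant applies after a translation. -/
lemma lintegral_bordered {U : Matrix (Fin (n + 1)) (Fin (n + 1)) ℂ}
    (hU : U ∈ Matrix.unitaryGroup (Fin (n + 1)) ℂ) (z a : ℂ)
    {r : EuclideanSpace ℂ (Fin (n + 1))} {s : Fin (n + 1) → ℂ}
    (hr : U.mulVec s = WithLp.ofLp r) (hs : ∀ i : Fin n, i.val ≠ 0 → s i.succ = 0) :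
    ∫⁻ Y : Fin (n + 1) → Fin n → ℂ,
      ENNReal.ofReal (‖(U * Matrix.of (joinCols (Pi.single 0 z) Y) *
        U.conjTranspose).charpoly.derivative.eval z‖ ^ 2) *
      ginibreDensity (U * Matrix.of (joinCols (Pi.single 0 z) Y) * U.conjTranspose -
        rankOneNormal a r) =
      normalDensity (z - a * ‖s 0‖ ^ 2) * (∏ i : Fin n, normalDensity (a * s i.succ * star (s 0))) *
        ENNReal.ofReal (∫ t in Set.Ioi (0 : ℝ),
          (∏ i : Fin n, (t + ‖z - a * ‖s i.succ‖ ^ 2‖ ^ 2)) * Real.exp (-t)) := by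
  simp_rw [derivative_charpoly_bordered hU, ginibreDensity_unitary_conj_sub hU a hr]
  have hmp := (volume_preserving_piFinSuccAbove (fun _ : Fin (n + 1) => Fin n → ℂ) 0).symm
  rw [← hmp.lintegral_comp_emb (MeasurableEquiv.measurableEmbedding _)]
  have hcons : ∀ p : (Fin n → ℂ) × (Fin n → Fin n → ℂ),
      (MeasurableEquiv.piFinSuccAbove (fun _ : Fin (n + 1) => Fin n → ℂ) 0).symm p =
        Fin.cons p.1 p.2 := fun p => by
    simp [MeasurableEquiv.piFinSuccAbove_symm_apply, Fin.insertNthEquiv]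
  simp_rw [hcons]
  have hB : ∀ p : (Fin n → ℂ) × (Fin n → Fin n → ℂ), ginibreDensity (fun i j =>
      Matrix.of (joinCols (Pi.single 0 z) (Fin.cons p.1 p.2)) i j - a * s i * star (s j)) =
      _ := fun p => ginibreDensity_bordered z a s p.1 p.2
  simp_rw [hB]
  set K := normalDensity (z - a * ‖s 0‖ ^ 2) *
    ∏ i : Fin n, normalDensity (a * s i.succ * star (s 0)) with hK
  have hnm := measurable_normalDensity
  have hgm := measurable_ginibreDensity (m := n) (n := n)
  have hdm : Measurable fun C : Fin n → Fin n → ℂ => ENNReal.ofReal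
      (‖(z • (1 : Matrix (Fin n) (Fin n) ℂ) - Matrix.of fun i j => C i j).det‖ ^ 2) := by
    have : Continuous fun C : Fin n → Fin n → ℂ =>
        (z • (1 : Matrix (Fin n) (Fin n) ℂ) - Matrix.of fun i j => C i j).det :=
      Continuous.matrix_det (continuous_const.sub continuous_id)
    exact (this.norm.pow 2).measurable.ennreal_ofReal
  have hreorder : ∀ p : (Fin n → ℂ) × (Fin n → Fin n → ℂ),
      ENNReal.ofReal (‖(z • (1 : Matrix (Fin n) (Fin n) ℂ) - Matrix.of fun (i j : Fin n) =>
        (Fin.cons p.1 p.2 : Fin (n + 1) → Fin n → ℂ) i.succ j).det‖ ^ 2) *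
        (K * ((∏ j, normalDensity (p.1 j - a * s 0 * star (s j.succ))) *
          ginibreDensity fun i j => p.2 i j - a * s i.succ * star (s j.succ))) =
      K * ((∏ j, normalDensity (p.1 j - a * s 0 * star (s j.succ))) *
        (ENNReal.ofReal (‖(z • (1 : Matrix (Fin n) (Fin n) ℂ) - Matrix.of fun i j =>
          p.2 i j).det‖ ^ 2) *
          ginibreDensity fun i j => p.2 i j - a * s i.succ * star (s j.succ))) := fun p => by
    simp only [Fin.cons_succ]
    ring
  simp_rw [hreorder]
  have hm1 : Measurable fun w : Fin n → ℂ =>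
      ∏ j, normalDensity (w j - a * s 0 * star (s j.succ)) := by fun_prop
  have hm2 : Measurable fun C : Fin n → Fin n → ℂ =>
      ENNReal.ofReal (‖(z • (1 : Matrix (Fin n) (Fin n) ℂ) - Matrix.of fun i j =>
          C i j).det‖ ^ 2) *
          ginibreDensity fun i j => C i j - a * s i.succ * star (s j.succ) :=
    hdm.mul (hgm.comp (by fun_prop))
  have hm3 : Measurable fun p : (Fin n → ℂ) × (Fin n → Fin n → ℂ) =>
      (∏ j, normalDensity (p.1 j - a * s 0 * star (s j.succ))) *
        (ENNReal.ofReal (‖(z • (1 : Matrix (Fin n) (Fin n) ℂ) - Matrix.of fun i j =>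
          p.2 i j).det‖ ^ 2) *
          ginibreDensity fun i j => p.2 i j - a * s i.succ * star (s j.succ)) :=
    (hm1.comp measurable_fst).mul (hm2.comp measurable_snd)
  rw [lintegral_const_mul _ hm3, Measure.volume_eq_prod, lintegral_prod_mul hm1.aemeasurable hm2.aemeasurable]
  have e1 : ∫⁻ w : Fin n → ℂ, ∏ j, normalDensity (w j - a * s 0 * star (s j.succ)) = 1 := by
    rw [volume_pi, lintegral_pi_prod volume (f := fun j x =>
      normalDensity (x - a * s 0 * star (s j.succ))) (fun j => by fun_prop)]
    refine Finset.prod_eq_one fun j _ => ?_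
    rw [lintegral_sub_right_eq_self, lintegral_normalDensity]
  let A' : Fin n → Fin n → ℂ := fun i j => a * s i.succ * star (s j.succ)
  have e2 : ∫⁻ C : Fin n → Fin n → ℂ,
      ENNReal.ofReal (‖(z • (1 : Matrix (Fin n) (Fin n) ℂ) - Matrix.of fun i j =>
          C i j).det‖ ^ 2) *
          ginibreDensity (fun i j => C i j - a * s i.succ * star (s j.succ)) =
      ENNReal.ofReal (∫ t in Set.Ioi (0 : ℝ),
          (∏ i : Fin n, (t + ‖z - a * ‖s i.succ‖ ^ 2‖ ^ 2)) * Real.exp (-t)) := by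
    rw [← lintegral_norm_det_sq_ginibreUE, lintegral_ginibreUE, ← lintegral_add_right_eq_self _ A']
    refine lintegral_congr fun C => ?_
    rw [mul_comm]
    congr 1
    · congr 1
      funext i j
      simp [A']
    · congr 4
      ext i j
      simp only [Matrix.sub_apply, Matrix.smul_apply, Matrix.one_apply, Matrix.of_apply,
        Pi.add_apply, A', Matrix.diagonal_apply]
      by_cases h : i = j
      · subst h
        simp only [if_true, smul_eq_mul, mul_one]
        have := Complex.mul_conj' (s i.succ)
        rw [← this]
        simp only [Complex.star_def]
        ring
      -- Among the entries `s i.succ` only the one with `i = 0` can be non-zero, so two different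
      -- indices always give a zero product.
      · have : s i.succ = 0 ∨ s j.succ = 0 := by
          by_cases hi : i.val = 0
          · exact Or.inr (hs j fun hj => h (Fin.ext (hi.trans hj.symm)))
          · exact Or.inl (hs i hi)
        rcases this with this | this <;> simp [h, this]
  rw [e1, e2, one_mul]

end FixedEigenpair

section AdaptedFrame

variable {n : ℕ}

/-! ### A unitary frame adapted to an eigenvector and the direction of the deformation -/

lemma norm_sq_cons_one (u : Fin n → ℂ) :
    ‖(WithLp.toLp 2 (Fin.cons 1 u : Fin (n + 1) → ℂ) : EuclideanSpace ℂ (Fin (n + 1)))‖ ^ 2 =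
      1 + ∑ i, ‖u i‖ ^ 2 := by
  rw [EuclideanSpace.norm_sq_eq, Fin.sum_univ_succ]
  simp

lemma cons_one_ne_zero (u : Fin n → ℂ) : (Fin.cons 1 u : Fin (n + 1) → ℂ) ≠ 0 := fun h => by
  simpa using congrFun h 0

/-- Gram–Schmidt on `v / |v|`, `r` gives an orthonormal basis whose first two vectors span a space
containing `r`, so the later coordinates of `r` vanish. The columns of `U` are this basis, `s` lists
the coordinates of `r`, and `U 0 0 = 1 / |v|` because `v` has first entry 1. -/
lemma exists_adapted_unitary {r : EuclideanSpace ℂ (Fin (n + 1))} (hr : ‖r‖ = 1) (u : Fin n → ℂ) :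
    ∃ (U : Matrix (Fin (n + 1)) (Fin (n + 1)) ℂ) (s : Fin (n + 1) → ℂ),
      U ∈ Matrix.unitaryGroup (Fin (n + 1)) ℂ ∧ U 0 0 ≠ 0 ∧
      (∀ i, U i 0 = U 0 0 * (Fin.cons 1 u : Fin (n + 1) → ℂ) i) ∧
      ‖U 0 0‖ ^ 2 = (1 + ∑ i, ‖u i‖ ^ 2)⁻¹ ∧
      U.mulVec s = WithLp.ofLp r ∧ (∀ i : Fin n, i.val ≠ 0 → s i.succ = 0) ∧
      ‖s 0‖ ^ 2 = ‖inner ℂ r (unitDir (Fin.cons 1 u))‖ ^ 2 ∧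
      ∑ i : Fin n, ‖s i.succ‖ ^ 2 = 1 - ‖s 0‖ ^ 2 := by
  set v : Fin (n + 1) → ℂ := Fin.cons 1 u with hv
  have hv0 : v ≠ 0 := cons_one_ne_zero u
  have hvn : ‖(WithLp.toLp 2 v : EuclideanSpace ℂ (Fin (n + 1)))‖ ≠ 0 := by simpa using hv0
  -- Repeating `r` is harmless: `gramSchmidtOrthonormalBasis` completes a dependent family to a
  -- basis. This also covers `r` parallel to `v`.
  let f : Fin (n + 1) → EuclideanSpace ℂ (Fin (n + 1)) := fun i => if i = 0 then unitDir v else r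
  have hcard : Module.finrank ℂ (EuclideanSpace ℂ (Fin (n + 1))) = Fintype.card (Fin (n + 1)) := by
    simp
  let b := InnerProductSpace.gramSchmidtOrthonormalBasis hcard f
  have hf0 : InnerProductSpace.gramSchmidtNormed ℂ f 0 = unitDir v := by
    have : InnerProductSpace.gramSchmidt ℂ f 0 = unitDir v :=
      InnerProductSpace.gramSchmidt_bot ℂ f
    simp [InnerProductSpace.gramSchmidtNormed, this, norm_unitDir hv0]
  have hb0 : b 0 = unitDir v := by
    rw [← hf0]
    refine InnerProductSpace.gramSchmidtOrthonormalBasis_apply hcard ?_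
    rw [hf0, ← norm_ne_zero_iff, norm_unitDir hv0]
    exact one_ne_zero
  have hcol : ∀ i, b 0 i = ((‖(WithLp.toLp 2 v : EuclideanSpace ℂ (Fin (n + 1)))‖⁻¹ : ℝ) : ℂ) * v i :=
    fun i => by rw [hb0]; simp [unitDir]
  have h00 : b 0 0 = ((‖(WithLp.toLp 2 v : EuclideanSpace ℂ (Fin (n + 1)))‖⁻¹ : ℝ) : ℂ) := by
    rw [hcol]; simp [hv]
  have hsum := b.sum_sq_norm_inner_right r
  rw [hr, one_pow, Fin.sum_univ_succ] at hsum
  refine ⟨Matrix.of fun i j => b j i, fun j => inner ℂ (b j) r, ?_, ?_, ?_, ?_, ?_, ?_, ?_, ?_⟩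
  · rw [Matrix.mem_unitaryGroup_iff']
    ext i j
    have := orthonormal_iff_ite.1 b.orthonormal i j
    rw [PiLp.inner_apply] at this
    rw [Matrix.one_apply, ← this, Matrix.mul_apply]
    simp [Matrix.star_apply, mul_comm]
  · simpa [h00] using hv0
  · intro i
    simp only [Matrix.of_apply, h00, hcol]
  · simp only [Matrix.of_apply, h00]
    rw [Complex.norm_real, norm_inv, norm_norm, inv_pow, norm_sq_cons_one]
  · have := b.sum_repr' r
    conv_rhs => rw [← this]
    funext i
    simp [Matrix.mulVec, dotProduct, mul_comm]
  · intro i hi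
    have h1 : f ⟨1, by omega⟩ = r := if_neg fun h => by
      simpa using congrArg Fin.val h
    have := InnerProductSpace.gramSchmidtOrthonormalBasis_inv_triangular hcard f
      (i := ⟨1, by omega⟩) (j := i.succ) (by rw [Fin.lt_def]; simp; omega)
    rwa [h1] at this
  · simp only [hb0]
    rw [norm_inner_symm]
  · linarith

end AdaptedFrame

/-! ### The incomplete Gamma function -/

lemma incompleteGamma_natCast_add_one (m : ℕ) {x : ℝ} :
    incompleteGamma ((m : ℝ) + 1) x = ∫ t in Set.Ioi x, t ^ m * Real.exp (-t) := by
  unfold incompleteGamma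
  simp_rw [add_sub_cancel_right, Real.rpow_natCast]

lemma integrableOn_pow_mul_exp_neg (m : ℕ) {x : ℝ} (hx : 0 ≤ x) :
    IntegrableOn (fun t : ℝ => t ^ m * Real.exp (-t)) (Set.Ioi x) :=
  (integral_pow_mul_exp_neg m).1.mono_set (Set.Ioi_subset_Ioi hx)

/-- The substitution `t ↦ t - x` moves the domain to `(x, ∞)` and turns `(t + x)^m` into `t^m`. This
is the source of the incomplete Gamma functions. -/
lemma integral_add_mul_add_pow_mul_exp (m : ℕ) {x : ℝ} (hx : 0 ≤ x) (y : ℝ) :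
    ∫ t in Set.Ioi (0 : ℝ), ((t + y) * (t + x) ^ m) * Real.exp (-t) =
      Real.exp x * (incompleteGamma ((m : ℝ) + 1 + 1) x +
        (y - x) * incompleteGamma ((m : ℝ) + 1) x) := by
  have h1 := integrableOn_pow_mul_exp_neg m hx
  have h2 := integrableOn_pow_mul_exp_neg (m + 1) hx
  have hshift : ∫ t in Set.Ioi (0 : ℝ), ((t + y) * (t + x) ^ m) * Real.exp (-t) =
      ∫ t in Set.Ioi x, ((t - x + y) * t ^ m) * Real.exp (-(t - x)) := by
    have := (measurePreserving_add_right volume x).setIntegral_preimage_emb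
      (measurableEmbedding_addRight x)
      (fun t : ℝ => ((t - x + y) * t ^ m) * Real.exp (-(t - x))) (Set.Ioi x)
    rw [← this]
    have hpre : (fun t => t + x) ⁻¹' Set.Ioi x = Set.Ioi 0 := by ext t; simp
    rw [hpre]
    refine setIntegral_congr_fun measurableSet_Ioi fun t _ => ?_
    simp only [add_sub_cancel_right]
  have hcast : ((m : ℝ) + 1 + 1) = ((m + 1 : ℕ) : ℝ) + 1 := by push_cast; ring
  rw [hshift, hcast, incompleteGamma_natCast_add_one, incompleteGamma_natCast_add_one,
    ← integral_const_mul, ← integral_add h2 (h1.const_mul _), ← integral_const_mul]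
  refine setIntegral_congr_fun measurableSet_Ioi fun t _ => ?_
  have : Real.exp (-(t - x)) = Real.exp x * Real.exp (-t) := by
    rw [← Real.exp_add]; congr 1; ring
  simp only [this]
  ring

lemma incompleteGamma_one {x : ℝ} : incompleteGamma 1 x = Real.exp (-x) := by
  have h := incompleteGamma_natCast_add_one 0 (x := x)
  simp only [Nat.cast_zero, zero_add, pow_zero, one_mul] at h
  rw [h, integral_exp_neg_Ioi]

/-! ### The weight of an eigenpair -/

lemma norm_sub_mul_sq (z a : ℂ) (p : ℝ) :
    ‖z - a * p‖ ^ 2 = ‖z‖ ^ 2 - p * crossTerm a z + ‖a‖ ^ 2 * p ^ 2 := by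
  simp only [← Complex.normSq_eq_norm_sq, Complex.normSq_apply, crossTerm]
  simp
  ring

/-- Evaluation of the fixed-eigenpair integral. The factor `n!/π^n` is separated because it
normalizes the sphere measure in affine coordinates, and `n + 1` because the joint density carries
`1/N`. -/
lemma ofReal_rankOneJPD_eq {n : ℕ} (a z : ℂ) {s : Fin (n + 1) → ℂ}
    (hs : ∀ i : Fin n, i.val ≠ 0 → s i.succ = 0)
    (hs1 : ∑ i : Fin n, ‖s i.succ‖ ^ 2 = 1 - ‖s 0‖ ^ 2) :
    normalDensity (z - a * ‖s 0‖ ^ 2) * (∏ i : Fin n, normalDensity (a * s i.succ * star (s 0))) *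
        ENNReal.ofReal (∫ t in Set.Ioi (0 : ℝ),
          (∏ i : Fin n, (t + ‖z - a * ‖s i.succ‖ ^ 2‖ ^ 2)) * Real.exp (-t)) =
      ENNReal.ofReal (((n : ℝ) + 1) * (n.factorial / Real.pi ^ n) *
        rankOneJPD (n + 1) a z (‖s 0‖ ^ 2)) := by
  set q := ‖s 0‖ ^ 2 with hq
  have hpi := Real.pi_pos
  have hprod : ∏ i : Fin n, normalDensity (a * s i.succ * star (s 0)) =
      ENNReal.ofReal (Real.pi⁻¹ ^ n * Real.exp (-(‖a‖ ^ 2 * q * (1 - q)))) := by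
    unfold normalDensity
    rw [← ENNReal.ofReal_prod_of_nonneg fun i _ => by positivity, Finset.prod_mul_distrib,
      Finset.prod_const, Finset.card_univ, Fintype.card_fin, ← Real.exp_sum, ← hs1, Finset.mul_sum,
      ← Finset.sum_neg_distrib]
    congr 4
    funext i
    rw [norm_mul, norm_mul, norm_star, hq]
    ring
  have hnorm : normalDensity (z - a * (‖s 0‖ : ℂ) ^ 2) =
      ENNReal.ofReal (Real.pi⁻¹ * Real.exp (-(‖z‖ ^ 2 - q * crossTerm a z + ‖a‖ ^ 2 * q ^ 2))) := by
    rw [normalDensity, ← norm_sub_mul_sq, hq]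
    push_cast
    rfl
  have hint : ∫ t in Set.Ioi (0 : ℝ),
      (∏ i : Fin n, (t + ‖z - a * ‖s i.succ‖ ^ 2‖ ^ 2)) * Real.exp (-t) =
      Real.exp (‖z‖ ^ 2) * (incompleteGamma ((n + 1 : ℕ) : ℝ) (‖z‖ ^ 2) +
        incompleteGamma (((n + 1 : ℕ) : ℝ) - 1) (‖z‖ ^ 2) * (1 - q) *
          (‖a‖ ^ 2 * (1 - q) - crossTerm a z)) := by
    cases n with
    -- For `N = 1` the empty sum in `hs1` forces `q = 1`, so the term with `Γ(0, |z|²)` is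
    -- multiplied by zero.
    | zero =>
      have hq1 : 1 - q = 0 := by rw [← hs1]; simp
      simp only [Finset.univ_eq_empty, Finset.prod_empty, one_mul, hq1]
      rw [integral_exp_neg_Ioi_zero]
      simp [incompleteGamma_one, ← Real.exp_add]
    | succ m =>
      have h0 : ‖s (Fin.succ 0)‖ ^ 2 = 1 - q := by
        rw [← hs1, Fin.sum_univ_succ]
        simp [hs]
      have h1 : ∀ t : ℝ, ∏ i : Fin (m + 1), (t + ‖z - a * (‖s i.succ‖ : ℂ) ^ 2‖ ^ 2) =
          (t + ‖z - a * (1 - q : ℝ)‖ ^ 2) * (t + ‖z‖ ^ 2) ^ m := by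
        intro t
        rw [Fin.prod_univ_succ]
        congr 1
        · rw [← h0]; push_cast; rfl
        · simp [hs]
      simp_rw [h1]
      -- The coefficient of the second Gamma function is `|z - a(1-q)|² - |z|² = (1-q)(|a|²(1-q) -
      -- crossTerm a z)`.
      rw [integral_add_mul_add_pow_mul_exp m (by positivity), norm_sub_mul_sq]
      push_cast
      ring_nf
  rw [hprod, hnorm, hint, ← ENNReal.ofReal_mul (by positivity), ← ENNReal.ofReal_mul (by positivity)]
  congr 1
  unfold rankOneJPD
  have hG : Real.Gamma ((n + 1 : ℕ) : ℝ) = n.factorial := by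
    push_cast; exact Real.Gamma_nat_eq_factorial n
  have hf : (n.factorial : ℝ) ≠ 0 := by positivity
  have hn : (n : ℝ) + 1 ≠ 0 := by positivity
  set Br := incompleteGamma ((n + 1 : ℕ) : ℝ) (‖z‖ ^ 2) +
        incompleteGamma (((n + 1 : ℕ) : ℝ) - 1) (‖z‖ ^ 2) * (1 - q) *
          (‖a‖ ^ 2 * (1 - q) - crossTerm a z)
  -- The exponents are `-|z - aq|²` from the `(0, 0)` entry, `-|a|² q(1-q)` from the rest of the
  -- first column, and `|z|²` from the shift of `t`.
  have hexp : Real.exp (-q * (‖a‖ ^ 2 - crossTerm a z)) =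
      Real.exp (-(‖z‖ ^ 2 - q * crossTerm a z + ‖a‖ ^ 2 * q ^ 2)) *
        Real.exp (-(‖a‖ ^ 2 * q * (1 - q))) * Real.exp (‖z‖ ^ 2) := by
    rw [← Real.exp_add, ← Real.exp_add]; congr 1; ring
  rw [hG, hexp]
  push_cast
  field_simp
  rw [one_div, inv_pow]
  field_simp

/-- The integral over all matrices with a given eigenpair. -/
lemma lintegral_fixed_eigenpair {n : ℕ} (a : ℂ) {r : EuclideanSpace ℂ (Fin (n + 1))} (hr : ‖r‖ = 1)
    (z : ℂ) (u : Fin n → ℂ) :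
    ∫⁻ W : Fin (n + 1) → Fin n → ℂ,
      ENNReal.ofReal (‖(Matrix.of (chartMatrix 0 (joinCols (Fin.cons z u)
        W))).charpoly.derivative.eval z‖ ^ 2) *
      ginibreDensity (Matrix.of (chartMatrix 0 (joinCols (Fin.cons z u) W)) - rankOneNormal a r) =
    ENNReal.ofReal ((1 + ∑ i, ‖u i‖ ^ 2)⁻¹ ^ (n + 1)) *
      ENNReal.ofReal (((n : ℝ) + 1) * (n.factorial / Real.pi ^ n) *
        rankOneJPD (n + 1) a z (‖inner ℂ r (unitDir (Fin.cons 1 u))‖ ^ 2)) := by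
  obtain ⟨U, s, hU, h00, hcol, hU2, hUs, hs, hs0, hs1⟩ := exists_adapted_unitary hr u
  rw [lintegral_chartMatrix_eq hU h00 hcol z fun X =>
    ENNReal.ofReal (‖(Matrix.of X).charpoly.derivative.eval z‖ ^ 2) *
      ginibreDensity (Matrix.of X - rankOneNormal a r), hU2, ← hs0, ← ofReal_rankOneJPD_eq a z hs hs1,
    ← lintegral_bordered hU z a hUs hs]
  rfl

section SphereIntegral

/-! ### Integration over the complex unit sphere -/

/-- Complex polar coordinates use angles in `(-π, π)`, while `phaseMean` uses `[0, 2π)`; periodicity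
reconciles the two. -/
lemma setLIntegral_phase {N : ℕ} (g : EuclideanSpace ℂ (Fin N) → ℝ≥0∞)
    (v : EuclideanSpace ℂ (Fin N)) :
    ∫⁻ θ in Set.Ioo (-Real.pi) Real.pi, g (Complex.exp ((θ : ℝ) * Complex.I) • v) =
      ENNReal.ofReal (2 * Real.pi) * phaseMean g v := by
  have hT : (0 : ℝ) < 2 * Real.pi := by positivity
  have hper : Function.Periodic
      (fun θ : ℝ => g (Complex.exp (θ * Complex.I) • v)) (2 * Real.pi) := by
    intro θ
    have := Complex.exp_mul_I_periodic (θ : ℂ)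
    simp only at this ⊢
    rw [← this]
    push_cast
    rfl
  have h3 := (isAddFundamentalDomain_Ioc hT (-Real.pi) volume).setLIntegral_eq
    (isAddFundamentalDomain_Ioc hT 0 volume)
    (fun θ : ℝ => g (Complex.exp ((θ : ℂ) * Complex.I) • v)) (hper.map_vadd_zmultiples)
  rw [zero_add, show -Real.pi + 2 * Real.pi = Real.pi by ring] at h3
  rw [phaseMean, ← mul_assoc, ENNReal.mul_inv_cancel (by simpa using hT) ENNReal.ofReal_ne_top,
    one_mul, restrict_Ico_eq_restrict_Ioc, ← h3, restrict_Ioo_eq_restrict_Ioc]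

lemma lintegral_radial_gaussian (n : ℕ) {b : ℝ} (hb : 0 < b) :
    ∫⁻ r in Set.Ioi (0 : ℝ), ENNReal.ofReal (r ^ (2 * n + 1) * Real.exp (-b * r ^ 2)) =
      ENNReal.ofReal (n.factorial / 2 * b⁻¹ ^ (n + 1)) := by
  have h := integral_rpow_mul_exp_neg_mul_rpow (p := 2) (q := (2 * n + 1 : ℕ)) (b := b) two_pos
    (lt_of_lt_of_le (by norm_num) (Nat.cast_nonneg _)) hb
  have hG : (((2 * n + 1 : ℕ) : ℝ) + 1) / 2 = (n : ℝ) + 1 := by push_cast; ring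
  have hb' : b ^ (-(((2 * n + 1 : ℕ) : ℝ) + 1) / 2) = b⁻¹ ^ (n + 1) := by
    rw [neg_div, hG, Real.rpow_neg hb.le, inv_pow]
    norm_cast
  rw [hb', hG, Real.Gamma_nat_eq_factorial] at h
  have hc : ∀ r : ℝ, r ^ ((2 * n + 1 : ℕ) : ℝ) * Real.exp (-b * r ^ (2 : ℝ)) =
      r ^ (2 * n + 1) * Real.exp (-b * r ^ 2) := fun r => by
    rw [Real.rpow_natCast]; norm_num
  simp_rw [hc] at h
  have hi : Integrable (fun r : ℝ => r ^ (2 * n + 1) * Real.exp (-b * r ^ 2))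
      (volume.restrict (Set.Ioi 0)) := by
    refine Integrable.of_integral_ne_zero ?_
    rw [h]
    positivity
  rw [← ofReal_integral_eq_lintegral_ofReal hi, h]
  · congr 1; ring
  · filter_upwards [ae_restrict_mem measurableSet_Ioi] with r hr
    have : (0 : ℝ) < r := hr
    positivity

variable {n : ℕ}

/-- Affine coordinates on the projective space: `x = t (1, u)`. -/
lemma lintegral_affine_coordinates {f : (Fin (n + 1) → ℂ) → ℝ≥0∞} (hf : Measurable f) :
    ∫⁻ x, f x = ∫⁻ u : Fin n → ℂ, ∫⁻ t : ℂ,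
      ENNReal.ofReal (‖t‖ ^ (2 * n)) * f (t • (Fin.cons 1 u : Fin (n + 1) → ℂ)) := by
  have hmp := (volume_preserving_piFinSuccAbove (fun _ : Fin (n + 1) => ℂ) 0).symm
  have hcons : ∀ p : ℂ × (Fin n → ℂ),
      (MeasurableEquiv.piFinSuccAbove (fun _ : Fin (n + 1) => ℂ) 0).symm p =
        Fin.cons p.1 p.2 := fun p => by
    simp [MeasurableEquiv.piFinSuccAbove_symm_apply, Fin.insertNthEquiv]
  have hcm : Measurable fun p : ℂ × (Fin n → ℂ) => (Fin.cons p.1 p.2 : Fin (n + 1) → ℂ) := by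
    simp_rw [← hcons]
    exact MeasurableEquiv.measurable _
  rw [← hmp.lintegral_comp_emb (MeasurableEquiv.measurableEmbedding _)]
  simp_rw [hcons]
  rw [Measure.volume_eq_prod, lintegral_prod (fun p : ℂ × (Fin n → ℂ) => f (Fin.cons p.1 p.2)) (hf.comp hcm).aemeasurable]
  have hsm : Measurable fun p : ℂ × (Fin n → ℂ) =>
      ENNReal.ofReal (‖p.1‖ ^ (2 * n)) * f (p.1 • (Fin.cons 1 p.2 : Fin (n + 1) → ℂ)) := by
    refine Measurable.mul (by fun_prop) (hf.comp (measurable_fst.smul ?_))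
    exact hcm.comp (measurable_const.prodMk measurable_snd)
  have hswap : ∫⁻ u : Fin n → ℂ, ∫⁻ t : ℂ,
      ENNReal.ofReal (‖t‖ ^ (2 * n)) * f (t • (Fin.cons 1 u : Fin (n + 1) → ℂ)) =
      ∫⁻ t : ℂ, ∫⁻ u : Fin n → ℂ,
      ENNReal.ofReal (‖t‖ ^ (2 * n)) * f (t • (Fin.cons 1 u : Fin (n + 1) → ℂ)) :=
    (lintegral_lintegral_swap hsm.aemeasurable).symm
  rw [hswap]
  refine lintegral_congr_ae ?_
  -- For fixed `t ≠ 0`, scaling the last `n` coordinates by `t` has real Jacobian `|t|^{2n}`.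
  filter_upwards [compl_mem_ae_iff.2 (measure_singleton (0 : ℂ))] with t ht
  have ht0 : t ≠ 0 := ht
  have hdet : LinearMap.det (t • (LinearMap.id : (Fin n → ℂ) →ₗ[ℂ] (Fin n → ℂ))) = t ^ n := by
    simp
  rw [lintegral_comp_linearMap volume (t • (LinearMap.id : (Fin n → ℂ) →ₗ[ℂ] (Fin n → ℂ)))
    (by rw [hdet]; exact pow_ne_zero _ ht0), hdet, lintegral_const_mul' _ _ ENNReal.ofReal_ne_top]
  congr 1
  · rw [norm_pow, ← pow_mul, mul_comm n 2]
  · refine lintegral_congr fun u => ?_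
    congr 1
    funext i
    refine Fin.cases ?_ (fun i => ?_) i <;> simp

lemma unitDir_smul {N : ℕ} {t : ℂ} (v : Fin N → ℂ) :
    unitDir (t • v) = ((‖t‖⁻¹ : ℝ) * t) • unitDir v := by
  rw [unitDir, unitDir, WithLp.toLp_smul, norm_smul, smul_smul, smul_smul]
  congr 1
  push_cast
  rw [mul_inv]
  ring

/-- With `x = t (1, u)`, the direction of `x` depends on `u` and the phase of `t` only. The modulus
of `t` integrates to `n!/2 · (1 + |u|²)^{-(n+1)}` and the phase to `2π` times the phase mean. -/
lemma lintegral_gaussian_unitDir {g : EuclideanSpace ℂ (Fin (n + 1)) → ℝ≥0∞} (hg : Measurable g) :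
    ∫⁻ x : Fin (n + 1) → ℂ, g (unitDir x) * ENNReal.ofReal (Real.exp (-∑ i, ‖x i‖ ^ 2)) =
      ENNReal.ofReal (Real.pi * n.factorial) * ∫⁻ u : Fin n → ℂ,
        phaseMean g (unitDir (Fin.cons 1 u)) *
          ENNReal.ofReal ((1 + ∑ i, ‖u i‖ ^ 2)⁻¹ ^ (n + 1)) := by
  have hm : Measurable fun x : Fin (n + 1) → ℂ =>
      g (unitDir x) * ENNReal.ofReal (Real.exp (-∑ i, ‖x i‖ ^ 2)) :=
    (hg.comp measurable_unitDir).mul (by fun_prop)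
  rw [lintegral_affine_coordinates hm, ← lintegral_const_mul' _ _ ENNReal.ofReal_ne_top]
  refine lintegral_congr fun u => ?_
  set v : Fin (n + 1) → ℂ := Fin.cons 1 u with hv
  set b : ℝ := 1 + ∑ i, ‖u i‖ ^ 2 with hb
  have hb0 : 0 < b := by positivity
  rw [← Complex.lintegral_comp_polarCoord_symm]
  have hval : ∀ p ∈ polarCoord.target, ENNReal.ofReal p.1 •
      (ENNReal.ofReal (‖Complex.polarCoord.symm p‖ ^ (2 * n)) *
        (g (unitDir (Complex.polarCoord.symm p • v)) *
          ENNReal.ofReal (Real.exp (-∑ i, ‖(Complex.polarCoord.symm p • v) i‖ ^ 2)))) =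
      ENNReal.ofReal (p.1 ^ (2 * n + 1) * Real.exp (-b * p.1 ^ 2)) *
        g (Complex.exp (p.2 * Complex.I) • unitDir v) := by
    rintro ⟨r, θ⟩ hp
    have hr : 0 < r := hp.1
    have hpol : Complex.polarCoord.symm (r, θ) = r * Complex.exp (θ * Complex.I) := by
      rw [Complex.polarCoord_symm_apply, Complex.exp_mul_I, Complex.ofReal_cos, Complex.ofReal_sin]
    have hnorm : ‖Complex.polarCoord.symm (r, θ)‖ = r := by
      rw [hpol, norm_mul, Complex.norm_exp_ofReal_mul_I, Complex.norm_real, mul_one,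
        Real.norm_of_nonneg hr.le]
    have hdir : ((‖Complex.polarCoord.symm (r, θ)‖⁻¹ : ℝ) : ℂ) * Complex.polarCoord.symm (r, θ) =
        Complex.exp (θ * Complex.I) := by
      have : (r : ℂ) ≠ 0 := by exact_mod_cast hr.ne'
      rw [hnorm, hpol]
      push_cast
      rw [← mul_assoc, inv_mul_cancel₀ this, one_mul]
    have hsum : ∑ i, ‖(Complex.polarCoord.symm (r, θ) • v) i‖ ^ 2 = b * r ^ 2 := by
      simp_rw [Pi.smul_apply, norm_smul, hnorm, mul_pow]
      rw [← Finset.mul_sum, Fin.sum_univ_succ, mul_comm]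
      simp [hv, hb]
    rw [unitDir_smul, hdir, hsum, hnorm, smul_eq_mul]
    rw [pow_succ' r (2 * n), mul_assoc r, ENNReal.ofReal_mul hr.le,
      ENNReal.ofReal_mul (by positivity), neg_mul]
    ring
  rw [setLIntegral_congr_fun polarCoord.open_target.measurableSet hval, polarCoord_target,
    Measure.volume_eq_prod, ← Measure.prod_restrict,
    lintegral_prod_mul (f := fun r : ℝ => ENNReal.ofReal (r ^ (2 * n + 1) * Real.exp (-b * r ^ 2)))
      (g := fun θ : ℝ => g (Complex.exp (θ * Complex.I) • unitDir v)) (by fun_prop)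
      (by fun_prop), lintegral_radial_gaussian n hb0, setLIntegral_phase, mul_comm (phaseMean _ _),
    ← mul_assoc, ← mul_assoc, ← ENNReal.ofReal_mul (by positivity),
    ← ENNReal.ofReal_mul (by positivity)]
  congr 2
  ring

lemma lintegral_gaussian (N : ℕ) :
    ∫⁻ x : Fin N → ℂ, ENNReal.ofReal (Real.exp (-∑ i, ‖x i‖ ^ 2)) =
      ENNReal.ofReal (Real.pi ^ N) := by
  have h := lintegral_pi_prod volume (f := fun (_ : Fin N) (z : ℂ) => normalDensity z)
    fun _ => measurable_normalDensity
  simp only [lintegral_normalDensity, Finset.prod_const_one] at h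
  have hx : ∀ x : Fin N → ℂ, ENNReal.ofReal (Real.exp (-∑ i, ‖x i‖ ^ 2)) =
      ENNReal.ofReal (Real.pi ^ N) * ∏ i, normalDensity (x i) := by
    intro x
    unfold normalDensity
    rw [← ENNReal.ofReal_prod_of_nonneg fun i _ => by positivity,
      ← ENNReal.ofReal_mul (by positivity), Finset.prod_mul_distrib, Finset.prod_const,
      Finset.card_univ, Fintype.card_fin, ← Real.exp_sum, Finset.sum_neg_distrib, ← mul_assoc,
      ← mul_pow, mul_inv_cancel₀ Real.pi_ne_zero, one_pow, one_mul]
  simp_rw [hx]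
  rw [lintegral_const_mul' _ _ ENNReal.ofReal_ne_top]
  rw [volume_pi, h, mul_one]

/-- The case `g = 1` of the previous identity, whose left side is the Gaussian integral `π^{n+1}`.
-/
lemma lintegral_fubiniStudy (n : ℕ) :
    ∫⁻ u : Fin n → ℂ, ENNReal.ofReal ((1 + ∑ i, ‖u i‖ ^ 2)⁻¹ ^ (n + 1)) =
      ENNReal.ofReal (Real.pi ^ n / n.factorial) := by
  have h := lintegral_gaussian_unitDir (n := n) (g := fun _ => 1) measurable_const
  simp only [one_mul, lintegral_gaussian] at h
  simp_rw [fun v : EuclideanSpace ℂ (Fin (n + 1)) =>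
    phaseMean_of_invariant (g := fun _ => 1) (v := v) fun _ _ => rfl, one_mul] at h
  have hc : ENNReal.ofReal (Real.pi * n.factorial) ≠ 0 := by
    simp only [ne_eq, ENNReal.ofReal_eq_zero, not_le]
    positivity
  have hk : ENNReal.ofReal (Real.pi ^ (n + 1)) = ENNReal.ofReal (Real.pi * n.factorial) *
      ENNReal.ofReal (Real.pi ^ n / n.factorial) := by
    rw [← ENNReal.ofReal_mul (by positivity)]
    congr 1
    field_simp
    ring
  rw [hk] at h
  exact ((ENNReal.mul_right_inj hc ENNReal.ofReal_ne_top).1 h).symm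

/-- Uniqueness of Haar measure. The value of `c` is not needed, as it cancels wherever the sphere
measure is normalized or a constant is calibrated on a Gaussian. -/
lemma exists_volume_euclidean_eq_smul (N : ℕ) : ∃ c : ℝ≥0∞, c ≠ 0 ∧ c ≠ ∞ ∧
    ∀ f : EuclideanSpace ℂ (Fin N) → ℝ≥0∞,
      ∫⁻ v, f v = c * ∫⁻ x : Fin N → ℂ, f (WithLp.toLp 2 x) := by
  let e : EuclideanSpace ℂ (Fin N) ≃L[ℝ] (Fin N → ℂ) :=
    (PiLp.continuousLinearEquiv 2 ℝ fun _ : Fin N => ℂ)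
  have hH : (Measure.map e.symm (volume : Measure (Fin N → ℂ))).IsAddHaarMeasure :=
    e.symm.isAddHaarMeasure_map _
  refine ⟨(volume : Measure (EuclideanSpace ℂ (Fin N))).addHaarScalarFactor
    (Measure.map e.symm (volume : Measure (Fin N → ℂ))), ?_, ENNReal.coe_ne_top, fun f => ?_⟩
  · exact ENNReal.coe_ne_zero.2 (Measure.addHaarScalarFactor_pos_of_isAddHaarMeasure _ _).ne'
  · conv_lhs => rw [Measure.isAddLeftInvariant_eq_smul (volume : Measure (EuclideanSpace ℂ (Fin N)))
      (Measure.map e.symm (volume : Measure (Fin N → ℂ)))]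
    rw [lintegral_smul_measure]
    congr 1
    exact lintegral_map_equiv f e.symm.toHomeomorph.toMeasurableEquiv

lemma finrank_euclidean (N : ℕ) : Module.finrank ℝ (EuclideanSpace ℂ (Fin N)) = 2 * N := by
  rw [← Module.finrank_mul_finrank ℝ ℂ, Complex.finrank_real_complex, finrank_euclideanSpace_fin]

/-- Polar coordinates in `ℂ^(n+1)`. -/
lemma lintegral_toSphere_mul {g : EuclideanSpace ℂ (Fin (n + 1)) → ℝ≥0∞} (hg : Measurable g)
    {w : ℝ → ℝ≥0∞} (hw : Measurable w) :
    ∫⁻ v : EuclideanSpace ℂ (Fin (n + 1)), g (((‖v‖⁻¹ : ℝ) : ℂ) • v) * w ‖v‖ =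
      (∫⁻ x, g x.1 ∂(volume : Measure (EuclideanSpace ℂ (Fin (n + 1)))).toSphere) *
        ∫⁻ r in Set.Ioi (0 : ℝ), ENNReal.ofReal (r ^ (2 * n + 1)) * w r := by
  set μ := (volume : Measure (EuclideanSpace ℂ (Fin (n + 1))))
  set F : EuclideanSpace ℂ (Fin (n + 1)) → ℝ≥0∞ := fun v => g (((‖v‖⁻¹ : ℝ) : ℂ) • v) * w ‖v‖
  have hrad : ∫⁻ r : Set.Ioi (0 : ℝ), w r.1 ∂(Measure.volumeIoiPow (2 * n + 1)) =
      ∫⁻ r in Set.Ioi (0 : ℝ), ENNReal.ofReal (r ^ (2 * n + 1)) * w r := by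
    rw [Measure.volumeIoiPow, lintegral_withDensity_eq_lintegral_mul _ (by fun_prop)
      (by fun_prop), ← lintegral_subtype_comap measurableSet_Ioi]
    rfl
  have h0 : ∫⁻ v, F v ∂μ = ∫⁻ v : ({0}ᶜ : Set (EuclideanSpace ℂ (Fin (n + 1)))), F v.1
      ∂(μ.comap Subtype.val) := by
    rw [lintegral_subtype_comap (measurableSet_singleton _).compl, restrict_compl_singleton]
  rw [h0]
  have hmp := μ.measurePreserving_homeomorphUnitSphereProd
  rw [finrank_euclidean, show 2 * (n + 1) - 1 = 2 * n + 1 by omega] at hmp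
  rw [← hrad, ← lintegral_prod_mul (by fun_prop) (by fun_prop), ← hmp.lintegral_comp_emb
    (Homeomorph.measurableEmbedding _)]
  refine lintegral_congr fun v => ?_
  simp only [F, homeomorphUnitSphereProd_apply_fst_coe, homeomorphUnitSphereProd_apply_snd_coe]
  congr 2

lemma lintegral_radial_gaussian_one (n : ℕ) :
    ∫⁻ r in Set.Ioi (0 : ℝ), ENNReal.ofReal (r ^ (2 * n + 1)) *
      ENNReal.ofReal (Real.exp (-r ^ 2)) = ENNReal.ofReal (n.factorial / 2) := by
  have h := lintegral_radial_gaussian n one_pos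
  simp only [inv_one, one_pow, mul_one, neg_mul, one_mul] at h
  rw [← h]
  refine setLIntegral_congr_fun measurableSet_Ioi fun r hr => ?_
  have : (0 : ℝ) < r := hr
  rw [ENNReal.ofReal_mul (by positivity)]

/-- The unitarily invariant measure on the sphere in affine coordinates. -/
theorem lintegral_sphereHaar {g : EuclideanSpace ℂ (Fin (n + 1)) → ℝ≥0∞} (hg : Measurable g) :
    ∫⁻ v, g v ∂(sphereHaar (n + 1)) = ENNReal.ofReal (n.factorial / Real.pi ^ n) *
      ∫⁻ u : Fin n → ℂ, phaseMean g (unitDir (Fin.cons 1 u)) *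
        ENNReal.ofReal ((1 + ∑ i, ‖u i‖ ^ 2)⁻¹ ^ (n + 1)) := by
  obtain ⟨c, hc0, hct, hc⟩ := exists_volume_euclidean_eq_smul (n + 1)
  set σ := (volume : Measure (EuclideanSpace ℂ (Fin (n + 1)))).toSphere with hσ
  -- The Gaussian integral of a function of the direction is computed in polar and in affine
  -- coordinates; the radial factor `n!/2` is then cancelled.
  have key : ∀ g : EuclideanSpace ℂ (Fin (n + 1)) → ℝ≥0∞, Measurable g →
      ∫⁻ x, g x.1 ∂σ = (c * ENNReal.ofReal (2 * Real.pi)) *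
        ∫⁻ u : Fin n → ℂ, phaseMean g (unitDir (Fin.cons 1 u)) *
          ENNReal.ofReal ((1 + ∑ i, ‖u i‖ ^ 2)⁻¹ ^ (n + 1)) := by
    intro g hg
    have h1 := lintegral_toSphere_mul hg
      (w := fun r => ENNReal.ofReal (Real.exp (-r ^ 2))) (by fun_prop)
    rw [hc, lintegral_radial_gaussian_one] at h1
    have h2 : ∀ x : Fin (n + 1) → ℂ,
        g (((‖(WithLp.toLp 2 x : EuclideanSpace ℂ (Fin (n + 1)))‖⁻¹ : ℝ) : ℂ) • WithLp.toLp 2 x) *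
          ENNReal.ofReal (Real.exp (-‖(WithLp.toLp 2 x : EuclideanSpace ℂ (Fin (n + 1)))‖ ^ 2)) =
        g (unitDir x) * ENNReal.ofReal (Real.exp (-∑ i, ‖x i‖ ^ 2)) := fun x => by
      rw [EuclideanSpace.norm_sq_eq]; rfl
    simp_rw [h2] at h1
    rw [lintegral_gaussian_unitDir hg] at h1
    have hf : ENNReal.ofReal (n.factorial / 2 : ℝ) ≠ 0 := by
      simp only [ne_eq, ENNReal.ofReal_eq_zero, not_le]
      positivity
    have hk : ENNReal.ofReal (Real.pi * n.factorial) =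
        ENNReal.ofReal (2 * Real.pi) * ENNReal.ofReal (n.factorial / 2 : ℝ) := by
      rw [← ENNReal.ofReal_mul (by positivity)]; congr 1; ring
    refine (ENNReal.mul_left_inj hf ENNReal.ofReal_ne_top).1 ?_
    rw [← h1, hk]
    ring
  -- With `g = 1` the same identity gives the total mass, so `c` and `2π` disappear from the
  -- normalized measure.
  have huniv : σ Set.univ = (c * ENNReal.ofReal (2 * Real.pi)) *
      ENNReal.ofReal (Real.pi ^ n / n.factorial) := by
    have h1 := key (fun _ => 1) measurable_const
    simp_rw [fun v : EuclideanSpace ℂ (Fin (n + 1)) =>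
      phaseMean_of_invariant (g := fun _ => 1) (v := v) fun _ _ => rfl, one_mul] at h1
    rwa [lintegral_fubiniStudy, lintegral_one] at h1
  have hcc : c * ENNReal.ofReal (2 * Real.pi) ≠ 0 := mul_ne_zero hc0 (by simp [Real.pi_pos])
  have hct' : c * ENNReal.ofReal (2 * Real.pi) ≠ ∞ := ENNReal.mul_ne_top hct ENNReal.ofReal_ne_top
  rw [sphereHaar, lintegral_map hg measurable_subtype_coe, lintegral_smul_measure, key g hg, huniv,
    smul_eq_mul, ← mul_assoc]
  congr 1
  rw [ENNReal.mul_inv (Or.inl hcc) (Or.inl hct'), mul_comm, ← mul_assoc,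
    ENNReal.mul_inv_cancel hcc hct', one_mul, ← ENNReal.ofReal_inv_of_pos (by positivity), inv_div]

end SphereIntegral

section OverlapLaw

/-! ### The law of the overlap with a fixed direction -/

lemma ofReal_factorial_div_two_ne_zero (n : ℕ) : ENNReal.ofReal (n.factorial / 2 : ℝ) ≠ 0 := by
  simp only [ne_eq, ENNReal.ofReal_eq_zero, not_le]
  positivity

/-- A unitary map preserves both Lebesgue measure and the norm, hence Gaussian integrals of
functions of the direction. Polar coordinates transfer this to the sphere. -/
lemma lintegral_sphereHaar_isometry {n : ℕ}
    (T : EuclideanSpace ℂ (Fin (n + 1)) ≃ₗᵢ[ℂ] EuclideanSpace ℂ (Fin (n + 1)))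
    {g : EuclideanSpace ℂ (Fin (n + 1)) → ℝ≥0∞} (hg : Measurable g) :
    ∫⁻ v, g (T v) ∂(sphereHaar (n + 1)) = ∫⁻ v, g v ∂(sphereHaar (n + 1)) := by
  have hgT : Measurable fun v => g (T v) := hg.comp T.continuous.measurable
  have hw : Measurable fun r : ℝ => ENNReal.ofReal (Real.exp (-r ^ 2)) := by fun_prop
  let T' : EuclideanSpace ℂ (Fin (n + 1)) ≃ₗᵢ[ℝ] EuclideanSpace ℂ (Fin (n + 1)) :=
    { T.toLinearEquiv.restrictScalars ℝ with norm_map' := T.norm_map }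
  have hT' : ∀ v, T' v = T v := fun v => rfl
  have h1 := lintegral_toSphere_mul hg hw
  have h2 := lintegral_toSphere_mul hgT hw
  rw [← T'.measurePreserving.lintegral_comp_emb T'.toHomeomorph.measurableEmbedding] at h1
  simp only [hT', T.norm_map] at h1
  simp only [map_smul] at h2
  rw [h1] at h2
  rw [lintegral_radial_gaussian_one] at h2
  have h3 := (ENNReal.mul_left_inj (ofReal_factorial_div_two_ne_zero n) ENNReal.ofReal_ne_top).1 h2
  rw [sphereHaar, lintegral_map hg measurable_subtype_coe, lintegral_map hgT measurable_subtype_coe,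
    lintegral_smul_measure, lintegral_smul_measure, h3]

/-- Polar coordinates give the identity up to a constant independent of `h`; testing on a Gaussian
determines it without computing the area of the sphere. -/
lemma lintegral_radial (m : ℕ) {h : ℝ → ℝ≥0∞} (hh : Measurable h) :
    ∫⁻ u : Fin (m + 1) → ℂ, h (∑ i, ‖u i‖ ^ 2) =
      ENNReal.ofReal (2 * Real.pi ^ (m + 1) / m.factorial) *
        ∫⁻ r in Set.Ioi (0 : ℝ), ENNReal.ofReal (r ^ (2 * m + 1)) * h (r ^ 2) := by
  obtain ⟨c, hc0, hct, hc⟩ := exists_volume_euclidean_eq_smul (m + 1)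
  set S := (volume : Measure (EuclideanSpace ℂ (Fin (m + 1)))).toSphere Set.univ with hS
  have key : ∀ h : ℝ → ℝ≥0∞, Measurable h → c * ∫⁻ u : Fin (m + 1) → ℂ, h (∑ i, ‖u i‖ ^ 2) =
      S * ∫⁻ r in Set.Ioi (0 : ℝ), ENNReal.ofReal (r ^ (2 * m + 1)) * h (r ^ 2) := by
    intro h hh
    have h1 := lintegral_toSphere_mul (n := m) (g := fun _ => 1) measurable_const
      (w := fun r => h (r ^ 2)) (by fun_prop)
    simp only [one_mul, lintegral_one] at h1
    rw [hc] at h1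
    simp_rw [EuclideanSpace.norm_sq_eq] at h1
    exact h1
  have h1 := key (fun x => ENNReal.ofReal (Real.exp (-x))) (by fun_prop)
  rw [lintegral_gaussian, lintegral_radial_gaussian_one] at h1
  have hf0 := ofReal_factorial_div_two_ne_zero m
  have hk : ENNReal.ofReal (Real.pi ^ (m + 1)) =
      ENNReal.ofReal (2 * Real.pi ^ (m + 1) / m.factorial) * ENNReal.ofReal (m.factorial / 2) := by
    rw [← ENNReal.ofReal_mul (by positivity)]
    congr 1
    field_simp
  rw [hk, ← mul_assoc] at h1
  have h2 := (ENNReal.mul_left_inj hf0 ENNReal.ofReal_ne_top).1 h1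
  refine (ENNReal.mul_right_inj hc0 hct).1 ?_
  rw [key h hh, ← h2, mul_assoc]

/-- The substitution `q = 1/(1 + r²)` maps `(0, ∞)` bijectively onto `(0, 1)`, with `1 - q = r²/(1 +
r²)` and `|dq| = 2r/(1 + r²)² dr`. -/
lemma lintegral_inv_one_add_sq (m : ℕ) {g : ℝ → ℝ≥0∞} :
    ∫⁻ q in Set.Icc (0 : ℝ) 1, g q * ENNReal.ofReal (((m : ℝ) + 1) * (1 - q) ^ m) =
      ENNReal.ofReal (2 * ((m : ℝ) + 1)) * ∫⁻ r in Set.Ioi (0 : ℝ),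
        ENNReal.ofReal (r ^ (2 * m + 1)) *
          (g (1 + r ^ 2)⁻¹ * ENNReal.ofReal ((1 + r ^ 2)⁻¹ ^ (m + 2))) := by
  have hd : ∀ r ∈ Set.Ioi (0 : ℝ), HasDerivWithinAt (fun r : ℝ => (1 + r ^ 2)⁻¹)
      (-(2 * r) / (1 + r ^ 2) ^ 2) (Set.Ioi 0) r := by
    intro r _
    have h1 : HasDerivAt (fun r : ℝ => 1 + r ^ 2) (2 * r) r := by
      simpa using (hasDerivAt_pow 2 r).const_add 1
    exact (h1.inv (by positivity)).hasDerivWithinAt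
  have hinj : Set.InjOn (fun r : ℝ => (1 + r ^ 2)⁻¹) (Set.Ioi 0) := by
    intro x hx y hy hxy
    have h1 : x ^ 2 = y ^ 2 := by
      have := inv_injective hxy
      linarith
    exact (pow_left_inj₀ (le_of_lt hx) (le_of_lt hy) two_ne_zero).1 h1
  have himg : (fun r : ℝ => (1 + r ^ 2)⁻¹) '' Set.Ioi 0 = Set.Ioo 0 1 := by
    ext q
    constructor
    · rintro ⟨r, hr, rfl⟩
      have : (0 : ℝ) < r := hr
      exact ⟨by positivity, inv_lt_one_of_one_lt₀ (by nlinarith)⟩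
    · rintro ⟨h0, h1⟩
      have hpos : 0 < q⁻¹ - 1 := by
        have := one_lt_inv₀ h0 |>.2 h1
        linarith
      refine ⟨Real.sqrt (q⁻¹ - 1), Real.sqrt_pos.2 hpos, ?_⟩
      simp only [Real.sq_sqrt hpos.le]
      rw [add_sub_cancel, inv_inv]
  rw [← restrict_Ioo_eq_restrict_Icc, ← himg,
    lintegral_image_eq_lintegral_abs_deriv_mul measurableSet_Ioi hd hinj,
    ← lintegral_const_mul' _ _ ENNReal.ofReal_ne_top]
  refine setLIntegral_congr_fun measurableSet_Ioi fun r hr => ?_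
  have hr0 : (0 : ℝ) < r := hr
  have habs : |-(2 * r) / (1 + r ^ 2) ^ 2| = 2 * r / (1 + r ^ 2) ^ 2 := by
    rw [neg_div, abs_neg, abs_of_nonneg (by positivity)]
  have h1q : 1 - (1 + r ^ 2)⁻¹ = r ^ 2 / (1 + r ^ 2) := by
    field_simp
    ring
  simp only [habs, h1q]
  rw [mul_left_comm (ENNReal.ofReal (r ^ (2 * m + 1))), ← ENNReal.ofReal_mul (by positivity),
    mul_left_comm, mul_left_comm (ENNReal.ofReal (2 * ((m : ℝ) + 1))),
    ← ENNReal.ofReal_mul (by positivity), ← ENNReal.ofReal_mul (by positivity)]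
  congr 2
  rw [inv_pow, div_pow]
  field_simp
  ring

/-- By unitary invariance `r` may be taken to be `e₀`. In affine coordinates `q` is then `1/(1 +
|u|²)`, and the integral over `u` is radial. -/
theorem lintegral_sphereHaar_overlap (m : ℕ) {r : EuclideanSpace ℂ (Fin (m + 2))} (hr : ‖r‖ = 1)
    {g : ℝ → ℝ≥0∞} (hg : Measurable g) :
    ∫⁻ v, g (‖inner ℂ r v‖ ^ 2) ∂(sphereHaar (m + 2)) =
      ∫⁻ q in Set.Icc (0 : ℝ) 1, g q * ENNReal.ofReal (((m : ℝ) + 1) * (1 - q) ^ m) := by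
  have hcard : Module.finrank ℂ (EuclideanSpace ℂ (Fin (m + 2))) = Fintype.card (Fin (m + 2)) := by
    simp
  -- Only the first basis vector matters; a constant family makes it `r`.
  let f : Fin (m + 2) → EuclideanSpace ℂ (Fin (m + 2)) := fun _ => r
  let b := InnerProductSpace.gramSchmidtOrthonormalBasis hcard f
  have hf0 : InnerProductSpace.gramSchmidtNormed ℂ f 0 = r := by
    have : InnerProductSpace.gramSchmidt ℂ f 0 = r := InnerProductSpace.gramSchmidt_bot ℂ f
    simp [InnerProductSpace.gramSchmidtNormed, this, hr]
  have hb0 : b 0 = r := by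
    rw [← hf0]
    refine InnerProductSpace.gramSchmidtOrthonormalBasis_apply hcard ?_
    rw [hf0, ← norm_ne_zero_iff, hr]
    exact one_ne_zero
  have hrepr : ∀ v, inner ℂ r v = (b.repr v) 0 := fun v => by
    rw [b.repr_apply_apply, hb0]
  have hG : Measurable fun v : EuclideanSpace ℂ (Fin (m + 2)) => g (‖v 0‖ ^ 2) := by fun_prop
  simp_rw [hrepr]
  rw [lintegral_sphereHaar_isometry b.repr hG, lintegral_sphereHaar hG]
  have hphase : ∀ u : Fin (m + 1) → ℂ,
      phaseMean (fun v : EuclideanSpace ℂ (Fin (m + 2)) => g (‖v 0‖ ^ 2))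
        (unitDir (Fin.cons 1 u)) = g (1 + ∑ i, ‖u i‖ ^ 2)⁻¹ := by
    intro u
    rw [phaseMean_of_invariant fun c hc => by simp [hc]]
    congr 1
    rw [unitDir, PiLp.smul_apply, norm_smul, mul_pow]
    simp [norm_sq_cons_one]
  simp_rw [hphase]
  rw [lintegral_radial m (h := fun x => g (1 + x)⁻¹ * ENNReal.ofReal ((1 + x)⁻¹ ^ (m + 1 + 1)))
    (by fun_prop), lintegral_inv_one_add_sq, ← mul_assoc, ← ENNReal.ofReal_mul (by positivity)]
  congr 2
  rw [Nat.factorial_succ]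
  push_cast
  field_simp

end OverlapLaw

/-! ### Regularity and positivity of the explicit densities -/

lemma measurable_incompleteGamma (s : ℝ) : Measurable (incompleteGamma s) := by
  have h : incompleteGamma s = fun x => ∫ t, (Set.Ioi x).indicator
      (fun t => t ^ (s - 1) * Real.exp (-t)) t := by
    funext x
    rw [incompleteGamma, integral_indicator measurableSet_Ioi]
  rw [h]
  have hs : MeasurableSet {p : ℝ × ℝ | p.1 < p.2} := measurableSet_lt measurable_fst measurable_snd
  have hm : Measurable ({p : ℝ × ℝ | p.1 < p.2}.indicator
      fun p : ℝ × ℝ => p.2 ^ (s - 1) * Real.exp (-p.2)) := by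
    refine Measurable.indicator ?_ hs
    fun_prop
  exact (hm.stronglyMeasurable.integral_prod_right').measurable

lemma continuousOn_incompleteGamma (m : ℕ) :
    ContinuousOn (incompleteGamma ((m : ℝ) + 1)) (Set.Ici 0) := by
  have hc : Continuous fun t : ℝ => t ^ m * Real.exp (-t) := by fun_prop
  have h : ∀ x ∈ Set.Ici (0 : ℝ), incompleteGamma ((m : ℝ) + 1) x =
      (m.factorial : ℝ) - ∫ t in (0 : ℝ)..x, t ^ m * Real.exp (-t) := by
    intro x hx
    rw [incompleteGamma_natCast_add_one, ← (integral_pow_mul_exp_neg m).2,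
      ← intervalIntegral.integral_Ioi_sub_Ioi (integral_pow_mul_exp_neg m).1 hx, sub_sub_cancel]
  refine ContinuousOn.congr (Continuous.continuousOn ?_) h
  exact continuous_const.sub (intervalIntegral.continuous_primitive
    (fun a b => hc.intervalIntegrable a b) 0)

lemma continuous_incompleteGamma_norm_sq (m : ℕ) :
    Continuous fun z : ℂ => incompleteGamma ((m : ℝ) + 1) (‖z‖ ^ 2) :=
  (continuousOn_incompleteGamma m).comp_continuous (by fun_prop) fun z => by
    simp only [Set.mem_Ici]; positivity

lemma incompleteGamma_nonneg (m : ℕ) {x : ℝ} (hx : 0 ≤ x) :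
    0 ≤ incompleteGamma ((m : ℝ) + 1) x := by
  rw [incompleteGamma_natCast_add_one]
  refine setIntegral_nonneg measurableSet_Ioi fun t ht => ?_
  have : 0 < t := lt_of_le_of_lt hx ht
  positivity

/-- On the domain of integration `x ≤ t`. This is what makes the explicit density non-negative. -/
lemma mul_incompleteGamma_le (m : ℕ) {x : ℝ} (hx : 0 ≤ x) :
    x * incompleteGamma ((m : ℝ) + 1) x ≤ incompleteGamma ((m : ℝ) + 1 + 1) x := by
  have hcast : ((m : ℝ) + 1 + 1) = ((m + 1 : ℕ) : ℝ) + 1 := by push_cast; ring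
  rw [hcast, incompleteGamma_natCast_add_one, incompleteGamma_natCast_add_one, ← integral_const_mul]
  refine setIntegral_mono_on ((integrableOn_pow_mul_exp_neg m hx).const_mul _)
    (integrableOn_pow_mul_exp_neg (m + 1) hx) measurableSet_Ioi fun t ht => ?_
  have h0 : 0 < t := lt_of_le_of_lt hx ht
  rw [pow_succ', mul_assoc]
  exact mul_le_mul_of_nonneg_right (le_of_lt ht) (by positivity)

lemma continuous_crossTerm (a : ℂ) : Continuous (crossTerm a) := by
  unfold crossTerm
  fun_prop

lemma measurable_rankOneJPD (N : ℕ) (a : ℂ) :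
    Measurable fun x : ℂ × ℝ => rankOneJPD N a x.1 x.2 := by
  unfold rankOneJPD
  have h1 := measurable_incompleteGamma N
  have h2 := measurable_incompleteGamma ((N : ℝ) - 1)
  have h3 := (continuous_crossTerm a).measurable
  fun_prop

lemma continuous_rankOneJPD (m : ℕ) (a : ℂ) :
    Continuous fun x : ℂ × ℝ => rankOneJPD (m + 2) a x.1 x.2 := by
  unfold rankOneJPD
  have e1 : ((m + 2 : ℕ) : ℝ) = ((m + 1 : ℕ) : ℝ) + 1 := by push_cast; ring
  have e2 : ((m + 2 : ℕ) : ℝ) - 1 = (m : ℝ) + 1 := by push_cast; ring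
  rw [e2]
  simp_rw [e1]
  have h1 : Continuous fun x : ℂ × ℝ => incompleteGamma (((m + 1 : ℕ) : ℝ) + 1) (‖x.1‖ ^ 2) :=
    (continuous_incompleteGamma_norm_sq (m + 1)).comp continuous_fst
  have h2 : Continuous fun x : ℂ × ℝ => incompleteGamma ((m : ℝ) + 1) (‖x.1‖ ^ 2) :=
    (continuous_incompleteGamma_norm_sq m).comp continuous_fst
  have h3 : Continuous fun x : ℂ × ℝ => crossTerm a x.1 :=
    (continuous_crossTerm a).comp continuous_fst
  fun_prop

lemma rankOneJPD_one_one (a z : ℂ) :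
    rankOneJPD 1 a z 1 =
      1 / Real.pi * Real.exp (-(‖a‖ ^ 2 - crossTerm a z)) * Real.exp (-‖z‖ ^ 2) := by
  simp [rankOneJPD, incompleteGamma_one]

/-- From `|z - a(1-q)|² ≥ 0`, the factor of `Γ(N-1, |z|²)` is at least `-|z|²`. The bracket is
therefore at least `Γ(N, |z|²) - |z|² Γ(N-1, |z|²) ≥ 0`. -/
lemma rankOneJPD_nonneg (m : ℕ) (a z : ℂ) (q : ℝ) :
    0 ≤ rankOneJPD (m + 2) a z q := by
  have e1 : ((m + 2 : ℕ) : ℝ) = (m : ℝ) + 1 + 1 := by push_cast; ring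
  have e2 : ((m + 2 : ℕ) : ℝ) - 1 = (m : ℝ) + 1 := by push_cast; ring
  have hx : 0 ≤ ‖z‖ ^ 2 := by positivity
  have hΓ := mul_incompleteGamma_le m hx
  have hΓ0 := incompleteGamma_nonneg m hx
  have hG : 0 < Real.Gamma ((m + 2 : ℕ) : ℝ) := Real.Gamma_pos_of_pos (by positivity)
  have hsq : 0 ≤ ‖z - a * (1 - q : ℝ)‖ ^ 2 := by positivity
  rw [norm_sub_mul_sq] at hsq
  have h2 : -(‖z‖ ^ 2) ≤ (1 - q) * (‖a‖ ^ 2 * (1 - q) - crossTerm a z) := by linarith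
  have h3 := mul_le_mul_of_nonneg_left h2 hΓ0
  unfold rankOneJPD
  refine mul_nonneg (by positivity) ?_
  rw [e2, e1]
  linarith

/-! ### The joint density of an eigenvalue and its eigenvector -/

lemma norm_eq_one_ae_sphereHaar (N : ℕ) : ∀ᵐ v ∂(sphereHaar N), ‖v‖ = 1 := by
  unfold sphereHaar
  rw [ae_map_iff measurable_subtype_coe.aemeasurable (measurableSet_eq_fun (by fun_prop) (by fun_prop))]
  exact .of_forall fun x => by simp

instance sphereHaar_sfinite (N : ℕ) : SFinite (sphereHaar N) := by
  unfold sphereHaar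
  infer_instance

lemma overlap_eq_one {r v : EuclideanSpace ℂ (Fin 1)} (hr : ‖r‖ = 1) (hv : ‖v‖ = 1) :
    ‖inner ℂ r v‖ ^ 2 = 1 := by
  have h : ∀ w : EuclideanSpace ℂ (Fin 1), ‖w‖ = ‖w 0‖ := fun w => by
    rw [EuclideanSpace.norm_eq]; simp
  rw [PiLp.inner_apply]
  simp [← h, hr, hv]

lemma rankOneJPD_overlap_nonneg {n : ℕ} (a z : ℂ) {r v : EuclideanSpace ℂ (Fin (n + 1))}
    (hr : ‖r‖ = 1) (hv : ‖v‖ = 1) : 0 ≤ rankOneJPD (n + 1) a z (‖inner ℂ r v‖ ^ 2) := by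
  cases n with
  | zero =>
    rw [overlap_eq_one hr hv, rankOneJPD_one_one]
    positivity
  | succ m => exact rankOneJPD_nonneg m a z _

lemma continuousOn_rankOneJPD_overlap {n : ℕ} (a : ℂ) {r : EuclideanSpace ℂ (Fin (n + 1))}
    (hr : ‖r‖ = 1) : ContinuousOn (fun x : ℂ × EuclideanSpace ℂ (Fin (n + 1)) =>
      rankOneJPD (n + 1) a x.1 (‖inner ℂ r x.2‖ ^ 2)) {x | ‖x.2‖ = 1} := by
  cases n with
  | zero =>
    have h : ∀ x ∈ {x : ℂ × EuclideanSpace ℂ (Fin 1) | ‖x.2‖ = 1},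
        rankOneJPD (0 + 1) a x.1 (‖inner ℂ r x.2‖ ^ 2) =
          1 / Real.pi * Real.exp (-(‖a‖ ^ 2 - crossTerm a x.1)) * Real.exp (-‖x.1‖ ^ 2) := by
      intro x hx
      rw [overlap_eq_one hr hx]
      exact rankOneJPD_one_one a x.1
    refine ContinuousOn.congr (Continuous.continuousOn ?_) h
    have := continuous_crossTerm a
    fun_prop
  | succ m =>
    have h : Continuous fun x : ℂ × EuclideanSpace ℂ (Fin (m + 2)) =>
        (x.1, ‖inner ℂ r x.2‖ ^ 2) := by fun_prop
    exact ((continuous_rankOneJPD m a).comp h).continuousOn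

lemma measurable_rankOneJPD_overlap {N : ℕ} (a : ℂ) (r : EuclideanSpace ℂ (Fin N)) :
    Measurable fun x : ℂ × EuclideanSpace ℂ (Fin N) =>
      rankOneJPD N a x.1 (‖inner ℂ r x.2‖ ^ 2) := by
  have h : Continuous fun x : ℂ × EuclideanSpace ℂ (Fin N) =>
      (x.1, ‖inner ℂ r x.2‖ ^ 2) := by fun_prop
  exact (measurable_rankOneJPD N a).comp h.measurable

lemma phaseMean_mul_of_invariant {N : ℕ} {g k : EuclideanSpace ℂ (Fin N) → ℝ≥0∞}
    {v : EuclideanSpace ℂ (Fin N)} (hk : ∀ c : ℂ, ‖c‖ = 1 → k (c • v) = k v) (hk' : k v ≠ ∞) :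
    phaseMean (fun w => g w * k w) v = k v * phaseMean g v := by
  unfold phaseMean
  simp_rw [fun θ : ℝ => hk _ (Complex.norm_exp_ofReal_mul_I θ)]
  rw [lintegral_mul_const' _ _ hk']
  ring

/-! ### Fubini over eigenvalue, eigenvector and remaining columns. -/

section

variable {n : ℕ}

lemma lintegral_joinCols {F : (Fin (n + 1) → Fin (n + 1) → ℂ) → ℝ≥0∞} (hF : Measurable F) :
    ∫⁻ Y, F Y = ∫⁻ z : ℂ, ∫⁻ u : Fin n → ℂ, ∫⁻ W : Fin (n + 1) → Fin n → ℂ,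
      F (joinCols (Fin.cons z u) W) := by
  have h1 : MeasurePreserving
      (fun (Y : Fin (n + 1) → ℂ × (Fin n → ℂ)) (i : Fin (n + 1)) =>
        (MeasurableEquiv.piFinSuccAbove (fun _ : Fin (n + 1) => ℂ) 0).symm (Y i)) volume volume :=
    volume_preserving_pi fun _ =>
      (volume_preserving_piFinSuccAbove (fun _ : Fin (n + 1) => ℂ) 0).symm
  have h2 := (volume_measurePreserving_arrowProdEquivProdArrow ℂ (Fin n → ℂ) (Fin (n + 1))).symm
  have h3 := (volume_preserving_piFinSuccAbove (fun _ : Fin (n + 1) => ℂ) 0).symm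
  have hcons : ∀ p : ℂ × (Fin n → ℂ),
      (MeasurableEquiv.piFinSuccAbove (fun _ : Fin (n + 1) => ℂ) 0).symm p =
        Fin.cons p.1 p.2 := fun p => by
    simp [MeasurableEquiv.piFinSuccAbove_symm_apply, Fin.insertNthEquiv]
  have h12 := h1.comp h2
  have hval : ∀ p : (Fin (n + 1) → ℂ) × (Fin (n + 1) → Fin n → ℂ),
      ((fun (Y : Fin (n + 1) → ℂ × (Fin n → ℂ)) (i : Fin (n + 1)) =>
        (MeasurableEquiv.piFinSuccAbove (fun _ : Fin (n + 1) => ℂ) 0).symm (Y i)) ∘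
        (MeasurableEquiv.arrowProdEquivProdArrow ℂ (Fin n → ℂ) (Fin (n + 1))).symm) p =
        joinCols p.1 p.2 := by
    intro p
    funext i
    simp only [Function.comp_apply, hcons]
    rfl
  have hjm : Measurable fun p : (Fin (n + 1) → ℂ) × (Fin (n + 1) → Fin n → ℂ) =>
      joinCols p.1 p.2 := by
    have := h12.measurable
    rwa [funext hval] at this
  rw [← h12.lintegral_comp hF]
  simp_rw [hval]
  rw [Measure.volume_eq_prod, lintegral_prod
    (fun p : (Fin (n + 1) → ℂ) × (Fin (n + 1) → Fin n → ℂ) => F (joinCols p.1 p.2))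
    (hF.comp hjm).aemeasurable]
  have hm : Measurable fun c : Fin (n + 1) → ℂ => ∫⁻ W : Fin (n + 1) → Fin n → ℂ,
      F (joinCols c W) := (hF.comp hjm).lintegral_prod_right'
  rw [← h3.lintegral_comp hm]
  simp_rw [hcons]
  have hm2 : Measurable fun p : ℂ × (Fin n → ℂ) => ∫⁻ W : Fin (n + 1) → Fin n → ℂ,
      F (joinCols (Fin.cons p.1 p.2) W) := by
    have := hm.comp (MeasurableEquiv.piFinSuccAbove (fun _ : Fin (n + 1) => ℂ) 0).symm.measurable
    simpa only [Function.comp_def, hcons] using this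
  rw [Measure.volume_eq_prod, lintegral_prod (fun p : ℂ × (Fin n → ℂ) =>
    ∫⁻ W : Fin (n + 1) → Fin n → ℂ, F (joinCols (Fin.cons p.1 p.2) W)) hm2.aemeasurable]

lemma lintegral_ginibreUE_deformed {N : ℕ} (A : Matrix (Fin N) (Fin N) ℂ)
    (Φ : Matrix (Fin N) (Fin N) ℂ → ℝ≥0∞) :
    ∫⁻ G, Φ (deformedMatrix A G) ∂(ginibreUE N) =
      ∫⁻ X : Fin N → Fin N → ℂ, ginibreDensity (Matrix.of X - A) * Φ (Matrix.of X) := by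
  rw [lintegral_ginibreUE]
  let A' : Fin N → Fin N → ℂ := fun i j => A i j
  rw [← lintegral_add_right_eq_self
    (fun X : Fin N → Fin N → ℂ => ginibreDensity (Matrix.of X - A) * Φ (Matrix.of X)) A']
  refine lintegral_congr fun X => ?_
  have h1 : Matrix.of (X + A') = deformedMatrix A X := rfl
  have h2 : Matrix.of (X + A') - A = Matrix.of X := by
    rw [h1, deformedMatrix, add_sub_cancel_right]
  rw [h2, h1]
  rfl

lemma chartVec_joinCols (z : ℂ) (u : Fin n → ℂ) (W : Fin (n + 1) → Fin n → ℂ) :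
    chartVec 0 (joinCols (Fin.cons z u) W) = Fin.cons 1 u := by
  funext i
  refine Fin.cases ?_ (fun i => ?_) i <;> simp [chartVec]

/-- Written as the determinant of `derivative_charpoly_eval`, this is a continuous function of `Y`.
-/
lemma measurable_derivative_charpoly_eval :
    Measurable fun Y : Fin (n + 1) → Fin (n + 1) → ℂ =>
      (Matrix.of (chartMatrix 0 Y)).charpoly.derivative.eval (Y 0 0) := by
  have h : ∀ Y : Fin (n + 1) → Fin (n + 1) → ℂ,
      (Matrix.of (chartMatrix 0 Y)).charpoly.derivative.eval (Y 0 0) =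
        (Matrix.updateCol (Y 0 0 • (1 : Matrix (Fin (n + 1)) (Fin (n + 1)) ℂ) -
          Matrix.of (chartMatrix 0 Y)) 0 (chartVec 0 Y)).det := fun Y =>
    derivative_charpoly_eval (chartVec_self 0 Y) (chartMatrix_mulVec 0 Y)
  simp_rw [h]
  have hv : Continuous fun Y : Fin (n + 1) → Fin (n + 1) → ℂ => chartVec 0 Y := by
    refine continuous_pi fun i => ?_
    by_cases hi : i = 0
    · simp only [chartVec, hi, if_true]; fun_prop
    · simp only [chartVec, hi, if_false]; fun_prop
  have hc : Continuous fun Y : Fin (n + 1) → Fin (n + 1) → ℂ => Matrix.of (chartMatrix 0 Y) :=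
    (contDiff_chartMatrix 0).continuous
  have h0 : Continuous fun Y : Fin (n + 1) → Fin (n + 1) → ℂ => Y 0 0 := by fun_prop
  exact (Continuous.matrix_det (Continuous.matrix_updateCol 0
    ((h0.smul continuous_const).sub hc) hv)).measurable

/-- In the chart the test function depends on `z` and `u` only, so the remaining columns are
integrated by `lintegral_fixed_eigenpair`. The outcome is `N`, the explicit density, and exactly the
weight and constant by which `lintegral_sphereHaar` expresses the sphere integral in the variable
`u`. -/
theorem lintegral_eigenpair_rankOne (a : ℂ) {r : EuclideanSpace ℂ (Fin (n + 1))} (hr : ‖r‖ = 1)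
    {f : ℂ × EuclideanSpace ℂ (Fin (n + 1)) → ℝ≥0∞} (hf : Measurable f) :
    ∫⁻ G, ∫⁻ x, f x ∂(eigenpairMeasure (deformedMatrix (rankOneNormal a r) G))
        ∂(ginibreUE (n + 1)) =
      ((n + 1 : ℕ) : ℝ≥0∞) * ∫⁻ z : ℂ, ∫⁻ v, f (z, v) *
        ENNReal.ofReal (rankOneJPD (n + 1) a z (‖inner ℂ r v‖ ^ 2)) ∂(sphereHaar (n + 1)) := by
  have hρ : Measurable fun X : Fin (n + 1) → Fin (n + 1) → ℂ =>
      ginibreDensity (Matrix.of X - rankOneNormal a r) :=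
    measurable_ginibreDensity.comp
      ((by fun_prop : Measurable fun (X : Fin (n + 1) → Fin (n + 1) → ℂ) i j =>
        X i j - rankOneNormal a r i j))
  have hcm : Measurable (chartMatrix 0 : (Fin (n + 1) → Fin (n + 1) → ℂ) → _) :=
    (contDiff_chartMatrix 0).continuous.measurable
  have hvm : Measurable fun Y : Fin (n + 1) → Fin (n + 1) → ℂ => chartVec 0 Y := by
    refine measurable_pi_lambda _ fun i => ?_
    by_cases hi : i = 0
    · simp only [chartVec, hi, if_true]; fun_prop
    · simp only [chartVec, hi, if_false]; fun_prop
  have hm1 : Measurable fun Y : Fin (n + 1) → Fin (n + 1) → ℂ => ENNReal.ofReal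
      (‖(Matrix.of (chartMatrix 0 Y)).charpoly.derivative.eval (Y 0 0)‖ ^ 2) :=
    (measurable_derivative_charpoly_eval.norm.pow_const 2).ennreal_ofReal
  have hm2 : Measurable fun Y : Fin (n + 1) → Fin (n + 1) → ℂ =>
      phaseMean (fun v => f (Y 0 0, v)) (unitDir (chartVec 0 Y)) := by
    have h0 : Measurable fun Y : Fin (n + 1) → Fin (n + 1) → ℂ =>
        (Y 0 0, unitDir (chartVec 0 Y)) :=
      Measurable.prodMk (by fun_prop) (measurable_unitDir.comp hvm)
    exact (measurable_phaseMean hf).comp h0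
  have hF : Measurable fun Y : Fin (n + 1) → Fin (n + 1) → ℂ => ENNReal.ofReal
      (‖(Matrix.of (chartMatrix 0 Y)).charpoly.derivative.eval (Y 0 0)‖ ^ 2) *
      (ginibreDensity (Matrix.of (chartMatrix 0 Y) - rankOneNormal a r) *
        phaseMean (fun v => f (Y 0 0, v)) (unitDir (chartVec 0 Y))) :=
    hm1.mul ((hρ.comp hcm).mul hm2)
  rw [lintegral_ginibreUE_deformed _ fun X => ∫⁻ x, f x ∂(eigenpairMeasure X),
    lintegral_eigenpair_eq 0 hf hρ]
  refine (lintegral_joinCols hF).trans ?_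
  rw [← lintegral_const_mul' _ _ (ENNReal.natCast_ne_top _)]
  refine lintegral_congr fun z => ?_
  have hfz : Measurable fun v : EuclideanSpace ℂ (Fin (n + 1)) => f (z, v) * ENNReal.ofReal
      (rankOneJPD (n + 1) a z (‖inner ℂ r v‖ ^ 2)) :=
    (hf.comp measurable_prodMk_left).mul
      ((measurable_rankOneJPD_overlap a r).comp measurable_prodMk_left).ennreal_ofReal
  rw [lintegral_sphereHaar hfz, ← mul_assoc, ← lintegral_const_mul' _ _
    (ENNReal.mul_ne_top (ENNReal.natCast_ne_top _) ENNReal.ofReal_ne_top)]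
  refine lintegral_congr fun u => ?_
  -- The explicit density sees `v` through `q`, which ignores phases, so it leaves the phase mean as
  -- a factor.
  have hinv : ∀ c : ℂ, ‖c‖ = 1 →
      ENNReal.ofReal (rankOneJPD (n + 1) a z (‖inner ℂ r (c • unitDir (Fin.cons 1 u))‖ ^ 2)) =
      ENNReal.ofReal (rankOneJPD (n + 1) a z (‖inner ℂ r (unitDir (Fin.cons 1 u))‖ ^ 2)) :=
    fun c hc => by rw [inner_smul_right, norm_mul, hc, one_mul]
  rw [phaseMean_mul_of_invariant (g := fun v => f (z, v)) (k := fun v => ENNReal.ofReal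
    (rankOneJPD (n + 1) a z (‖inner ℂ r v‖ ^ 2))) hinv ENNReal.ofReal_ne_top]
  have hjm : Measurable fun W : Fin (n + 1) → Fin n → ℂ => joinCols (Fin.cons z u) W :=
    measurable_joinCols _
  have hW : ∀ W : Fin (n + 1) → Fin n → ℂ,
      ENNReal.ofReal (‖(Matrix.of (chartMatrix 0 (joinCols (Fin.cons z u)
        W))).charpoly.derivative.eval (joinCols (Fin.cons z u) W 0 0)‖ ^ 2) *
      (ginibreDensity (Matrix.of (chartMatrix 0 (joinCols (Fin.cons z u) W)) - rankOneNormal a r) *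
        phaseMean (fun v => f (joinCols (Fin.cons z u) W 0 0, v))
          (unitDir (chartVec 0 (joinCols (Fin.cons z u) W)))) =
      (ENNReal.ofReal (‖(Matrix.of (chartMatrix 0 (joinCols (Fin.cons z u)
        W))).charpoly.derivative.eval z‖ ^ 2) *
      ginibreDensity (Matrix.of (chartMatrix 0 (joinCols (Fin.cons z u) W)) -
        rankOneNormal a r)) * phaseMean (fun v => f (z, v)) (unitDir (Fin.cons 1 u)) := by
    intro W
    rw [chartVec_joinCols, joinCols_zero, Fin.cons_zero, mul_assoc]
  have hmW : Measurable fun W : Fin (n + 1) → Fin n → ℂ =>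
      ENNReal.ofReal (‖(Matrix.of (chartMatrix 0 (joinCols (Fin.cons z u)
        W))).charpoly.derivative.eval z‖ ^ 2) *
      ginibreDensity (Matrix.of (chartMatrix 0 (joinCols (Fin.cons z u) W)) -
        rankOneNormal a r) :=
    (hm1.comp hjm).mul ((hρ.comp hcm).comp hjm)
  have hcoef : ENNReal.ofReal (((n : ℝ) + 1) * (n.factorial / Real.pi ^ n) *
      rankOneJPD (n + 1) a z (‖inner ℂ r (unitDir (Fin.cons 1 u))‖ ^ 2)) =
      ((n + 1 : ℕ) : ℝ≥0∞) * ENNReal.ofReal (n.factorial / Real.pi ^ n) *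
        ENNReal.ofReal (rankOneJPD (n + 1) a z (‖inner ℂ r (unitDir (Fin.cons 1 u))‖ ^ 2)) := by
    rw [ENNReal.ofReal_mul (by positivity), ENNReal.ofReal_mul (by positivity)]
    congr 2
    rw [← Nat.cast_succ, ENNReal.ofReal_natCast]
  refine (lintegral_congr hW).trans ?_
  rw [lintegral_mul_const _ hmW, lintegral_fixed_eigenpair a hr z u, hcoef]
  ring

end

/-! ### The overlap with the deformation direction and the mean eigenvalue density -/

lemma continuous_rankOneOverlapJPD (m : ℕ) (a z : ℂ) :
    Continuous (rankOneOverlapJPD (m + 2) a z) := by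
  have h : Continuous fun q : ℝ => rankOneJPD (m + 2) a z q :=
    (continuous_rankOneJPD m a).comp (by fun_prop : Continuous fun q : ℝ => (z, q))
  unfold rankOneOverlapJPD
  fun_prop

lemma rankOneOverlapJPD_eq (m : ℕ) (a z : ℂ) (q : ℝ) :
    rankOneOverlapJPD (m + 2) a z q = ((m : ℝ) + 1) * (1 - q) ^ m * rankOneJPD (m + 2) a z q := by
  rw [rankOneOverlapJPD, Nat.add_sub_cancel]
  push_cast
  ring

lemma rankOneOverlapJPD_nonneg (m : ℕ) (a z : ℂ) {q : ℝ} (hq : q ≤ 1) :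
    0 ≤ rankOneOverlapJPD (m + 2) a z q := by
  rw [rankOneOverlapJPD_eq]
  have := rankOneJPD_nonneg m a z q
  have : 0 ≤ 1 - q := by linarith
  positivity

lemma measurable_rankOneOverlapJPD (N : ℕ) (a : ℂ) :
    Measurable fun x : ℂ × ℝ => rankOneOverlapJPD N a x.1 x.2 := by
  have := measurable_rankOneJPD N a
  unfold rankOneOverlapJPD
  fun_prop

lemma lintegral_sphereHaar_mul_rankOneJPD (m : ℕ) (a z : ℂ)
    {r : EuclideanSpace ℂ (Fin (m + 2))} (hr : ‖r‖ = 1) {g : ℝ → ℝ≥0∞} (hg : Measurable g) :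
    ∫⁻ v, g (‖inner ℂ r v‖ ^ 2) * ENNReal.ofReal (rankOneJPD (m + 2) a z (‖inner ℂ r v‖ ^ 2))
        ∂(sphereHaar (m + 2)) =
      ∫⁻ q in Set.Icc (0 : ℝ) 1, g q * ENNReal.ofReal (rankOneOverlapJPD (m + 2) a z q) := by
  have hJ : Measurable fun q : ℝ => rankOneJPD (m + 2) a z q :=
    (measurable_rankOneJPD (m + 2) a).comp measurable_prodMk_left
  rw [lintegral_sphereHaar_overlap m hr (g := fun q => g q *
    ENNReal.ofReal (rankOneJPD (m + 2) a z q)) (hg.mul hJ.ennreal_ofReal)]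
  refine setLIntegral_congr_fun measurableSet_Icc fun q hq => ?_
  have : 0 ≤ 1 - q := by linarith [hq.2]
  rw [rankOneOverlapJPD_eq, ENNReal.ofReal_mul (q := rankOneJPD (m + 2) a z q) (by positivity)]
  ring

lemma integral_sphereHaar_rankOneJPD (m : ℕ) (a z : ℂ) {r : EuclideanSpace ℂ (Fin (m + 2))}
    (hr : ‖r‖ = 1) :
    ∫ v, rankOneJPD (m + 2) a z (‖inner ℂ r v‖ ^ 2) ∂(sphereHaar (m + 2)) =
      ∫ q in (0 : ℝ)..1, rankOneOverlapJPD (m + 2) a z q := by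
  have h := lintegral_sphereHaar_mul_rankOneJPD m a z hr (g := fun _ => 1) measurable_const
  simp only [one_mul] at h
  have hm : Measurable fun v : EuclideanSpace ℂ (Fin (m + 2)) =>
      rankOneJPD (m + 2) a z (‖inner ℂ r v‖ ^ 2) := by
    have hq : Continuous fun v : EuclideanSpace ℂ (Fin (m + 2)) => (z, ‖inner ℂ r v‖ ^ 2) := by
      fun_prop
    exact (measurable_rankOneJPD (m + 2) a).comp hq.measurable
  have h0 : ∀ᵐ v ∂(sphereHaar (m + 2)), 0 ≤ rankOneJPD (m + 2) a z (‖inner ℂ r v‖ ^ 2) :=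
    .of_forall fun v => rankOneJPD_nonneg m a z _
  have h1 := integral_eq_lintegral_of_nonneg_ae (μ := sphereHaar (m + 2))
    (f := fun v => rankOneJPD (m + 2) a z (‖inner ℂ r v‖ ^ 2)) h0 hm.aestronglyMeasurable
  have h2 := integral_eq_lintegral_of_nonneg_ae (μ := volume.restrict (Set.Icc (0 : ℝ) 1))
    (f := rankOneOverlapJPD (m + 2) a z) ((ae_restrict_iff' measurableSet_Icc).2
      (.of_forall fun q hq => rankOneOverlapJPD_nonneg m a z hq.2))
    (continuous_rankOneOverlapJPD m a z).aestronglyMeasurable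
  rw [intervalIntegral.integral_of_le zero_le_one, ← integral_Icc_eq_integral_Ioc, h1, h2, h]

/-- Substituting `crossTerm a z = |a|² - δ` turns the factor of `Γ(N-1, |z|²)` into `|a|²(1-q)² + (δ
- |a|²)(1-q)`. The weight `(1-q)^{N-2}` then yields `I^{(2)}` and `I^{(1)}`. -/
lemma rankOneMeanDensity_eq_integral (m : ℕ) (a z : ℂ) :
    rankOneMeanDensity (m + 2) a z =
      ((m + 2 : ℕ) : ℝ) * ∫ q in (0 : ℝ)..1, rankOneOverlapJPD (m + 2) a z q := by
  have hi : ∀ k : ℕ, IntervalIntegrable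
      (fun q : ℝ => Real.exp (-q * deltaParam a z) * (1 - q) ^ (m + k)) volume 0 1 := fun k =>
    Continuous.intervalIntegrable (by fun_prop) _ _
  have hI : ∀ k, overlapIntegral k (m + 2) (deltaParam a z) =
      ∫ q in (0 : ℝ)..1, Real.exp (-q * deltaParam a z) * (1 - q) ^ (m + k) := fun k => by
    rw [overlapIntegral, show m + 2 + k - 2 = m + k by omega]
  have hN : ((m + 2 : ℕ) : ℝ) ≠ 0 := by positivity
  rw [rankOneMeanDensity, hI, hI, hI]
  simp only [← intervalIntegral.integral_const_mul]
  rw [← intervalIntegral.integral_add ((hi 2).const_mul _) ((hi 1).const_mul _),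
    ← intervalIntegral.integral_const_mul, ← intervalIntegral.integral_add ((hi 0).const_mul _)
    (((hi 2).const_mul _).add ((hi 1).const_mul _) |>.const_mul _),
    ← intervalIntegral.integral_const_mul]
  refine intervalIntegral.integral_congr fun q _ => ?_
  have hδ : crossTerm a z = ‖a‖ ^ 2 - deltaParam a z := by rw [deltaParam]; ring
  have hG : Real.Gamma ((m + 2 : ℕ) : ℝ) ≠ 0 := (Real.Gamma_pos_of_pos (by positivity)).ne'
  simp only [rankOneOverlapJPD, rankOneJPD, hδ, Nat.add_sub_cancel, sub_sub_cancel]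
  generalize incompleteGamma ((m + 2 : ℕ) : ℝ) (‖z‖ ^ 2) = A
  generalize incompleteGamma (((m + 2 : ℕ) : ℝ) - 1) (‖z‖ ^ 2) = B
  generalize Real.exp (-q * deltaParam a z) = E
  generalize Real.Gamma ((m + 2 : ℕ) : ℝ) = Γ at hG ⊢
  generalize ((m + 2 : ℕ) : ℝ) = M at hN ⊢
  have := Real.pi_ne_zero
  field_simp
  ring

lemma rankOneMeanDensity_nonneg (m : ℕ) (a z : ℂ) : 0 ≤ rankOneMeanDensity (m + 2) a z := by
  rw [rankOneMeanDensity_eq_integral]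
  exact mul_nonneg (by positivity) (intervalIntegral.integral_nonneg zero_le_one
    fun q hq => rankOneOverlapJPD_nonneg m a z hq.2)

lemma continuous_overlapIntegral (k N : ℕ) : Continuous (overlapIntegral k N) := by
  unfold overlapIntegral
  exact intervalIntegral.continuous_parametric_intervalIntegral_of_continuous'
    (f := fun (δ q : ℝ) => Real.exp (-q * δ) * (1 - q) ^ (N + k - 2)) (by fun_prop) 0 1

lemma continuous_rankOneMeanDensity (m : ℕ) (a : ℂ) :
    Continuous (rankOneMeanDensity (m + 2) a) := by
  unfold rankOneMeanDensity
  have e1 : ((m + 2 : ℕ) : ℝ) = ((m + 1 : ℕ) : ℝ) + 1 := by push_cast; ring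
  have e2 : ((m + 2 : ℕ) : ℝ) - 1 = (m : ℝ) + 1 := by push_cast; ring
  rw [e2]
  simp_rw [e1]
  have h1 := continuous_incompleteGamma_norm_sq (m + 1)
  have h2 := continuous_incompleteGamma_norm_sq m
  have hδ : Continuous fun z => deltaParam a z := by
    have := continuous_crossTerm a
    unfold deltaParam
    fun_prop
  have hI := fun k => (continuous_overlapIntegral k (m + 2)).comp hδ
  simp only [Function.comp_def] at hI
  exact continuous_const.mul ((h1.mul (hI 0)).add
    (h2.mul ((continuous_const.mul (hI 2)).add ((hδ.sub continuous_const).mul (hI 1)))))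

/-- The phase average of a function of `z` alone is the function itself, so the eigenvalue measure
is the `z`-marginal of the eigenpair measure, multiplicities included. -/
lemma lintegral_eigenvalueMeasure {N : ℕ} {f : ℂ → ℝ≥0∞} (hf : Measurable f)
    (X : Matrix (Fin N) (Fin N) ℂ) :
    ∫⁻ z, f z ∂(eigenvalueMeasure X) = ∫⁻ x, f x.1 ∂(eigenpairMeasure X) := by
  rw [eigenvalueMeasure, lintegral_multiset_sum,
    lintegral_eigenpairMeasure (f := fun x => f x.1) (hf.comp measurable_fst)]
  congr 2
  funext z
  rw [lintegral_dirac' _ hf, phaseMean_of_invariant (g := fun _ => f z) fun _ _ => rfl]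

lemma lintegral_smul_eigenpair_rankOne {n : ℕ} (a : ℂ) {r : EuclideanSpace ℂ (Fin (n + 1))}
    (hr : ‖r‖ = 1) {f : ℂ × EuclideanSpace ℂ (Fin (n + 1)) → ℝ≥0∞} (hf : Measurable f) :
    ∫⁻ G, ∫⁻ x, f x ∂(((n + 1 : ℕ) : ℝ≥0∞)⁻¹ •
        eigenpairMeasure (deformedMatrix (rankOneNormal a r) G)) ∂(ginibreUE (n + 1)) =
      ∫⁻ z : ℂ, ∫⁻ v, f (z, v) *
        ENNReal.ofReal (rankOneJPD (n + 1) a z (‖inner ℂ r v‖ ^ 2)) ∂(sphereHaar (n + 1)) := by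
  have h0 : ((n + 1 : ℕ) : ℝ≥0∞) ≠ 0 := by simp
  simp only [lintegral_smul_measure, smul_eq_mul]
  rw [lintegral_const_mul' _ _ (ENNReal.inv_ne_top.2 h0), lintegral_eigenpair_rankOne a hr hf,
    ← mul_assoc, ENNReal.inv_mul_cancel h0 (ENNReal.natCast_ne_top _), one_mul]

/-! ### The three densities and the main theorem. -/

theorem isEigenpairJPD_rankOne {n : ℕ} (a : ℂ) {r : EuclideanSpace ℂ (Fin (n + 1))}
    (hr : ‖r‖ = 1) : IsEigenpairJPD (rankOneNormal a r)
      (fun x => rankOneJPD (n + 1) a x.1 (‖inner ℂ r x.2‖ ^ 2)) := by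
  have hm := measurable_rankOneJPD_overlap a r
  refine ⟨hm, ?_, fun f hf => ?_⟩
  · filter_upwards [Measure.quasiMeasurePreserving_snd.ae (norm_eq_one_ae_sphereHaar (n + 1))]
      with x hx using rankOneJPD_overlap_nonneg a x.1 hr hx
  · rw [lintegral_smul_eigenpair_rankOne a hr hf]
    exact (lintegral_prod (fun x : ℂ × EuclideanSpace ℂ (Fin (n + 1)) => f x *
      ENNReal.ofReal (rankOneJPD (n + 1) a x.1 (‖inner ℂ r x.2‖ ^ 2)))
      (hf.mul hm.ennreal_ofReal).aemeasurable).symm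

theorem isOverlapJPD_rankOne (m : ℕ) (a : ℂ) {r : EuclideanSpace ℂ (Fin (m + 2))}
    (hr : ‖r‖ = 1) : IsOverlapJPD (rankOneNormal a r) r
      (fun x => rankOneOverlapJPD (m + 2) a x.1 x.2) := by
  have hm := measurable_rankOneOverlapJPD (m + 2) a
  have hφ : Measurable fun x : ℂ × EuclideanSpace ℂ (Fin (m + 2)) =>
      (x.1, ‖inner ℂ r x.2‖ ^ 2) := by
    have : Continuous fun x : ℂ × EuclideanSpace ℂ (Fin (m + 2)) =>
      (x.1, ‖inner ℂ r x.2‖ ^ 2) := by fun_prop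
    exact this.measurable
  refine ⟨hm, ?_, fun f hf => ?_⟩
  · have h : ∀ᵐ q : ℝ ∂(volume.restrict (Set.Icc 0 1)), q ∈ Set.Icc (0 : ℝ) 1 :=
      ae_restrict_mem measurableSet_Icc
    filter_upwards [Measure.quasiMeasurePreserving_snd.ae h]
      with x hx using rankOneOverlapJPD_nonneg m a x.1 hx.2
  · simp_rw [lintegral_map hf hφ]
    rw [lintegral_smul_eigenpair_rankOne (f := fun x => f (x.1, ‖inner ℂ r x.2‖ ^ 2)) a hr
      (hf.comp hφ), lintegral_prod (fun x : ℂ × ℝ => f x *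
      ENNReal.ofReal (rankOneOverlapJPD (m + 2) a x.1 x.2))
      (hf.mul hm.ennreal_ofReal).aemeasurable]
    exact lintegral_congr fun z => lintegral_sphereHaar_mul_rankOneJPD m a z hr
      (g := fun q => f (z, q)) (hf.comp measurable_prodMk_left)

theorem isMeanEigenvalueDensity_rankOne (m : ℕ) (a : ℂ) {r : EuclideanSpace ℂ (Fin (m + 2))}
    (hr : ‖r‖ = 1) :
    IsMeanEigenvalueDensity (rankOneNormal a r) (rankOneMeanDensity (m + 2) a) := by
  refine ⟨(continuous_rankOneMeanDensity m a).measurable,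
    .of_forall (rankOneMeanDensity_nonneg m a), fun f hf => ?_⟩
  simp_rw [lintegral_eigenvalueMeasure hf]
  rw [lintegral_eigenpair_rankOne (f := fun x => f x.1) a hr (hf.comp measurable_fst),
    ← lintegral_const_mul' _ _ (ENNReal.natCast_ne_top _)]
  refine lintegral_congr fun z => ?_
  have hint : IntegrableOn (rankOneOverlapJPD (m + 2) a z) (Set.Icc 0 1) :=
    (continuous_rankOneOverlapJPD m a z).continuousOn.integrableOn_Icc
  have hJ : Measurable fun q : ℝ => rankOneOverlapJPD (m + 2) a z q :=
    (continuous_rankOneOverlapJPD m a z).measurable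
  rw [lintegral_sphereHaar_mul_rankOneJPD m a z hr (g := fun _ => f z) measurable_const,
    lintegral_const_mul _ hJ.ennreal_ofReal, ← ofReal_integral_eq_lintegral_ofReal hint
    ((ae_restrict_iff' measurableSet_Icc).2
      (.of_forall fun q hq => rankOneOverlapJPD_nonneg m a z hq.2)),
    rankOneMeanDensity_eq_integral, intervalIntegral.integral_of_le zero_le_one,
    ← integral_Icc_eq_integral_Ioc, ENNReal.ofReal_mul (by positivity), ENNReal.ofReal_natCast]
  ring

theorem mainTheorem12 (N : ℕ) (hN : 1 ≤ N) (a : ℂ) (r : EuclideanSpace ℂ (Fin N))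
    (hr : ‖r‖ = 1) :
    -- the joint probability density of `z` and `v`
    (ContinuousOn
        (fun x : ℂ × EuclideanSpace ℂ (Fin N) => rankOneJPD N a x.1 (‖inner ℂ r x.2‖ ^ 2))
        {x | ‖x.2‖ = 1} ∧
      IsEigenpairJPD (rankOneNormal a r)
        (fun x => rankOneJPD N a x.1 (‖inner ℂ r x.2‖ ^ 2))) ∧
    (2 ≤ N →
      -- the joint probability density of `z` and `q`
      IsOverlapJPD (rankOneNormal a r) r (fun x => rankOneOverlapJPD N a x.1 x.2) ∧
      -- the mean eigenvalue density, and its relation to the joint densities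
      Continuous (rankOneMeanDensity N a) ∧
      IsMeanEigenvalueDensity (rankOneNormal a r) (rankOneMeanDensity N a) ∧
      (∀ z : ℂ,
        rankOneMeanDensity N a z =
          N * ∫ v, rankOneJPD N a z (‖inner ℂ r v‖ ^ 2) ∂(sphereHaar N)) ∧
      (∀ z : ℂ,
        rankOneMeanDensity N a z = N * ∫ q in (0 : ℝ)..1, rankOneOverlapJPD N a z q)) := by
  obtain ⟨n, rfl⟩ : ∃ n, N = n + 1 := ⟨N - 1, by omega⟩
  refine ⟨⟨continuousOn_rankOneJPD_overlap a hr, isEigenpairJPD_rankOne a hr⟩, fun h2 => ?_⟩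
  obtain ⟨m, rfl⟩ : ∃ m, n = m + 1 := ⟨n - 1, by omega⟩
  refine ⟨isOverlapJPD_rankOne m a hr, continuous_rankOneMeanDensity m a,
    isMeanEigenvalueDensity_rankOne m a hr, fun z => ?_, rankOneMeanDensity_eq_integral m a⟩
  rw [integral_sphereHaar_rankOneJPD m a z hr]
  exact rankOneMeanDensity_eq_integral m a z
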